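/- Let $n\ge 0$ and let $M$ be a closed connected smooth manifold of dimension $4n+3$. Suppose that $M$ carries a 3-Sasakian metric, i.e. a Riemannian metric $g$ such that the holonomy group of the metric cone $(M\times(0,\infty),\ \bar g=r^2g+dr^2)$ reduces to $Sp(n+1)$: for a base point $x$ of the cone there is a linear isometry $T_x(M\times(0,\infty))\cong\mathbb{H}^{n+1}$ carrying the holonomy group at $x$ into the group $Sp(n+1)$ of unitary quaternionic matrices. Let $\mathbb{S}^2(\bar g)=\{e_0I+e_1J+e_2K:\ e_0^2+e_1^2+e_2^2=1\}$ be the associated 2-sphere of parallel complex structures on the cone, where $I,J,K$ are the parallel endomorphism fields that extend the multiplications by the unit quaternions $i,j,k$ on $\mathbb{H}^{n+1}$ commuting with $Sp(n+1)$. Let $\mathfrak{j}\in\mathbb{S}^2(\bar g)$ and let $\xi=\ker\alpha_{\mathfrak j}$ be the cooriented contact structure on $M=M\times\{1\}$ defined by the contact form $\alpha_{\mathfrak j}(v)=\bar g(v,\mathfrak{j}\,\partial_r)$. Let $\mathcal{C}(M,\xi)$ be the space, with the $C^\infty$ topology, of all cooriented contact structures $\eta$ on $M$ that are isotopic to $\xi$,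 i.e. $\eta=(\Phi_1)_*\xi$ for a smooth isotopy $(\Phi_t)_{t\in[0,1]}$ of $M$ with $\Phi_0=\mathrm{id}$. Then $$\operatorname{rk}\,\pi_2(\mathcal{C}(M,\xi),\xi)\ \ge\ 1 ,$$ where $\operatorname{rk}$ is the rank of an abelian group, i.e. the maximal number of elements that are linearly independent over $\mathbb{Z}$. -/

import Mathlib

open Set Bundle Topology
open scoped Manifold ContDiff Quaternion Matrix

noncomputable section

/-! ### Smooth 1-forms and the `C^∞` topology -/

section Contact

variable (d : ℕ) (M : Type*) [TopologicalSpace M] [ChartedSpace (EuclideanSpace ℝ (Fin d)) M]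
  [IsManifold (𝓡 d) ∞ M]

/-- Smooth 1-forms on a `d`-dimensional manifold `M`. -/
abbrev OneForm : Type _ :=
  Cₛ^∞⟮𝓡 d; EuclideanSpace ℝ (Fin d) →L[ℝ] ℝ, fun x : M ↦ TangentSpace (𝓡 d) x →L[ℝ] ℝ⟯

variable {d M}

/-- The coordinate expression of a 1-form in the chart centered at `x`: its pullback by the inverse
of the chart (meaningful on the target of the chart). -/
def OneForm.inChart (α : OneForm d M) (x : M) (y : EuclideanSpace ℝ (Fin d)) :
    EuclideanSpace ℝ (Fin d) →L[ℝ] ℝ :=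
  (α ((extChartAt (𝓡 d) x).symm y)).comp
    (mfderiv 𝓘(ℝ, EuclideanSpace ℝ (Fin d)) (𝓡 d) (extChartAt (𝓡 d) x).symm y)

/-- The exterior derivative `(dα)_p (u, v)`, computed in the chart centered at `p`. -/
def OneForm.extDerivAt (α : OneForm d M) (p : M) (u v : TangentSpace (𝓡 d) p) : ℝ :=
  (fderiv ℝ (α.inChart p) (extChartAt (𝓡 d) p p) u : EuclideanSpace ℝ (Fin d) →L[ℝ] ℝ) v
    - (fderiv ℝ (α.inChart p) (extChartAt (𝓡 d) p p) v : EuclideanSpace ℝ (Fin d) →L[ℝ] ℝ) u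

/-- The `C^∞` topology on 1-forms: uniform convergence on compact subsets of charts of all partial
derivatives of the coordinate expressions. -/
instance OneForm.smoothTopology : TopologicalSpace (OneForm d M) :=
  ⨅ (x : M) (k : ℕ), TopologicalSpace.induced
    (fun α : OneForm d M ↦ UniformOnFun.ofFun
      {K : Set (EuclideanSpace ℝ (Fin d)) | IsCompact K ∧ K ⊆ (extChartAt (𝓡 d) x).target}
      (iteratedFDeriv ℝ k (α.inChart x)))
    inferInstance

/-! ### Contact structures -/

/-- `α` is a contact form: it vanishes nowhere and `dα` is nondegenerate on `ker α`; when
`d = 2m + 1` this says that `α ∧ (dα)^m` is a volume form. -/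
def OneForm.IsContact (α : OneForm d M) : Prop :=
  ∀ p : M, α p ≠ 0 ∧ ∀ u : TangentSpace (𝓡 d) p, α p u = 0 →
    (∀ v : TangentSpace (𝓡 d) p, α p v = 0 → α.extDerivAt p u v = 0) → u = 0

variable (d M)

/-- Contact forms, with the `C^∞` topology. -/
abbrev ContactForm : Type _ := {α : OneForm d M // α.IsContact}

/-- Two contact forms define the same cooriented contact structure if they differ by multiplication
by a positive function (which is then automatically smooth). -/
instance ContactForm.setoid : Setoid (ContactForm d M) where
  r α β := ∃ f : M → ℝ, (∀ p, 0 < f p) ∧ ∀ p, β.1 p = f p • α.1 p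
  iseqv :=
    { refl := fun α ↦ ⟨fun _ ↦ 1, fun _ ↦ one_pos, fun p ↦ (one_smul ℝ _).symm⟩
      symm := by
        rintro α β ⟨f, hf, h⟩
        refine ⟨fun p ↦ (f p)⁻¹, fun p ↦ inv_pos.2 (hf p), fun p ↦ ?_⟩
        rw [h p, smul_smul, inv_mul_cancel₀ (hf p).ne', one_smul]
      trans := by
        rintro α β γ ⟨f, hf, h⟩ ⟨f', hf', h'⟩
        refine ⟨fun p ↦ f' p * f p, fun p ↦ mul_pos (hf' p) (hf p), fun p ↦ ?_⟩
        rw [h' p, h p, smul_smul] }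

/-- Cooriented contact structures `ξ = ker α`, i.e. contact forms up to positive functions, with the
`C^∞` (quotient) topology. -/
abbrev ContactStructure : Type _ := Quotient (ContactForm.setoid d M)

variable {d M}

/-- The cooriented contact structure `ker α`. -/
abbrev ContactForm.ker (α : ContactForm d M) : ContactStructure d M :=
  Quotient.mk (ContactForm.setoid d M) α

/-- `η` is isotopic to `ξ`: there is a smooth isotopy `(Φ_t)`, `0 ≤ t ≤ 1`, of `M` starting at the
identity such that `Φ_1` carries `ξ` to `η` (with their coorientations). -/
def ContactStructure.IsIsotopic (ξ η : ContactStructure d M) : Prop :=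
  ∃ Φ : ℝ → M ≃ₘ^∞⟮𝓡 d, 𝓡 d⟯ M,
    ContMDiffOn (𝓘(ℝ, ℝ).prod (𝓡 d)) (𝓡 d) ∞ (fun z : ℝ × M ↦ Φ z.1 z.2) (Icc 0 1 ×ˢ univ) ∧
    (∀ p, Φ 0 p = p) ∧
    ∃ α β : ContactForm d M, α.ker = ξ ∧ β.ker = η ∧
      ∀ (p : M) (v : TangentSpace (𝓡 d) p),
        β.1 (Φ 1 p) (mfderiv (𝓡 d) (𝓡 d) (Φ 1) p v) = α.1 p v

theorem ContactStructure.IsIsotopic.refl (ξ : ContactStructure d M) : ξ.IsIsotopic ξ := by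
  obtain ⟨α, rfl⟩ := Quotient.exists_rep ξ
  refine ⟨fun _ ↦ Diffeomorph.refl (𝓡 d) M ∞, contMDiff_snd.contMDiffOn, fun _ ↦ rfl,
    α, α, rfl, rfl, fun p v ↦ ?_⟩
  have h : mfderiv (𝓡 d) (𝓡 d) (Diffeomorph.refl (𝓡 d) M ∞) p
      = ContinuousLinearMap.id ℝ (TangentSpace (𝓡 d) p) := mfderiv_id
  rw [h]
  rfl

/-- The space `𝒞(M, ξ)` of contact structures isotopic to `ξ`, with the `C^∞` topology. -/
abbrev ContactStructure.IsotopyClass (ξ : ContactStructure d M) : Type _ :=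
  {η : ContactStructure d M // ξ.IsIsotopic η}

/-- `ξ` as a point of `𝒞(M, ξ)`. -/
def ContactStructure.base (ξ : ContactStructure d M) : ξ.IsotopyClass :=
  ⟨ξ, ContactStructure.IsIsotopic.refl ξ⟩

end Contact

/-! ### Levi-Civita parallel transport -/

section Parallel

variable {E : Type*} [NormedAddCommGroup E] [NormedSpace ℝ E] {H : Type*} [TopologicalSpace H]
  (I : ModelWithCorners ℝ E H) {N : Type*} [TopologicalSpace N] [ChartedSpace H N]

/-- The coordinate expression `G_y (u, v)` of a metric tensor `b` in the chart centered at `x`. -/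
def metricInChart (b : ∀ x : N, TangentSpace I x → TangentSpace I x → ℝ) (x : N) (y u v : E) : ℝ :=
  b ((extChartAt I x).symm y) (mfderiv 𝓘(ℝ, E) I (extChartAt I x).symm y u)
    (mfderiv 𝓘(ℝ, E) I (extChartAt I x).symm y v)

/-- The Christoffel symbol of the first kind `G (∇_u v, w)` (`u`, `v`, `w` constant in the
coordinates) at the center of the chart at `x`:
`(∂_u G (v, w) + ∂_v G (u, w) - ∂_w G (u, v)) / 2`. -/
def christoffelAt (b : ∀ x : N, TangentSpace I x → TangentSpace I x → ℝ) (x : N) (u v w : E) : ℝ :=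
  (fderiv ℝ (fun y ↦ metricInChart I b x y v w) (extChartAt I x x) u
    + fderiv ℝ (fun y ↦ metricInChart I b x y u w) (extChartAt I x x) v
    - fderiv ℝ (fun y ↦ metricInChart I b x y u v) (extChartAt I x x) w) / 2

/-- `V`, a curve in the tangent bundle seen as a vector field along its base curve `γ`, is parallel
for the Levi-Civita connection of `b`. At time `t`, in the chart centered at `γ t`, with coordinate
expressions `c` of `γ` and `v` of `V`, the condition is `v' + Γ (c', v) = 0`, which is expressed by
pairing with all vectors `w`. -/
def IsParallelAlong (b : ∀ x : N, TangentSpace I x → TangentSpace I x → ℝ)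
    (V : ℝ → TangentBundle I N) : Prop :=
  ∀ t : ℝ, ∃ c' v' : E,
    HasDerivAt (fun s ↦ extChartAt I (V t).proj (V s).proj) c' t ∧
    HasDerivAt (fun s ↦ (mfderiv I 𝓘(ℝ, E) (extChartAt I (V t).proj) (V s).proj (V s).snd : E))
      v' t ∧
    ∀ w : E, metricInChart I b (V t).proj (extChartAt I (V t).proj (V t).proj) v' w
      + christoffelAt I b (V t).proj c' (V t).snd w = 0

end Parallel

/-! ### The metric cone and 3-Sasakian structures -/

section Sasakian

variable {d : ℕ} {M : Type*} [TopologicalSpace M] [ChartedSpace (EuclideanSpace ℝ (Fin d)) M]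
  [IsManifold (𝓡 d) ∞ M]

/-- The cone metric `r² g + dr²` at a point `x = (p, r)` of `M × ℝ`; the metric cone of `(M, g)` is
the open subset `r > 0` of `M × ℝ` with this metric. -/
def coneMetric (g : ContMDiffRiemannianMetric (𝓡 d) ∞ (EuclideanSpace ℝ (Fin d))
      (fun p : M ↦ TangentSpace (𝓡 d) p)) (x : M × ℝ)
    (u v : TangentSpace ((𝓡 d).prod 𝓘(ℝ, ℝ)) x) : ℝ :=
  x.2 ^ 2 * g.inner x.1 (u : EuclideanSpace ℝ (Fin d) × ℝ).1 (v : EuclideanSpace ℝ (Fin d) × ℝ).1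
    + (u : EuclideanSpace ℝ (Fin d) × ℝ).2 * (v : EuclideanSpace ℝ (Fin d) × ℝ).2

/-- Parallel vector fields along smooth curves in the metric cone. -/
def IsConeParallel (g : ContMDiffRiemannianMetric (𝓡 d) ∞ (EuclideanSpace ℝ (Fin d))
      (fun p : M ↦ TangentSpace (𝓡 d) p))
    (V : ℝ → TangentBundle ((𝓡 d).prod 𝓘(ℝ, ℝ)) (M × ℝ)) : Prop :=
  ContMDiff 𝓘(ℝ, ℝ) ((𝓡 d).prod 𝓘(ℝ, ℝ)) ∞ (fun t ↦ (V t).proj) ∧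
  (∀ t, 0 < (V t).proj.2) ∧ IsParallelAlong ((𝓡 d).prod 𝓘(ℝ, ℝ)) (coneMetric g) V

/-- The holonomy group of the metric cone at `x`: parallel transports along the smooth loops
`γ : [0, 1] → M × (0, ∞)` based at `x`. (Smooth loops give the same group as piecewise smooth ones,
since parallel transport does not change when one slows down at the corners.) -/
def coneHolonomy (g : ContMDiffRiemannianMetric (𝓡 d) ∞ (EuclideanSpace ℝ (Fin d))
      (fun p : M ↦ TangentSpace (𝓡 d) p)) (x : M × ℝ) :
    Set (TangentSpace ((𝓡 d).prod 𝓘(ℝ, ℝ)) x ≃ₗ[ℝ] TangentSpace ((𝓡 d).prod 𝓘(ℝ, ℝ)) x) :=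
  {P | ∃ γ : ℝ → M × ℝ, ∀ v : TangentSpace ((𝓡 d).prod 𝓘(ℝ, ℝ)) x,
    ∃ V : ℝ → TangentBundle ((𝓡 d).prod 𝓘(ℝ, ℝ)) (M × ℝ),
      IsConeParallel g V ∧ (∀ t, (V t).proj = γ t) ∧ V 0 = ⟨x, v⟩ ∧ V 1 = ⟨x, P v⟩}

/-- A reduction to `Sp(n+1)` of the holonomy of the metric cone at the point `x`: an isometry of the
tangent space of the cone with `ℍ^{n+1}` which conjugates the holonomy group into the group
`Sp(n+1)` of unitary quaternionic matrices acting on the left. -/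
structure SpReduction (n : ℕ) (g : ContMDiffRiemannianMetric (𝓡 d) ∞ (EuclideanSpace ℝ (Fin d))
      (fun p : M ↦ TangentSpace (𝓡 d) p)) (x : M × ℝ) where
  /-- The identification with `ℍ^{n+1}`. -/
  frame : TangentSpace ((𝓡 d).prod 𝓘(ℝ, ℝ)) x ≃ₗ[ℝ] (Fin (n + 1) → ℍ[ℝ])
  isometry : ∀ v, coneMetric g x v v = ∑ i, ‖frame v i‖ ^ 2
  holonomy_le : ∀ P ∈ coneHolonomy g x,
    ∃ A ∈ unitary (Matrix (Fin (n + 1)) (Fin (n + 1)) ℍ[ℝ]), ∀ v, frame (P v) = A *ᵥ frame v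

/-- A field of endomorphisms of the tangent spaces of the metric cone is parallel: it maps parallel
vector fields along curves to parallel vector fields. -/
def IsConeParallelEndo (g : ContMDiffRiemannianMetric (𝓡 d) ∞ (EuclideanSpace ℝ (Fin d))
      (fun p : M ↦ TangentSpace (𝓡 d) p))
    (J : ∀ x : M × ℝ, TangentSpace ((𝓡 d).prod 𝓘(ℝ, ℝ)) x →ₗ[ℝ]
      TangentSpace ((𝓡 d).prod 𝓘(ℝ, ℝ)) x) : Prop :=
  ∀ V : ℝ → TangentBundle ((𝓡 d).prod 𝓘(ℝ, ℝ)) (M × ℝ), IsConeParallel g V →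
    IsConeParallel g (fun t ↦ ⟨(V t).proj, J (V t).proj (V t).snd⟩)

/-- `J` belongs to the 2-sphere `{e₀ I + e₁ J + e₂ K}` of complex structures of the metric cone
given by the reduction `φ`: it is parallel, and at the base point it is the multiplication on the
right by a unit imaginary quaternion `q = e₀ i + e₁ j + e₂ k`. -/
def SpReduction.IsComplexStructure {n : ℕ}
    {g : ContMDiffRiemannianMetric (𝓡 d) ∞ (EuclideanSpace ℝ (Fin d))
      (fun p : M ↦ TangentSpace (𝓡 d) p)} {x : M × ℝ} (φ : SpReduction n g x)
    (J : ∀ x : M × ℝ, TangentSpace ((𝓡 d).prod 𝓘(ℝ, ℝ)) x →ₗ[ℝ]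
      TangentSpace ((𝓡 d).prod 𝓘(ℝ, ℝ)) x) : Prop :=
  IsConeParallelEndo g J ∧
  ∃ q : ℍ[ℝ], q.re = 0 ∧ ‖q‖ = 1 ∧ ∀ v i, φ.frame (J x v) i = φ.frame v i * q

/-- `(M, ξ)` is a 3-Sasakian contact manifold: `M` carries a 3-Sasakian metric `g`, i.e. the holonomy
group of the metric cone of `(M, g)` reduces to `Sp(n+1)`, and `ξ = ker α_J`,
`α_J (v) = g (v, J ∂_r)`, for a complex structure `J` in the 2-sphere of complex structures of the
metric cone (`M` being identified with `M × {1}`). -/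
def ContactStructure.IsThreeSasakian (n : ℕ) (ξ : ContactStructure d M) : Prop :=
  ∃ (g : ContMDiffRiemannianMetric (𝓡 d) ∞ (EuclideanSpace ℝ (Fin d))
      (fun p : M ↦ TangentSpace (𝓡 d) p)) (x : M × ℝ) (φ : SpReduction n g x)
    (J : ∀ x : M × ℝ, TangentSpace ((𝓡 d).prod 𝓘(ℝ, ℝ)) x →ₗ[ℝ]
      TangentSpace ((𝓡 d).prod 𝓘(ℝ, ℝ)) x) (α : ContactForm d M),
    0 < x.2 ∧ φ.IsComplexStructure J ∧ α.ker = ξ ∧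
    ∀ (p : M) (v : TangentSpace (𝓡 d) p),
      α.1 p v = coneMetric g (p, 1) ((v, 0) : EuclideanSpace ℝ (Fin d) × ℝ)
        (J (p, 1) ((0, 1) : EuclideanSpace ℝ (Fin d) × ℝ))

end Sasakian

end

open Set Bundle Topology
open scoped Manifold ContDiff Quaternion Matrix

set_option maxSynthPendingDepth 3
set_option synthInstance.maxHeartbeats 200000

noncomputable section

/-! ### The degree of a 2-sphere of idempotent matrices -/

section Degree

open scoped unitInterval Matrix.Norms.L2Operator

variable {ι : Type*} [Fintype ι] [DecidableEq ι]

/-! Every unit imaginary quaternion `q` gives a parallel complex structure J_q of the cone and a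
contact form α_q = ḡ(·, J_q ∂_r) on M. The 2-sphere of contact structures ker α_q lies in the
isotopy class of ξ and represents an element of infinite order in π₂. It is detected by looking at a
contact structure at a single point of M.

Geometry. Multiplications on the right by quaternions commute with the holonomy, so parallel
transport extends them to the whole cone (`SpReduction.quaternionicFields`). Such a field A
satisfies dA = [Γ, A] in coordinates, hence is smooth (`contDiffAt_endoInChart`). Since ∇∂_r is the
identity on the slice r = 1, dα_q = 2ḡ(J_q ·, ·) (`extDerivAt_form`). This makes α_q a contact form
and shows that the Lie derivative of α_b along X_a = J_a ∂_r is 2α_{ab}. The flow of X_a therefore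
rotates the sphere of forms, and any two of its contact structures are isotopic (`isIsotopic_form`).

Detection. Fix p in M. A contact form α gives on T_pM ⊕ ℝ the symplectic form 2 dr ∧ α + dα, with dα
projected to ker α; a positive factor on α only multiplies it by a positive number. Times √-1 its
matrix is Hermitian and invertible, and the projection on the positive eigenspaces depends
continuously on the contact structure (`ContactStructure.continuous_projection`). This is a
continuous map from 𝒞(M, ξ) to idempotent matrices. At ker α_q its value is (1 + √-1 R(q))/2, where
R is the representation of ℍ on the complexified tangent space of the cone (`projection_form`). The
ranges of these projections form a vector bundle over the 2-sphere with nonzero first Chern number.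

The Chern number in elementary terms. A family of idempotents on the square, constant on the
boundary, is conjugated to a constant by a family of invertible matrices. On the top side these
commute with the base idempotent; the determinant of their compression to its range is a loop in ℂ ∖
{0}, and the increment of its logarithm is the degree. It does not depend on the lift, is invariant
under homotopy and is additive, so it is a homomorphism from π₂ to ℂ (`degreeHom`). For the sphere R
itself provides the lift, and the degree is -π√-1 times the size of the matrices
(`degree_sphereLoop`), which is not zero. -/

/-- The intertwiner of two idempotents `p` and `q`. -/
def katoStep (q p : Matrix ι ι ℂ) : Matrix ι ι ℂ := q * p + (1 - q) * (1 - p)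

theorem katoStep_self {p : Matrix ι ι ℂ} (hp : p * p = p) : katoStep p p = 1 := by
  simp only [katoStep, mul_sub, sub_mul, hp, one_mul, mul_one]
  abel

theorem mul_katoStep {p q : Matrix ι ι ℂ} (hp : p * p = p) (hq : q * q = q) :
    q * katoStep q p = katoStep q p * p := by
  simp only [katoStep, mul_add, add_mul, mul_sub, sub_mul, one_mul, mul_one, mul_assoc, hp]
  simp only [← mul_assoc, hq]
  abel

theorem katoStep_mul_katoStep {p q : Matrix ι ι ℂ} (hp : p * p = p) (hq : q * q = q) :
    katoStep p q * katoStep q p = 1 - (q - p) * (q - p) := by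
  have h2 : q * (q * p) = q * p := by rw [← mul_assoc, hq]
  simp only [katoStep, mul_add, add_mul, mul_sub, sub_mul, one_mul, mul_one, mul_assoc, hp, hq, h2]
  abel

/-- By `katoStep_mul_katoStep` the product with the reverse step is `1 - (q - p)²`, a unit as soon
as `q` and `p` are at distance less than 1. -/
theorem det_katoStep_ne_zero {p q : Matrix ι ι ℂ} (hp : p * p = p) (hq : q * q = q)
    (h : ‖q - p‖ < 1) : (katoStep q p).det ≠ 0 := by
  have h1 : IsUnit (katoStep p q * katoStep q p) := by
    rw [katoStep_mul_katoStep hp hq]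
    refine isUnit_one_sub_of_norm_lt_one ((norm_mul_le _ _).trans_lt ?_)
    nlinarith [norm_nonneg (q - p)]
  rw [Matrix.isUnit_iff_isUnit_det, Matrix.det_mul] at h1
  exact (isUnit_of_mul_isUnit_right h1).ne_zero

/-- The composition of the first `j` intertwiners along `F (y, ·)`, stopped at time `t`. -/
def katoLift {Y : Type*} (F : Y × I → Matrix ι ι ℂ) (τ : ℕ → I) (z : Y × I) : ℕ → Matrix ι ι ℂ
  | 0 => 1
  | j + 1 => katoStep (F (z.1, min z.2 (τ (j + 1)))) (F (z.1, min z.2 (τ j))) * katoLift F τ z j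

/-- Compactness of `Y` gives a subdivision of `I` on whose steps all the paths `F (y, ·)` move by
less than 1 in norm; the lift is the product of the corresponding Kato intertwiners. Stopping at
time `t` makes it continuous in `t`. Where the path is constant every factor is `katoStep p p = 1`,
which later yields the boundary conditions on the vertical sides of a square. -/
theorem exists_lift_of_idempotent {Y : Type*} [TopologicalSpace Y] [CompactSpace Y]
    {F : Y × I → Matrix ι ι ℂ} (hF : Continuous F) (hF2 : ∀ z, F z * F z = F z) :
    ∃ L : Y × I → Matrix ι ι ℂ, Continuous L ∧ (∀ z, (L z).det ≠ 0) ∧ (∀ y, L (y, 0) = 1) ∧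
      (∀ y t, F (y, t) * L (y, t) = L (y, t) * F (y, 0)) ∧
      ∀ y, (∀ t, F (y, t) = F (y, 0)) → ∀ t, L (y, t) = 1 := by
  obtain ⟨δ, hδ, hδF⟩ : ∃ δ > 0, ∀ (y : Y) (s t : I), dist s t < δ → ‖F (y, s) - F (y, t)‖ < 1 := by
    let G : C(I, C(Y, Matrix ι ι ℂ)) :=
      -- Seen as a path in the uniform metric of `C(Y, Matrix ι ι ℂ)`, the family is uniformly
      -- continuous on the compact `I`.
      (ContinuousMap.mk (fun z : I × Y ↦ F (z.2, z.1)) (by fun_prop)).curry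
    have hG := CompactSpace.uniformContinuous_of_continuous G.continuous
    obtain ⟨δ, hδ, h⟩ := Metric.uniformContinuous_iff.1 hG 1 one_pos
    refine ⟨δ, hδ, fun y s t hst ↦ ?_⟩
    rw [← dist_eq_norm]
    exact (ContinuousMap.dist_apply_le_dist (f := G s) (g := G t) y).trans_lt (h hst)
  obtain ⟨n, hn⟩ := exists_nat_one_div_lt hδ
  let τ : ℕ → I := fun j ↦ projIcc 0 1 zero_le_one ((j : ℝ) / (n + 1))
  have hτ0 : τ 0 = 0 := by simp [τ]
  have hτn : τ (n + 1) = 1 := by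
    apply projIcc_of_right_le
    rw [Nat.cast_add_one, div_self (by positivity)]
  have hτ : ∀ j, dist (τ (j + 1)) (τ j) < δ := by
    intro j
    refine lt_of_le_of_lt ?_ hn
    rw [Subtype.dist_eq, Real.dist_eq]
    refine (abs_projIcc_sub_projIcc _).trans ?_
    rw [Nat.cast_add_one, ← sub_div, add_sub_cancel_left, abs_of_nonneg (by positivity)]
  refine ⟨fun z ↦ katoLift F τ z (n + 1), ?_, ?_, ?_, ?_, ?_⟩
  · have : ∀ j, Continuous fun z ↦ katoLift F τ z j := by
      intro j
      induction j with
      | zero => exact continuous_const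
      | succ j ih =>
        simp only [katoLift, katoStep]
        fun_prop
    exact this _
  · intro z
    have : ∀ j, (katoLift F τ z j).det ≠ 0 := by
      intro j
      induction j with
      | zero => simp [katoLift]
      | succ j ih =>
        rw [katoLift, Matrix.det_mul]
        refine mul_ne_zero (det_katoStep_ne_zero (hF2 _) (hF2 _) (hδF _ _ _ ?_)) ih
        refine lt_of_le_of_lt ?_ (hτ j)
        rw [Subtype.dist_eq, Subtype.dist_eq, Real.dist_eq, Real.dist_eq]
        have := abs_min_sub_min_le_max (z.2 : ℝ) (τ (j + 1)) z.2 (τ j)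
        simpa using this
    exact this _
  · intro y
    have : ∀ j, katoLift F τ (y, 0) j = 1 := by
      intro j
      induction j with
      | zero => rfl
      | succ j ih =>
        simp [katoLift, katoStep_self (hF2 _), ih]
    exact this _
  · intro y t
    have : ∀ j, F (y, min t (τ j)) * katoLift F τ (y, t) j = katoLift F τ (y, t) j * F (y, 0) := by
      intro j
      induction j with
      | zero => simp [katoLift, hτ0]
      | succ j ih =>
        rw [katoLift, ← mul_assoc, mul_katoStep (hF2 _) (hF2 _), mul_assoc, ih, mul_assoc]
    have h := this (n + 1)
    rwa [hτn, min_eq_left (show t ≤ 1 from t.2.2)] at h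
  · intro y hy t
    have : ∀ j, katoLift F τ (y, t) j = 1 := by
      intro j
      induction j with
      | zero => rfl
      | succ j ih => simp [katoLift, hy (min t _), katoStep_self (hF2 _), ih]
    exact this _

/-- The compression of `g` to the range of `p`, extended by the identity. -/
def compression (p g : Matrix ι ι ℂ) : Matrix ι ι ℂ := p * g * p + (1 - p)

theorem compression_one {p : Matrix ι ι ℂ} (hp : p * p = p) : compression p 1 = 1 := by
  simp [compression, hp]

theorem compression_mul {p g h : Matrix ι ι ℂ} (hp : p * p = p) (hg : p * g = g * p) :
    compression p (g * h) = compression p g * compression p h := by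
  have h1 : ∀ x, p * (p * x) = p * x := fun x ↦ by rw [← mul_assoc, hp]
  have h2 : ∀ x, p * (g * x) = g * (p * x) := fun x ↦ by rw [← mul_assoc, hg, mul_assoc]
  simp only [compression, mul_add, add_mul, mul_sub, sub_mul, mul_one, one_mul, mul_assoc, h1, h2,
    hp]
  abel

theorem commute_nonsing_inv {p q g : Matrix ι ι ℂ} (hg : g.det ≠ 0) (h : p * g = g * q) :
    g⁻¹ * p = q * g⁻¹ := by
  have hu : IsUnit g.det := hg.isUnit
  calc g⁻¹ * p = g⁻¹ * (p * g) * g⁻¹ := by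
        rw [mul_assoc, mul_assoc, Matrix.mul_nonsing_inv _ hu, mul_one]
    _ = q * g⁻¹ := by rw [h, ← mul_assoc, Matrix.nonsing_inv_mul _ hu, one_mul]

theorem det_compression_ne_zero {p g : Matrix ι ι ℂ} (hp : p * p = p) (hg : p * g = g * p)
    (hd : g.det ≠ 0) : (compression p g).det ≠ 0 := by
  have h : compression p g * compression p g⁻¹ = 1 := by
    rw [← compression_mul hp hg, Matrix.mul_nonsing_inv _ hd.isUnit, compression_one hp]
  intro h0
  have := congrArg Matrix.det h
  simp [h0] at this

/-- The increment of a continuous logarithm along a path in `ℂ ∖ {0}` starting at `1`. -/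
def logIncrement (c : C(I, {z : ℂ // z ≠ 0})) (hc : (c 0 : ℂ) = 1) : ℂ :=
  Complex.isCoveringMap_exp.liftPath c 0 (Subtype.ext (by simp [hc])) 1

theorem logIncrement_eq_of_exp {c : C(I, {z : ℂ // z ≠ 0})} (hc : (c 0 : ℂ) = 1) {l : I → ℂ}
    (hl : Continuous l) (h0 : l 0 = 0) (h : ∀ s, Complex.exp (l s) = c s) :
    logIncrement c hc = l 1 := by
  have := (Complex.isCoveringMap_exp.eq_liftPath_iff (γ := c) (e := 0)
    (Subtype.ext (by simp [hc])) (Γ := l)).2 ⟨hl, funext fun s ↦ Subtype.ext (h s), h0⟩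
  exact (congrFun this 1).symm

theorem exists_log (c : C(I, {z : ℂ // z ≠ 0})) (hc : (c 0 : ℂ) = 1) :
    ∃ l : I → ℂ, Continuous l ∧ l 0 = 0 ∧ (∀ s, Complex.exp (l s) = c s) ∧
      l 1 = logIncrement c hc :=
  ⟨_, (Complex.isCoveringMap_exp.liftPath c 0 (Subtype.ext (by simp [hc]))).continuous,
    Complex.isCoveringMap_exp.liftPath_zero _ _ _, fun s ↦
      congrArg Subtype.val (congrFun (Complex.isCoveringMap_exp.liftPath_lifts c 0
        (Subtype.ext (by simp [hc]))) s), rfl⟩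

theorem logIncrement_mul {c c₁ c₂ : C(I, {z : ℂ // z ≠ 0})} (hc : (c 0 : ℂ) = 1)
    (hc₁ : (c₁ 0 : ℂ) = 1) (hc₂ : (c₂ 0 : ℂ) = 1) (h : ∀ s, (c s : ℂ) = c₁ s * c₂ s) :
    logIncrement c hc = logIncrement c₁ hc₁ + logIncrement c₂ hc₂ := by
  obtain ⟨l₁, h₁, h₁0, h₁e, h₁1⟩ := exists_log c₁ hc₁
  obtain ⟨l₂, h₂, h₂0, h₂e, h₂1⟩ := exists_log c₂ hc₂
  rw [logIncrement_eq_of_exp hc (l := fun s ↦ l₁ s + l₂ s) (h₁.add h₂)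
    (by simp [h₁0, h₂0]) (fun s ↦ by rw [Complex.exp_add, h₁e, h₂e, h]), h₁1, h₂1]

/-- Homotopy lifting for the covering `exp`: the homotopy fixes both ends, so the endpoint of the
lift does not move. -/
theorem logIncrement_eq_of_homotopy {c₀ c₁ : C(I, {z : ℂ // z ≠ 0})} (hc₀ : (c₀ 0 : ℂ) = 1)
    (hc₁ : (c₁ 0 : ℂ) = 1) {H : I × I → ℂ} (hH : Continuous H) (hne : ∀ z, H z ≠ 0)
    (h0 : ∀ s, H (0, s) = c₀ s) (h1 : ∀ s, H (1, s) = c₁ s)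
    (hl : ∀ τ, H (τ, 0) = 1) (hr : ∀ τ, H (τ, 1) = 1) :
    logIncrement c₀ hc₀ = logIncrement c₁ hc₁ := by
  refine Complex.isCoveringMap_exp.liftPath_apply_one_eq_of_homotopicRel ⟨?_⟩ 0 _ _
  refine ⟨⟨⟨fun z ↦ ⟨H z, hne z⟩, hH.subtype_mk _⟩, fun s ↦ Subtype.ext (h0 s),
    fun s ↦ Subtype.ext (h1 s)⟩, ?_⟩
  rintro t s (rfl | rfl)
  · exact Subtype.ext ((hl t).trans hc₀.symm)
  · refine Subtype.ext ((hr t).trans ?_)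
    rw [← hr 0, h0]

/-- `L` is a lift of the family of idempotents `F` on the square, based at `p`, to the general
linear group. -/
structure IsFrameLift (F : I × I → Matrix ι ι ℂ) (p : Matrix ι ι ℂ) (L : I × I → Matrix ι ι ℂ) :
    Prop where
  cont : Continuous L
  det_ne_zero : ∀ z, (L z).det ≠ 0
  bottom : ∀ s, L (s, 0) = 1
  left : ∀ t, L (0, t) = 1
  right : ∀ t, L (1, t) = 1
  intertwine : ∀ z, F z * L z = L z * p

theorem IsFrameLift.commute_top {F : I × I → Matrix ι ι ℂ} {p : Matrix ι ι ℂ}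
    {L : I × I → Matrix ι ι ℂ} (hL : IsFrameLift F p L) (hF : ∀ s, F (s, 1) = p) (s : I) :
    p * L (s, 1) = L (s, 1) * p := by
  have := hL.intertwine (s, 1)
  rwa [hF] at this

/-- The loop `det` of the compression of a lift on the top side of the square. -/
def IsFrameLift.loop {F : I × I → Matrix ι ι ℂ} {p : Matrix ι ι ℂ} {L : I × I → Matrix ι ι ℂ}
    (hL : IsFrameLift F p L) (hp : p * p = p) (hF : ∀ s, F (s, 1) = p) :
    C(I, {z : ℂ // z ≠ 0}) where
  toFun s := ⟨(compression p (L (s, 1))).det,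
    det_compression_ne_zero hp (hL.commute_top hF s) (hL.det_ne_zero _)⟩
  continuous_toFun := by
    have := hL.cont
    refine Continuous.subtype_mk ?_ _
    unfold compression
    exact Continuous.matrix_det (by fun_prop)

theorem IsFrameLift.loop_zero {F : I × I → Matrix ι ι ℂ} {p : Matrix ι ι ℂ}
    {L : I × I → Matrix ι ι ℂ} (hL : IsFrameLift F p L) (hp : p * p = p) (hF : ∀ s, F (s, 1) = p) :
    (hL.loop hp hF 0 : ℂ) = 1 := by
  simp [IsFrameLift.loop, hL.left, compression_one hp]

/-- The degree of the family, computed by a lift. -/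
def IsFrameLift.degree {F : I × I → Matrix ι ι ℂ} {p : Matrix ι ι ℂ} {L : I × I → Matrix ι ι ℂ}
    (hL : IsFrameLift F p L) (hp : p * p = p) (hF : ∀ s, F (s, 1) = p) : ℂ :=
  logIncrement (hL.loop hp hF) (hL.loop_zero hp hF)

/-- The quotient `L⁻¹ L'` commutes with `p` on the whole square, not only on the top side. Its
compressed determinant on the side at height `τ`, for `τ` from 0 to 1, contracts the quotient of the
two loops to the constant loop. -/
theorem IsFrameLift.degree_unique {F : I × I → Matrix ι ι ℂ} {p : Matrix ι ι ℂ}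
    {L L' : I × I → Matrix ι ι ℂ} (hL : IsFrameLift F p L) (hL' : IsFrameLift F p L')
    (hp : p * p = p) (hF : ∀ s, F (s, 1) = p) : hL'.degree hp hF = hL.degree hp hF := by
  have hc : ∀ z, p * ((L z)⁻¹ * L' z) = (L z)⁻¹ * L' z * p := fun z ↦ by
    rw [← mul_assoc, ← commute_nonsing_inv (hL.det_ne_zero z) (hL.intertwine z), mul_assoc,
      hL'.intertwine, mul_assoc]
  have hd : ∀ z, ((L z)⁻¹ * L' z).det ≠ 0 := fun z ↦ by
    rw [Matrix.det_mul, Matrix.det_nonsing_inv]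
    exact mul_ne_zero (by simpa using hL.det_ne_zero z) (hL'.det_ne_zero z)
  have hcont : Continuous fun z ↦ (compression p ((L z)⁻¹ * L' z)).det := by
    have h1 : Continuous fun z ↦ (L z)⁻¹ := by
      simp_rw [Matrix.inv_def, Ring.inverse_eq_inv']
      exact (hL.cont.matrix_det.inv₀ hL.det_ne_zero).smul hL.cont.matrix_adjugate
    have h2 := hL'.cont
    unfold compression
    exact Continuous.matrix_det (by fun_prop)
  let c : C(I, {z : ℂ // z ≠ 0}) := ⟨fun s ↦ ⟨(compression p ((L (s, 1))⁻¹ * L' (s, 1))).det,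
    det_compression_ne_zero hp (hc _) (hd _)⟩,
    (hcont.comp (by fun_prop : Continuous fun s : I ↦ (s, (1 : I)))).subtype_mk _⟩
  let c₀ : C(I, {z : ℂ // z ≠ 0}) := ContinuousMap.const I ⟨1, one_ne_zero⟩
  have hc0 : (c 0 : ℂ) = 1 := by simp [c, hL.left, hL'.left, compression_one hp]
  have hz : logIncrement c₀ rfl = logIncrement c hc0 := by
    refine logIncrement_eq_of_homotopy _ _
      (H := fun z ↦ (compression p ((L (z.2, z.1))⁻¹ * L' (z.2, z.1))).det)
      (hcont.comp continuous_swap) (fun z ↦ det_compression_ne_zero hp (hc _) (hd _)) ?_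
      (fun _ ↦ rfl) ?_ ?_
    · intro s
      simp [hL.bottom, hL'.bottom, compression_one hp, c₀]
    · simp [hL.left, hL'.left, compression_one hp]
    · simp [hL.right, hL'.right, compression_one hp]
  have hz' : logIncrement c₀ rfl = 0 :=
    logIncrement_eq_of_exp (l := fun _ ↦ 0) _ continuous_const rfl (by simp [c₀])
  have := logIncrement_mul (hL'.loop_zero hp hF) (hL.loop_zero hp hF) hc0 (fun s ↦ by
    change (compression p (L' (s, 1))).det = (compression p (L (s, 1))).det *
      (compression p ((L (s, 1))⁻¹ * L' (s, 1))).det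
    rw [← Matrix.det_mul, ← compression_mul hp (hL.commute_top hF s), ← mul_assoc,
      Matrix.mul_nonsing_inv _ (hL.det_ne_zero _).isUnit, one_mul])
  rw [IsFrameLift.degree, IsFrameLift.degree, this, ← hz, hz', add_zero]

/-! ### The degree as an invariant of 2-dimensional homotopy classes -/

variable {X : Type*} [TopologicalSpace X] {x : X}

open Topology.Homotopy

/-- The family on the square `I × I` given by a 2-dimensional loop. -/
def squareFamily (P : X → Matrix ι ι ℂ) (f : GenLoop (Fin 2) X x) (z : I × I) : Matrix ι ι ℂ :=
  P (f ![z.1, z.2])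

theorem squareFamily_top (P : X → Matrix ι ι ℂ) (f : GenLoop (Fin 2) X x) (s : I) :
    squareFamily P f (s, 1) = P x := by
  exact congrArg P (GenLoop.boundary f _ ⟨1, Or.inr rfl⟩)

theorem continuous_vecPair : Continuous fun z : I × I ↦ ![z.1, z.2] := by fun_prop

theorem exists_isFrameLift {P : X → Matrix ι ι ℂ} (hP : Continuous P) (hP2 : ∀ y, P y * P y = P y)
    (f : GenLoop (Fin 2) X x) : ∃ L, IsFrameLift (squareFamily P f) (P x) L := by
  have hf : ∀ y : Fin 2 → I, y ∈ Cube.boundary (Fin 2) → P (f y) = P x := fun y hy ↦ by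
    rw [GenLoop.boundary f y hy]
  obtain ⟨L, h1, h2, h3, h4, h5⟩ := exists_lift_of_idempotent (F := squareFamily P f)
    (hP.comp (f.1.continuous.comp continuous_vecPair)) (fun _ ↦ hP2 _)
  have hb : ∀ s, squareFamily P f (s, 0) = P x := fun s ↦ hf _ ⟨1, Or.inl rfl⟩
  have hl : ∀ t, squareFamily P f (0, t) = P x := fun s ↦ hf _ ⟨0, Or.inl rfl⟩
  have hr : ∀ t, squareFamily P f (1, t) = P x := fun s ↦ hf _ ⟨0, Or.inr rfl⟩
  exact ⟨L, h1, h2, h3, h5 0 (fun t ↦ by rw [hl, hl]), h5 1 (fun t ↦ by rw [hr, hr]),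
    fun z ↦ by rw [h4, hb]⟩

/-- The degree of a 2-dimensional loop with respect to a continuous map to the idempotents. -/
def loopDegree {P : X → Matrix ι ι ℂ} (hP : Continuous P) (hP2 : ∀ y, P y * P y = P y)
    (f : GenLoop (Fin 2) X x) : ℂ :=
  (exists_isFrameLift hP hP2 f).choose_spec.degree (hP2 x) (squareFamily_top P f)

theorem loopDegree_eq {P : X → Matrix ι ι ℂ} (hP : Continuous P) (hP2 : ∀ y, P y * P y = P y)
    (f : GenLoop (Fin 2) X x) {L} (hL : IsFrameLift (squareFamily P f) (P x) L) :
    loopDegree hP hP2 f = hL.degree (hP2 x) (squareFamily_top P f) :=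
  IsFrameLift.degree_unique _ _ _ _

/-- The lift is taken over the whole homotopy at once, with parameter space `I × I`. Its slices are
lifts of the intermediate loops, and their top sides form a homotopy of determinant loops relative
to the ends. -/
theorem loopDegree_eq_of_homotopic {P : X → Matrix ι ι ℂ} (hP : Continuous P)
    (hP2 : ∀ y, P y * P y = P y) {f g : GenLoop (Fin 2) X x} (h : GenLoop.Homotopic f g) :
    loopDegree hP hP2 f = loopDegree hP hP2 g := by
  obtain ⟨H⟩ := h
  have hH : ∀ τ, ∀ y ∈ Cube.boundary (Fin 2), P (H (τ, y)) = P x := fun τ y hy ↦ by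
    rw [H.eq_fst τ hy]
    exact congrArg P (GenLoop.boundary f y hy)
  obtain ⟨L, h1, h2, h3, h4, h5⟩ := exists_lift_of_idempotent
    (F := fun z : (I × I) × I ↦ P (H (z.1.1, ![z.1.2, z.2])))
    (hP.comp (H.continuous.comp (by fun_prop))) (fun _ ↦ hP2 _)
  have hb : ∀ τ s, P (H (τ, ![s, 0])) = P x := fun τ s ↦ hH _ _ ⟨1, Or.inl rfl⟩
  have hT : ∀ τ s, P (H (τ, ![s, 1])) = P x := fun τ s ↦ hH _ _ ⟨1, Or.inr rfl⟩
  have hl : ∀ τ t, P (H (τ, ![0, t])) = P x := fun τ s ↦ hH _ _ ⟨0, Or.inl rfl⟩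
  have hr : ∀ τ t, P (H (τ, ![1, t])) = P x := fun τ s ↦ hH _ _ ⟨0, Or.inr rfl⟩
  have hL : ∀ τ, ∀ F : I × I → Matrix ι ι ℂ, (∀ z, F z = P (H (τ, ![z.1, z.2]))) →
      IsFrameLift F (P x) fun z ↦ L ((τ, z.1), z.2) :=
    fun τ F hF ↦ ⟨h1.comp (by fun_prop), fun z ↦ h2 _, fun s ↦ h3 _,
      h5 (τ, 0) (fun t ↦ by simp only [hl]), h5 (τ, 1) (fun t ↦ by simp only [hr]), fun z ↦ by
        have := h4 (τ, z.1) z.2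
        simp only [hb] at this
        rw [hF, this]⟩
  have hf : IsFrameLift (squareFamily P f) (P x) fun z ↦ L ((0, z.1), z.2) :=
    hL 0 _ fun z ↦ by rw [H.apply_zero]; rfl
  have hg : IsFrameLift (squareFamily P g) (P x) fun z ↦ L ((1, z.1), z.2) :=
    hL 1 _ fun z ↦ by rw [H.apply_one]; rfl
  rw [loopDegree_eq hP hP2 f hf, loopDegree_eq hP hP2 g hg]
  refine logIncrement_eq_of_homotopy _ _ (H := fun z ↦ (compression (P x) (L (z, 1))).det)
    ?_ ?_ (fun _ ↦ rfl) (fun _ ↦ rfl) ?_ ?_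
  · unfold compression
    exact Continuous.matrix_det (by fun_prop)
  · rintro ⟨τ, s⟩
    exact det_compression_ne_zero (hP2 x) ((hL τ _ fun _ ↦ rfl).commute_top (hT τ) s) (h2 _)
  · intro τ
    simp [(hL τ _ fun _ ↦ rfl).left 1, compression_one (hP2 x)]
  · intro τ
    simp [(hL τ _ fun _ ↦ rfl).right 1, compression_one (hP2 x)]

/-- A lift of the concatenation follows the lift `L` of `f` and then `L'` multiplied on the right by
the final value `L (s, 1)`. At the top the loop is a product, since compression is multiplicative on
matrices commuting with the idempotent. -/
theorem loopDegree_transAt {P : X → Matrix ι ι ℂ} (hP : Continuous P)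
    (hP2 : ∀ y, P y * P y = P y) (f g : GenLoop (Fin 2) X x) :
    loopDegree hP hP2 (GenLoop.transAt 1 f g) = loopDegree hP hP2 g + loopDegree hP hP2 f := by
  obtain ⟨L, hL⟩ := exists_isFrameLift hP hP2 f
  obtain ⟨L', hL'⟩ := exists_isFrameLift hP hP2 g
  let K : I × I → Matrix ι ι ℂ := fun z ↦
    if (z.2 : ℝ) ≤ 1 / 2 then L (z.1, projIcc 0 1 zero_le_one (2 * z.2))
    else L' (z.1, projIcc 0 1 zero_le_one (2 * z.2 - 1)) * L (z.1, 1)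
  have hc := hL.cont
  have hc' := hL'.cont
  have hmid : ∀ t : I, (t : ℝ) = 1 / 2 → projIcc (0 : ℝ) 1 zero_le_one (2 * t) = 1 ∧
      projIcc (0 : ℝ) 1 zero_le_one (2 * t - 1) = 0 := fun t ht ↦
    ⟨projIcc_of_right_le _ (by linarith), projIcc_of_le_left _ (by linarith)⟩
  have hK : IsFrameLift (squareFamily P (GenLoop.transAt 1 f g)) (P x) K := by
    refine ⟨?_, ?_, ?_, ?_, ?_, ?_⟩
    · refine Continuous.if_le ?_ ?_ (by fun_prop) continuous_const ?_
      · exact hc.comp (continuous_fst.prodMk (continuous_projIcc.comp (by fun_prop)))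
      · exact (hc'.comp (continuous_fst.prodMk (continuous_projIcc.comp (by fun_prop)))).mul
          (hc.comp (by fun_prop))
      · intro z hz
        rw [(hmid _ hz).1, (hmid _ hz).2, hL'.bottom, one_mul]
    · intro z
      simp only [K]
      split_ifs
      · exact hL.det_ne_zero _
      · rw [Matrix.det_mul]
        exact mul_ne_zero (hL'.det_ne_zero _) (hL.det_ne_zero _)
    · intro s
      have : projIcc (0 : ℝ) 1 zero_le_one (2 * ((0 : I) : ℝ)) = 0 :=
        projIcc_of_le_left _ (by simp)
      simp only [K, this]
      rw [if_pos (by simp), hL.bottom]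
    · intro t
      simp [K, hL.left, hL'.left]
    · intro t
      simp [K, hL.right, hL'.right]
    · rintro ⟨s, t⟩
      have hu : ∀ r : I, Function.update ![s, t] 1 r = ![s, r] := fun r ↦ by
        ext i
        fin_cases i <;> simp
      have ht : ∀ y, GenLoop.transAt 1 f g y = if (y 1 : ℝ) ≤ 1 / 2
          then f (Function.update y 1 <| Set.projIcc 0 1 zero_le_one (2 * y 1))
          else g (Function.update y 1 <| Set.projIcc 0 1 zero_le_one (2 * y 1 - 1)) := fun y ↦ rfl
      have e1 : (![s, t] : Fin 2 → I) 1 = t := rfl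
      simp only [squareFamily, ht, K, e1, hu]
      split_ifs
      · exact hL.intertwine (s, projIcc 0 1 zero_le_one (2 * t))
      · have h1 := hL'.intertwine (s, projIcc 0 1 zero_le_one (2 * t - 1))
        rw [squareFamily] at h1
        rw [← mul_assoc, h1, mul_assoc, hL.commute_top (squareFamily_top P f), mul_assoc]
  rw [loopDegree_eq hP hP2 _ hK, loopDegree_eq hP hP2 _ hL, loopDegree_eq hP hP2 _ hL']
  refine logIncrement_mul _ _ _ fun s ↦ ?_
  change (compression (P x) (K (s, 1))).det = (compression (P x) (L' (s, 1))).det *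
    (compression (P x) (L (s, 1))).det
  rw [← Matrix.det_mul, ← compression_mul (hP2 x) (hL'.commute_top (squareFamily_top P g) s)]
  have : projIcc (0 : ℝ) 1 zero_le_one (2 * ((1 : I) : ℝ) - 1) = 1 :=
    projIcc_of_right_le _ (by norm_num)
  simp only [K, this]
  rw [if_neg (by norm_num)]

/-- The degree as a homomorphism on the second homotopy group. -/
def degreeHom {P : X → Matrix ι ι ℂ} (hP : Continuous P) (hP2 : ∀ y, P y * P y = P y) :
    Additive (π_ 2 X x) →+ ℂ :=
  AddMonoidHom.mk' (fun a ↦ Quotient.lift (s := GenLoop.Homotopic.setoid (Fin 2) x)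
    (loopDegree hP hP2) (fun _ _ h ↦ loopDegree_eq_of_homotopic hP hP2 h) a.toMul) (by
    intro a b
    obtain ⟨f, hf⟩ := Quotient.exists_rep a.toMul
    obtain ⟨g, hg⟩ := Quotient.exists_rep b.toMul
    have := HomotopyGroup.mul_spec (i := (1 : Fin 2)) (p := f) (q := g)
    rw [toMul_add, ← hf, ← hg]
    refine (congrArg _ this).trans ?_
    exact loopDegree_transAt hP hP2 g f)

/-- A homomorphism to ℂ kills torsion, so a class of nonzero degree is linearly independent over ℤ.
-/
theorem one_le_rank_of_isFrameLift {P : X → Matrix ι ι ℂ} (hP : Continuous P)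
    (hP2 : ∀ y, P y * P y = P y) (f : GenLoop (Fin 2) X x) {L}
    (hL : IsFrameLift (squareFamily P f) (P x) L) (h : hL.degree (hP2 x) (squareFamily_top P f) ≠ 0) :
    1 ≤ Module.rank ℤ (Additive (π_ 2 X x)) := by
  let a : Additive (π_ 2 X x) :=
    Additive.ofMul (Quotient.mk (GenLoop.Homotopic.setoid (Fin 2) x) f)
  have ha : degreeHom hP hP2 a ≠ 0 := by
    change loopDegree hP hP2 f ≠ 0
    rwa [loopDegree_eq hP hP2 f hL]
  have hli : LinearIndependent ℤ ![a] := by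
    rw [Fintype.linearIndependent_iff]
    intro g hg i
    have h1 : g 0 • a = 0 := by simpa using hg
    have h2 : (g 0 : ℂ) * degreeHom hP hP2 a = 0 := by
      rw [← zsmul_eq_mul, ← map_zsmul, h1, map_zero]
    fin_cases i
    exact_mod_cast (mul_eq_zero.1 h2).resolve_right ha
  simpa using hli.cardinal_lift_le_rank

end Degree

/-! ### Smooth dependence of the solutions of an ODE on the initial value -/

section LocalFlow

open Metric Filter
open scoped NNReal

variable {E : Type*} [NormedAddCommGroup E] [NormedSpace ℝ E]

theorem norm_taylor_le_of_lipschitzOnWith {f : E → E} {f' : E → E →L[ℝ] E} {s : Set E} {K : ℝ≥0}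
    (hs : Convex ℝ s) (hf : ∀ x ∈ s, HasFDerivAt f (f' x) x) (hK : LipschitzOnWith K f' s)
    {x y : E} (hx : x ∈ s) (hy : y ∈ s) :
    ‖f y - f x - f' x (y - x)‖ ≤ K * ‖y - x‖ ^ 2 := by
  have hseg : segment ℝ x y ⊆ s := hs.segment_subset hx hy
  have := (convex_segment x y).norm_image_sub_le_of_norm_hasFDerivWithin_le'
    (f := f) (f' := f') (φ := f' x) (C := K * ‖y - x‖)
    (fun z hz ↦ (hf z (hseg hz)).hasFDerivWithinAt) (fun z hz ↦ ?_)
    (left_mem_segment ℝ x y) (right_mem_segment ℝ x y)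
  · rw [pow_two, ← mul_assoc]
    exact this
  · refine (hK.norm_sub_le (hseg hz) hx).trans ?_
    gcongr
    obtain ⟨t, ht, rfl⟩ := (segment_eq_image' ℝ x y ▸ hz)
    rw [add_sub_cancel_left, norm_smul, Real.norm_of_nonneg ht.1]
    exact mul_le_of_le_one_left (norm_nonneg _) ht.2

theorem gronwallBound_zero_eq_mul (K ε x : ℝ) :
    gronwallBound 0 K ε x = ε * gronwallBound 0 K 1 x := by
  unfold gronwallBound
  split_ifs <;> ring

/-- The solution map of an ODE at time `T ≥ 0` is differentiable with respect to the initial value,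
and the derivative is the solution of the variational equation. -/
theorem hasFDerivAt_flow_of_nonneg {f : E → E} {f' : E → E →L[ℝ] E} {s : Set E} {K K' : ℝ≥0}
    (hs : Convex ℝ s) (hf : ∀ x ∈ s, HasFDerivAt f (f' x) x) (hK : LipschitzOnWith K f s)
    (hK' : LipschitzOnWith K' f' s) {φ : E → ℝ → E} {ψ : ℝ → E →L[ℝ] E} {x : E} {T ρ : ℝ}
    (hT : 0 ≤ T) (hρ : 0 < ρ) (hφρ : ∀ t ∈ Icc 0 T, ball (φ x t) ρ ⊆ s)
    (hφ : ∀ᶠ y in 𝓝 x, φ y 0 = y ∧ ∀ t ∈ Icc 0 T, HasDerivAt (φ y) (f (φ y t)) t ∧ φ y t ∈ s)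
    (hψ0 : ψ 0 = 1) (hψ : ∀ t ∈ Icc 0 T, HasDerivAt ψ (f' (φ x t) ∘L ψ t) t) :
    HasFDerivAt (fun y ↦ φ y T) (ψ T) x := by
  obtain ⟨C, hC⟩ := isCompact_Icc.exists_bound_of_continuousOn
    (fun t ht ↦ (hψ t ht).continuousAt.continuousWithinAt : ContinuousOn ψ (Icc 0 T))
  have hC0 : 0 ≤ C := (norm_nonneg _).trans (hC 0 (left_mem_Icc.2 hT))
  have hφx := hφ.self_of_nhds
  have hev : ∀ᶠ h in 𝓝 (0 : E), (φ (x + h) 0 = x + h ∧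
      ∀ t ∈ Icc 0 T, HasDerivAt (φ (x + h)) (f (φ (x + h) t)) t ∧ φ (x + h) t ∈ s) ∧
      C * ‖h‖ < ρ := by
    refine Eventually.and ?_ ?_
    · have : Tendsto (fun h ↦ x + h) (𝓝 0) (𝓝 x) := by
        have := (continuous_const_add x).tendsto (0 : E)
        rwa [add_zero] at this
      exact this.eventually hφ
    · have : Tendsto (fun h : E ↦ C * ‖h‖) (𝓝 0) (𝓝 0) := by
        have h1 : Continuous fun h : E ↦ C * ‖h‖ := by fun_prop
        simpa using h1.tendsto 0
      exact this.eventually (gt_mem_nhds hρ)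
  rw [hasFDerivAt_iff_isLittleO_nhds_zero]
  refine Asymptotics.IsBigO.trans_isLittleO (g := fun h : E ↦ ‖h‖ ^ 2) ?_ ?_
  · refine Asymptotics.IsBigO.of_bound (K' * C ^ 2 * gronwallBound 0 K 1 T) ?_
    filter_upwards [hev] with h ⟨⟨h0, hh⟩, hρh⟩
    have hb : ∀ t ∈ Icc 0 T, ‖ψ t h‖ ≤ C * ‖h‖ := fun t ht ↦ (ψ t).le_of_opNorm_le (hC t ht) h
    have hy : ∀ t ∈ Icc 0 T, φ x t + ψ t h ∈ s := fun t ht ↦ hφρ t ht (by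
      rw [mem_ball, dist_eq_norm, add_sub_cancel_left]
      exact (hb t ht).trans_lt hρh)
    have hyd : ∀ t ∈ Icc 0 T,
        HasDerivAt (fun t ↦ φ x t + ψ t h) (f (φ x t) + f' (φ x t) (ψ t h)) t := fun t ht ↦ by
      have h2 := (ContinuousLinearMap.apply ℝ E h).hasFDerivAt.comp_hasDerivAt t (hψ t ht)
      exact (hφx.2 t ht).1.add h2
    -- The curve `φ x t + ψ t h` starts at `x + h` and solves the equation up to the Taylor
    -- remainder, at most `K' (C ‖h‖)²`. By Gronwall it stays within `O(‖h‖²)` of the true solution.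
    have key := dist_le_of_approx_trajectories_ODE_of_mem (v := fun _ ↦ f) (s := fun _ ↦ s)
      (f := φ (x + h)) (g := fun t ↦ φ x t + ψ t h) (f' := fun t ↦ f (φ (x + h) t))
      (g' := fun t ↦ f (φ x t) + f' (φ x t) (ψ t h)) (a := 0) (b := T) (K := K)
      (εf := 0) (εg := K' * (C * ‖h‖) ^ 2) (δ := 0) (fun _ _ ↦ hK)
      (fun t ht ↦ (hh t ht).1.continuousAt.continuousWithinAt)
      (fun t ht ↦ (hh t (Ico_subset_Icc_self ht)).1.hasDerivWithinAt) (fun t _ ↦ by simp)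
      (fun t ht ↦ (hh t (Ico_subset_Icc_self ht)).2)
      (fun t ht ↦ (hyd t ht).continuousAt.continuousWithinAt)
      (fun t ht ↦ (hyd t (Ico_subset_Icc_self ht)).hasDerivWithinAt)
      (fun t ht ↦ ?_) (fun t ht ↦ hy t (Ico_subset_Icc_self ht))
      (by simp [h0, hφx.1, hψ0]) T (right_mem_Icc.2 hT)
    · rw [sub_zero, zero_add, gronwallBound_zero_eq_mul, dist_eq_norm] at key
      rw [norm_pow, norm_norm, sub_sub]
      refine key.trans_eq ?_
      ring
    · have ht' := Ico_subset_Icc_self ht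
      have := norm_taylor_le_of_lipschitzOnWith hs hf hK' (hφx.2 t ht').2 (hy t ht')
      rw [add_sub_cancel_left, sub_sub] at this
      rw [dist_comm, dist_eq_norm]
      refine this.trans ?_
      gcongr
      exact hb t ht'
  · simpa using Asymptotics.isLittleO_norm_pow_id (E' := E) one_lt_two

/-- The solution map of an ODE at time `T` is differentiable with respect to the initial value. -/
theorem hasFDerivAt_flow {f : E → E} {f' : E → E →L[ℝ] E} {s : Set E} {K K' : ℝ≥0}
    (hs : Convex ℝ s) (hf : ∀ x ∈ s, HasFDerivAt f (f' x) x) (hK : LipschitzOnWith K f s)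
    (hK' : LipschitzOnWith K' f' s) {φ : E → ℝ → E} {ψ : ℝ → E →L[ℝ] E} {x : E} {T ρ ε : ℝ}
    (hT : |T| < ε) (hρ : 0 < ρ) (hφρ : ∀ t, |t| < ε → ball (φ x t) ρ ⊆ s)
    (hφ : ∀ᶠ y in 𝓝 x, φ y 0 = y ∧ ∀ t, |t| < ε → HasDerivAt (φ y) (f (φ y t)) t ∧ φ y t ∈ s)
    (hψ0 : ψ 0 = 1) (hψ : ∀ t, |t| < ε → HasDerivAt ψ (f' (φ x t) ∘L ψ t) t) :
    HasFDerivAt (fun y ↦ φ y T) (ψ T) x := by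
  rcases le_total 0 T with h0 | h0
  · have hε : ∀ t ∈ Icc 0 T, |t| < ε := fun t ht ↦ by
      rw [abs_of_nonneg ht.1]
      rw [abs_of_nonneg h0] at hT
      linarith [ht.2]
    exact hasFDerivAt_flow_of_nonneg hs hf hK hK' h0 hρ (fun t ht ↦ hφρ t (hε t ht))
      (hφ.mono fun y hy ↦ ⟨hy.1, fun t ht ↦ hy.2 t (hε t ht)⟩) hψ0 (fun t ht ↦ hψ t (hε t ht))
  -- Negative times are reduced to positive ones by reversing time and replacing `f` with `-f`.
  · have hε : ∀ t ∈ Icc 0 (-T), |-t| < ε := fun t ht ↦ by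
      rw [abs_neg, abs_of_nonneg ht.1]
      rw [abs_of_nonpos h0] at hT
      linarith [ht.2]
    have hneg : ∀ {F : Type _} [NormedAddCommGroup F] [NormedSpace ℝ F] (g : ℝ → F) (g' : F) (t : ℝ),
        HasDerivAt g g' (-t) → HasDerivAt (fun t ↦ g (-t)) (-g') t := fun g g' t h ↦ by
      simpa [Function.comp_def] using h.scomp t (hasDerivAt_neg t)
    have hK'2 : LipschitzOnWith K' (fun x ↦ -f' x) s := hK'.neg
    have := hasFDerivAt_flow_of_nonneg (f := fun x ↦ -f x) (f' := fun x ↦ -f' x) (T := -T)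
      (φ := fun y t ↦ φ y (-t)) (ψ := fun t ↦ ψ (-t)) hs (fun x hx ↦ (hf x hx).neg) hK.neg hK'2
      (by linarith) hρ (fun t ht ↦ hφρ _ (hε t ht))
      (hφ.mono fun y hy ↦ ⟨by simpa using hy.1,
        fun t ht ↦ ⟨hneg _ _ _ (hy.2 _ (hε t ht)).1, (hy.2 _ (hε t ht)).2⟩⟩)
      (by simpa using hψ0)
      (fun t ht ↦ (hneg _ _ _ (hψ _ (hε t ht))).congr_deriv (by ext; simp))
    simpa using this

/-- A smooth vector field has local flows of every finite class of differentiability. -/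
theorem exists_contDiffAt_localFlow (k : ℕ) {E : Type*} [NormedAddCommGroup E] [NormedSpace ℝ E]
    [CompleteSpace E] {f : E → E} {x₀ : E} (hf : ContDiffAt ℝ ∞ f x₀) :
    ∃ φ : E × ℝ → E, ContDiffAt ℝ k φ (x₀, 0) ∧
      ∀ᶠ z in 𝓝 (x₀, (0 : ℝ)), φ (z.1, 0) = z.1 ∧
        HasDerivAt (fun t ↦ φ (z.1, t)) (f (φ z)) z.2 := by
  induction k generalizing E with
  | zero =>
    obtain ⟨ε, hε, a, r, L, K, hr, h⟩ := IsPicardLindelof.of_contDiffAt_one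
      (hf.of_le (by exact_mod_cast le_top))
    obtain ⟨α, hα, hαc⟩ := (h 0).exists_forall_mem_closedBall_eq_hasDerivWithinAt_continuousOn
    have hnhds : closedBall x₀ r ×ˢ Icc (0 - ε) (0 + ε) ∈ 𝓝 (x₀, (0 : ℝ)) :=
      prod_mem_nhds (closedBall_mem_nhds _ hr) (Icc_mem_nhds (by linarith) (by linarith))
    refine ⟨α, ?_, ?_⟩
    · rw [Nat.cast_zero, contDiffAt_zero]
      exact ⟨_, hnhds, hαc⟩
    · filter_upwards [prod_mem_nhds (closedBall_mem_nhds x₀ (show (0 : ℝ) < r from hr))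
        (Ioo_mem_nhds (show 0 - ε < 0 by linarith) (show 0 < 0 + ε by linarith))] with z hz
      exact ⟨(hα z.1 hz.1).1, ((hα z.1 hz.1).2 z.2 (Ioo_subset_Icc_self hz.2)).hasDerivAt
        (Icc_mem_nhds hz.2.1 hz.2.2)⟩
  | succ k ih =>
    have hf' : ContDiffAt ℝ ∞ (fderiv ℝ f) x₀ := hf.fderiv_right (m := ∞) (by simp)
    -- The equation is coupled with its variational equation. The induction hypothesis gives this
    -- larger system a flow of class `C^k`; its second component, started at 1, is the derivative of
    -- the first in the initial value.
    let F : E × (E →L[ℝ] E) → E × (E →L[ℝ] E) := fun z ↦ (f z.1, (fderiv ℝ f z.1).comp z.2)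
    have hF : ContDiffAt ℝ ∞ F (x₀, 1) := by
      refine ContDiffAt.prodMk (hf.comp (x₀, (1 : E →L[ℝ] E)) contDiffAt_fst) ?_
      exact ContDiffAt.clm_comp (hf'.comp (x₀, (1 : E →L[ℝ] E)) contDiffAt_fst) contDiffAt_snd
    obtain ⟨Φ, hΦ, hΦe⟩ := ih hF
    have hι : ContDiffAt ℝ k (fun z : E × ℝ ↦ ((z.1, (1 : E →L[ℝ] E)), z.2)) (x₀, 0) := by
      fun_prop
    have hΦι : ContDiffAt ℝ k (fun z : E × ℝ ↦ Φ ((z.1, 1), z.2)) (x₀, 0) :=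
      ContDiffAt.comp (x₀, (0 : ℝ)) hΦ hι
    let φ : E × ℝ → E := fun z ↦ (Φ ((z.1, 1), z.2)).1
    let ψ : E × ℝ → E →L[ℝ] E := fun z ↦ (Φ ((z.1, 1), z.2)).2
    have hφ : ContDiffAt ℝ k φ (x₀, 0) := hΦι.fst
    have hψ : ContDiffAt ℝ k ψ (x₀, 0) := hΦι.snd
    have hode : ∀ᶠ z in 𝓝 (x₀, (0 : ℝ)), (φ (z.1, 0) = z.1 ∧ ψ (z.1, 0) = 1) ∧
        HasDerivAt (fun t ↦ φ (z.1, t)) (f (φ z)) z.2 ∧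
        HasDerivAt (fun t ↦ ψ (z.1, t)) ((fderiv ℝ f (φ z)).comp (ψ z)) z.2 := by
      filter_upwards [hι.continuousAt.tendsto.eventually hΦe] with z hz
      refine ⟨⟨congrArg Prod.fst hz.1, congrArg Prod.snd hz.1⟩, ?_, ?_⟩
      · exact hz.2.fst
      · exact hz.2.snd
    have h00 : φ (x₀, 0) = x₀ := hode.self_of_nhds.1.1
    -- choose a ball on which `f` and its derivative are Lipschitz
    obtain ⟨K, s₁, hs₁, hK⟩ := (hf.of_le (by exact_mod_cast le_top) :
      ContDiffAt ℝ 1 f x₀).exists_lipschitzOnWith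
    obtain ⟨K', s₂, hs₂, hK'⟩ := (hf'.of_le (by exact_mod_cast le_top) :
      ContDiffAt ℝ 1 (fderiv ℝ f) x₀).exists_lipschitzOnWith
    have hd : ∀ᶠ y in 𝓝 x₀, DifferentiableAt ℝ f y := by
      have h1 : ContDiffAt ℝ 1 f x₀ := hf.of_le (by exact_mod_cast le_top)
      exact (h1.eventually (by simp)).mono fun y hy ↦ hy.differentiableAt (by simp)
    obtain ⟨a, ha, hball⟩ := Metric.mem_nhds_iff.1 (inter_mem (inter_mem hs₁ hs₂) hd)
    have hφc : ContinuousAt φ (x₀, 0) := hφ.continuousAt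
    have hφa : ∀ᶠ z in 𝓝 (x₀, (0 : ℝ)), φ z ∈ ball x₀ (a / 2) := by
      have := hφc.tendsto
      rw [h00] at this
      exact this.eventually (ball_mem_nhds x₀ (by positivity))
    obtain ⟨ε, hε, hεb⟩ := Metric.mem_nhds_iff.1 (inter_mem hode hφa)
    have hmem : ∀ y t, dist y x₀ < ε → |t| < ε → (y, t) ∈ ball (x₀, (0 : ℝ)) ε := fun y t hy ht ↦ by
      rw [mem_ball, Prod.dist_eq, max_lt_iff]
      exact ⟨hy, by simpa [Real.dist_eq] using ht⟩
    have hfd : ∀ z ∈ ball (x₀, (0 : ℝ)) ε, HasFDerivAt (fun y ↦ φ (y, z.2)) (ψ z) z.1 := by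
      intro z hz
      rw [mem_ball, Prod.dist_eq, max_lt_iff] at hz
      have hz2 : |z.2| < ε := by simpa [Real.dist_eq] using hz.2
      have := hasFDerivAt_flow (f := f) (f' := fderiv ℝ f) (s := ball x₀ a) (φ := fun y t ↦ φ (y, t))
        (ψ := fun t ↦ ψ (z.1, t)) (x := z.1) (T := z.2) (ρ := a / 2) (ε := ε) (convex_ball _ _)
        (fun x hx ↦ (hball hx).2.hasFDerivAt) (hK.mono fun x hx ↦ (hball hx).1.1)
        (hK'.mono fun x hx ↦ (hball hx).1.2) hz2 (by positivity) ?_ ?_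
        (hεb (hmem z.1 0 hz.1 (by simpa using hε))).1.1.2
        (fun t ht ↦ (hεb (hmem z.1 t hz.1 ht)).1.2.2)
      · exact this
      · intro t ht
        refine ball_subset_ball' ?_
        have : φ (z.1, t) ∈ ball x₀ (a / 2) := (hεb (hmem z.1 t hz.1 ht)).2
        rw [mem_ball] at this
        linarith
      · filter_upwards [isOpen_ball.mem_nhds (show z.1 ∈ ball x₀ ε from hz.1)] with y hy
        refine ⟨(hεb (hmem y 0 hy (by simpa using hε))).1.1.1, fun t ht ↦
          ⟨(hεb (hmem y t hy ht)).1.2.1, ?_⟩⟩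
        exact ball_subset_ball (by linarith) (hεb (hmem y t hy ht)).2
    have hφk : ∀ᶠ z in 𝓝 (x₀, (0 : ℝ)), ContinuousAt φ z ∧ ContinuousAt ψ z := by
      have h1 : ContDiffAt ℝ 0 φ (x₀, 0) := hφ.of_le (by simp)
      have h2 : ContDiffAt ℝ 0 ψ (x₀, 0) := hψ.of_le (by simp)
      filter_upwards [h1.eventually (by simp), h2.eventually (by simp)] with z h1 h2
      exact ⟨h1.continuousAt, h2.continuousAt⟩
    -- The partial derivatives are `ψ` in space and `f ∘ φ` in time. Both are of class `C^k`, hence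
    -- `φ` is of class `C^(k+1)`.
    have hder : ∀ᶠ z in 𝓝 (x₀, (0 : ℝ)), HasFDerivAt φ
        ((ψ z).coprod ((1 : ℝ →L[ℝ] ℝ).smulRight (f (φ z)))) z := by
      filter_upwards [ball_mem_nhds (x₀, (0 : ℝ)) hε, hφk] with z hz hzc
      have h1 : ∀ᶠ v in 𝓝 z, v ∈ ball (x₀, (0 : ℝ)) ε := isOpen_ball.mem_nhds hz
      have hfc : ContinuousAt f (φ z) :=
        (hball (ball_subset_ball (by linarith) (hεb hz).2)).2.continuousAt
      have := hasStrictFDerivAt_uncurry_coprod (𝕜 := ℝ) (u := z) (f := fun y t ↦ φ (y, t))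
        (f₁ := fun y t ↦ ψ (y, t)) (f₂ := fun y t ↦ (1 : ℝ →L[ℝ] ℝ).smulRight (f (φ (y, t))))
        (h1.mono fun v hv ↦ hfd v hv) (h1.mono fun v hv ↦ (hεb hv).1.2.1.hasFDerivAt) hzc.2 ?_
      · exact this.hasFDerivAt
      · have h2 : ContinuousAt (fun v ↦ f (φ v)) z := ContinuousAt.comp hfc hzc.1
        exact ((ContinuousLinearMap.smulRightL ℝ ℝ E (1 : ℝ →L[ℝ] ℝ)).continuous.continuousAt).comp h2
    refine ⟨φ, ?_, hode.mono fun z hz ↦ ⟨hz.1.1, hz.2.1⟩⟩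
    rw [Nat.cast_add, Nat.cast_one, contDiffAt_succ_iff_hasFDerivAt]
    refine ⟨fun z ↦ (ψ z).coprod ((1 : ℝ →L[ℝ] ℝ).smulRight (f (φ z))), ?_, ?_⟩
    · exact ⟨_, hder, fun z hz ↦ hz⟩
    · have h1 : ContDiffAt ℝ k (fun z ↦ f (φ z)) (x₀, 0) :=
        ContDiffAt.comp (x₀, (0 : ℝ)) (by rw [h00]; exact hf.of_le (by exact_mod_cast le_top)) hφ
      have h2 : ContDiffAt ℝ k (fun z ↦ (1 : ℝ →L[ℝ] ℝ).smulRight (f (φ z))) (x₀, 0) :=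
        (ContinuousLinearMap.smulRightL ℝ ℝ E (1 : ℝ →L[ℝ] ℝ)).contDiff.contDiffAt.comp _ h1
      have h3 : (fun z ↦ (ψ z).coprod ((1 : ℝ →L[ℝ] ℝ).smulRight (f (φ z)))) = fun z ↦
          (ψ z).comp (ContinuousLinearMap.fst ℝ E ℝ) +
          ((1 : ℝ →L[ℝ] ℝ).smulRight (f (φ z))).comp (ContinuousLinearMap.snd ℝ E ℝ) := by
        ext z v <;> simp
      rw [h3]
      exact (hψ.clm_comp contDiffAt_const).add (h2.clm_comp contDiffAt_const)

end LocalFlow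

/-! ### Derivatives of charts -/

section Charts

variable {E : Type*} [NormedAddCommGroup E] [NormedSpace ℝ E] {H : Type*} [TopologicalSpace H]
  (I : ModelWithCorners ℝ E H) {N : Type*} [TopologicalSpace N] [ChartedSpace H N]

/-- The derivative at `y` of the chart centered at `x`. -/
def toChart (x y : N) : E →L[ℝ] E :=
  mfderiv I 𝓘(ℝ, E) (extChartAt I x) y

/-- The derivative at `z` of the inverse of the chart centered at `x`. -/
def fromChart (x : N) (z : E) : E →L[ℝ] E :=
  mfderiv 𝓘(ℝ, E) I (extChartAt I x).symm z

variable [I.Boundaryless] [IsManifold I ∞ N]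

theorem toChart_comp_fromChart {x : N} {z : E} (hz : z ∈ (extChartAt I x).target) :
    toChart I x ((extChartAt I x).symm z) ∘L fromChart I x z = ContinuousLinearMap.id ℝ E := by
  have : IsManifold I 1 N := .of_le (n := ∞) (by exact_mod_cast le_top)
  have h := mfderiv_extChartAt_comp_mfderivWithin_extChartAt_symm (I := I) hz
  rw [I.range_eq_univ, mfderivWithin_univ] at h
  exact h

theorem fromChart_comp_toChart {x y : N} (hy : y ∈ (extChartAt I x).source) :
    fromChart I x (extChartAt I x y) ∘L toChart I x y = ContinuousLinearMap.id ℝ E := by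
  have : IsManifold I 1 N := .of_le (n := ∞) (by exact_mod_cast le_top)
  have h := mfderivWithin_extChartAt_symm_comp_mfderiv_extChartAt' (I := I) hy
  rw [I.range_eq_univ, mfderivWithin_univ] at h
  exact h

theorem toChart_fromChart {x : N} {z : E} (hz : z ∈ (extChartAt I x).target) (v : E) :
    toChart I x ((extChartAt I x).symm z) (fromChart I x z v) = v :=
  congrArg (fun f : E →L[ℝ] E ↦ f v) (toChart_comp_fromChart I hz)

theorem fromChart_toChart {x y : N} (hy : y ∈ (extChartAt I x).source) (v : E) :
    fromChart I x (extChartAt I x y) (toChart I x y v) = v :=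
  congrArg (fun f : E →L[ℝ] E ↦ f v) (fromChart_comp_toChart I hy)

theorem toChart_self (x : N) : toChart I x x = ContinuousLinearMap.id ℝ E := by
  have : IsManifold I 1 N := .of_le (n := ∞) (by exact_mod_cast le_top)
  exact mfderiv_extChartAt_self

theorem fromChart_self (x : N) : fromChart I x (extChartAt I x x) = ContinuousLinearMap.id ℝ E := by
  have h := fromChart_comp_toChart I (mem_extChartAt_source (I := I) x)
  rwa [toChart_self, ContinuousLinearMap.comp_id] at h

theorem hasMFDerivAt_extChartAt_symm {x : N} {z : E} (hz : z ∈ (extChartAt I x).target) :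
    HasMFDerivAt 𝓘(ℝ, E) I (extChartAt I x).symm z
      (mfderiv 𝓘(ℝ, E) I (extChartAt I x).symm z) := by
  have : IsManifold I 1 N := .of_le (n := ∞) (by exact_mod_cast le_top)
  have h := mdifferentiableWithinAt_extChartAt_symm (I := I) hz
  rw [I.range_eq_univ, mdifferentiableWithinAt_univ] at h
  exact h.hasMFDerivAt

theorem hasMFDerivAt_extChartAt_toChart {x y : N} (hy : y ∈ (extChartAt I x).source) :
    HasMFDerivAt I 𝓘(ℝ, E) (extChartAt I x) y
      (mfderiv I 𝓘(ℝ, E) (extChartAt I x) y) := by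
  have : IsManifold I 1 N := .of_le (n := ∞) (by exact_mod_cast le_top)
  rw [extChartAt_source] at hy
  exact (mdifferentiableAt_extChartAt hy).hasMFDerivAt

theorem contDiffAt_transition {x₀ x₁ : N} {z : E} (hz : z ∈ (extChartAt I x₁).target)
    (hz' : (extChartAt I x₁).symm z ∈ (extChartAt I x₀).source) :
    ContDiffAt ℝ ∞ (extChartAt I x₀ ∘ (extChartAt I x₁).symm) z := by
  rw [← contMDiffAt_iff_contDiffAt]
  rw [extChartAt_source] at hz'
  exact (contMDiffAt_extChartAt' hz').comp z ((contMDiffOn_extChartAt_symm x₁).contMDiffAt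
    (extChartAt_target_mem_nhds' hz))

theorem hasFDerivAt_transition {x₀ x₁ : N} {z : E} (hz : z ∈ (extChartAt I x₁).target)
    (hz' : (extChartAt I x₁).symm z ∈ (extChartAt I x₀).source) :
    HasFDerivAt (extChartAt I x₀ ∘ (extChartAt I x₁).symm)
      (toChart I x₀ ((extChartAt I x₁).symm z) ∘L fromChart I x₁ z) z :=
  ((hasMFDerivAt_extChartAt_toChart I hz').comp z
    (hasMFDerivAt_extChartAt_symm I hz)).hasFDerivAt

theorem eventually_mem_transition {x₀ x₁ : N} {z : E} (hz : z ∈ (extChartAt I x₁).target)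
    (hz' : (extChartAt I x₁).symm z ∈ (extChartAt I x₀).source) :
    ∀ᶠ w in 𝓝 z, w ∈ (extChartAt I x₁).target ∧
      (extChartAt I x₁).symm w ∈ (extChartAt I x₀).source := by
  refine Filter.Eventually.and (extChartAt_target_mem_nhds' hz) ?_
  have hc : ContinuousAt (extChartAt I x₁).symm z := continuousAt_extChartAt_symm'' hz
  exact hc.tendsto.eventually ((isOpen_extChartAt_source x₀).mem_nhds hz')

/-- A vector field is smooth at `y` iff its coordinate expression is. -/
theorem contMDiffAt_vectorField_iff {X : ∀ y : N, TangentSpace I y} {x y : N}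
    (hy : y ∈ (extChartAt I x).source) :
    ContMDiffAt I I.tangent ∞ (fun y ↦ (⟨y, X y⟩ : TangentBundle I N)) y ↔
      ContMDiffAt I 𝓘(ℝ, E) ∞ (fun y ↦ toChart I x y (X y)) y := by
  have : IsManifold I (∞ + 1) N := by simpa using (inferInstance : IsManifold I ∞ N)
  have : IsManifold I 1 N := .of_le (n := ∞) (by exact_mod_cast le_top)
  rw [extChartAt_source] at hy
  have hy' : y ∈ (trivializationAt E (TangentSpace I) x).baseSet := by simpa using hy
  have h := Trivialization.contMDiffAt_section_iff (IB := I) (n := ∞)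
    (s := X) (trivializationAt E (TangentSpace I) x) hy'
  refine Iff.trans h (Filter.EventuallyEq.contMDiffAt_iff ?_)
  filter_upwards [(chartAt H x).open_source.mem_nhds hy] with w hw
  have := TangentBundle.continuousLinearMapAt_trivializationAt (I := I) hw
  have h2 : (trivializationAt E (TangentSpace I) x).continuousLinearMapAt ℝ w (X w) =
    toChart I x w (X w) := by rw [this]; rfl
  rw [← h2]
  rw [Trivialization.continuousLinearMapAt_apply, Trivialization.linearMapAt_apply, if_pos]
  simpa using hw

theorem contDiffAt_vectorField {X : ∀ y : N, TangentSpace I y}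
    (hX : ContMDiff I I.tangent ∞ (fun y ↦ (⟨y, X y⟩ : TangentBundle I N)))
    {x : N} {z : E} (hz : z ∈ (extChartAt I x).target) :
    ContDiffAt ℝ ∞ (fun z ↦ toChart I x ((extChartAt I x).symm z) (X ((extChartAt I x).symm z)))
      z := by
  rw [← contMDiffAt_iff_contDiffAt]
  have h := (contMDiffAt_vectorField_iff I ((extChartAt I x).map_target hz)).1
    (hX ((extChartAt I x).symm z))
  exact h.comp z ((contMDiffOn_extChartAt_symm x).contMDiffAt (extChartAt_target_mem_nhds' hz))

theorem hasMFDerivAt_of_hasDerivAt_chart {X : ∀ y : N, TangentSpace I y} {x : N} {c : ℝ → E} {t : ℝ}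
    (hc : HasDerivAt c (toChart I x ((extChartAt I x).symm (c t)) (X ((extChartAt I x).symm (c t)))) t)
    (ht : c t ∈ (extChartAt I x).target) :
    HasMFDerivAt 𝓘(ℝ, ℝ) I (fun s ↦ (extChartAt I x).symm (c s)) t
      ((1 : ℝ →L[ℝ] ℝ).smulRight (X ((extChartAt I x).symm (c t)))) := by
  have h := (hasMFDerivAt_extChartAt_symm I ht).comp t hc.hasFDerivAt.hasMFDerivAt
  refine h.congr_mfderiv ?_
  symm
  apply ContinuousLinearMap.ext
  intro s
  have := fromChart_toChart I ((extChartAt I x).map_target ht) (X ((extChartAt I x).symm (c t)))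
  rw [(extChartAt I x).right_inv ht] at this
  change s • X ((extChartAt I x).symm (c t)) = fromChart I x (c t)
    (s • toChart I x ((extChartAt I x).symm (c t)) (X ((extChartAt I x).symm (c t))))
  rw [map_smul, this]
  rfl

/-! ### The flow of a vector field on a compact manifold -/

open Filter in
theorem exists_contMDiffAt_localFlow [CompleteSpace E] {X : ∀ y : N, TangentSpace I y}
    (hX : ContMDiff I I.tangent ∞ (fun y ↦ (⟨y, X y⟩ : TangentBundle I N))) (k : ℕ) (x : N) :
    ∃ φ : ℝ × N → N, ContMDiffAt (𝓘(ℝ, ℝ).prod I) I k φ (0, x) ∧ ∃ ε > 0, ∃ u ∈ 𝓝 x, ∀ y ∈ u,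
      φ (0, y) = y ∧ IsMIntegralCurveOn (fun t ↦ φ (t, y)) X (Ioo (-ε) ε) := by
  obtain ⟨φ, hφ, hφe⟩ := exists_contDiffAt_localFlow k
    (contDiffAt_vectorField I hX (mem_extChartAt_target (I := I) x))
  have h0 : φ (extChartAt I x x, 0) = extChartAt I x x := hφe.self_of_nhds.1
  have htar : ∀ᶠ z in 𝓝 (extChartAt I x x, (0 : ℝ)), φ z ∈ (extChartAt I x).target := by
    have := hφ.continuousAt.tendsto
    rw [h0] at this
    exact this.eventually (extChartAt_target_mem_nhds x)
  have hιc : ContMDiffAt (𝓘(ℝ, ℝ).prod I) 𝓘(ℝ, E × ℝ) k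
      (fun z : ℝ × N ↦ (extChartAt I x z.2, z.1)) (0, x) := by
    rw [modelWithCornersSelf_prod, ← chartedSpaceSelf_prod]
    have h1 : ContMDiffAt I 𝓘(ℝ, E) k (extChartAt I x) x :=
      (contMDiffAt_extChartAt (n := ∞)).of_le (by exact_mod_cast le_top)
    exact ContMDiffAt.prodMk (h1.comp ((0 : ℝ), x) contMDiffAt_snd) contMDiffAt_fst
  refine ⟨fun z ↦ (extChartAt I x).symm (φ (extChartAt I x z.2, z.1)), ?_, ?_⟩
  · have h1 : ContMDiffAt 𝓘(ℝ, E) I k (extChartAt I x).symm (φ (extChartAt I x x, 0)) := by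
      rw [h0]
      exact ((contMDiffOn_extChartAt_symm x).contMDiffAt (extChartAt_target_mem_nhds x)).of_le
        (n := ∞) (by exact_mod_cast le_top)
    have h2 : ContMDiffAt 𝓘(ℝ, E × ℝ) 𝓘(ℝ, E) k φ (extChartAt I x x, 0) :=
      hφ.contMDiffAt
    exact h1.comp ((0 : ℝ), x) (h2.comp ((0 : ℝ), x) hιc)
  · have hev : ∀ᶠ z in 𝓝 ((0 : ℝ), x), (φ (extChartAt I x z.2, 0) = extChartAt I x z.2 ∧
        HasDerivAt (fun t ↦ φ (extChartAt I x z.2, t)) (toChart I x ((extChartAt I x).symm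
          (φ (extChartAt I x z.2, z.1))) (X ((extChartAt I x).symm (φ (extChartAt I x z.2, z.1)))))
            z.1) ∧ φ (extChartAt I x z.2, z.1) ∈ (extChartAt I x).target :=
      hιc.continuousAt.tendsto.eventually (hφe.and htar)
    obtain ⟨s, hs, u, hu, hsu⟩ := mem_nhds_prod_iff.1 hev
    obtain ⟨ε, hε, hεs⟩ := Metric.mem_nhds_iff.1 hs
    refine ⟨ε, hε, u ∩ (extChartAt I x).source, inter_mem hu (extChartAt_source_mem_nhds x), ?_⟩
    rintro y ⟨hy, hys⟩
    refine ⟨?_, fun t ht ↦ ?_⟩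
    · have h : ((0 : ℝ), y) ∈ s ×ˢ u := ⟨hεs (Metric.mem_ball_self hε), hy⟩
      have h2 := (hsu h).1.1
      simp only at h2 ⊢
      rw [h2, (extChartAt I x).left_inv hys]
    · have h : (t, y) ∈ s ×ˢ u := by
        refine ⟨hεs ?_, hy⟩
        rw [Real.ball_eq_Ioo]
        simpa using ht
      exact (hasMFDerivAt_of_hasDerivAt_chart I (hsu h).1.2 (hsu h).2).hasMFDerivWithinAt

open Filter in
/-- A smooth vector field on a compact manifold has a smooth global flow. -/
theorem exists_contMDiff_flow [CompleteSpace E] [CompactSpace N] [T2Space N]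
    {X : ∀ y : N, TangentSpace I y}
    (hX : ContMDiff I I.tangent ∞ (fun y ↦ (⟨y, X y⟩ : TangentBundle I N))) :
    ∃ Φ : ℝ → N → N, (∀ y, Φ 0 y = y) ∧ (∀ s t y, Φ (s + t) y = Φ s (Φ t y)) ∧
      (∀ y, IsMIntegralCurve (fun t ↦ Φ t y) X) ∧
      ContMDiff (𝓘(ℝ, ℝ).prod I) I ∞ (fun z : ℝ × N ↦ Φ z.1 z.2) := by
  have : IsManifold I 1 N := .of_le (n := ∞) (by exact_mod_cast le_top)
  have hX1 : ContMDiff I I.tangent 1 (fun y ↦ (⟨y, X y⟩ : TangentBundle I N)) :=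
    hX.of_le (by exact_mod_cast le_top)
  -- Finitely many local flows cover `N`, so all integral curves exist on a common interval around
  -- 0, and this uniform time extends them to ℝ.
  have hglob : ∀ y : N, ∃ γ : ℝ → N, γ 0 = y ∧ IsMIntegralCurve γ X := by
    choose φ hφ ε hε u hu h using exists_contMDiffAt_localFlow I hX 0
    obtain ⟨s, hs⟩ := CompactSpace.elim_nhds_subcover u hu
    obtain ⟨δ, hδ, hδs⟩ : ∃ δ > 0, ∀ x ∈ s, δ ≤ ε x := by
      rcases s.eq_empty_or_nonempty with rfl | hne
      · exact ⟨1, one_pos, by simp⟩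
      · obtain ⟨x, hx, hmin⟩ := s.exists_min_image ε hne
        exact ⟨ε x, hε x, hmin⟩
    refine exists_isMIntegralCurve_of_isMIntegralCurveOn hX1 hδ fun y ↦ ?_
    have hy : y ∈ ⋃ x ∈ s, u x := by rw [hs]; trivial
    simp only [mem_iUnion] at hy
    obtain ⟨x, hx, hyx⟩ := hy
    refine ⟨_, (h x y hyx).1, (h x y hyx).2.mono ?_⟩
    exact Ioo_subset_Ioo (neg_le_neg (hδs x hx)) (hδs x hx)
  choose γ hγ0 hγ using hglob
  have hadd : ∀ s t y, γ y (s + t) = γ (γ y t) s := by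
    intro s t y
    have := isMIntegralCurve_Ioo_eq_of_contMDiff_boundaryless (t₀ := 0) hX1
      ((hγ y).comp_add t) (hγ (γ y t)) (by simp [hγ0])
    exact congrFun this s
  refine ⟨fun t y ↦ γ y t, hγ0, fun s t y ↦ hadd s t y, hγ, ?_⟩
  -- The local flow and its neighbourhood may depend on the finite class `k`; uniqueness of integral
  -- curves identifies each of them with `γ`.
  rw [contMDiff_infty]
  intro k
  have h0 : ∀ x, ContMDiffAt (𝓘(ℝ, ℝ).prod I) I k (fun z : ℝ × N ↦ γ z.2 z.1) (0, x) := by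
    intro x
    obtain ⟨φ, hφ, ε, hε, u, hu, h⟩ := exists_contMDiffAt_localFlow I hX k x
    refine hφ.congr_of_eventuallyEq ?_
    filter_upwards [prod_mem_nhds (Ioo_mem_nhds (neg_lt_zero.2 hε) hε) hu] with z hz
    have := isMIntegralCurveOn_Ioo_eqOn_of_contMDiff_boundaryless (t₀ := 0)
      (by simpa using hε) hX1 ((hγ z.2).isMIntegralCurveOn _) (h z.2 hz.2).2
      (by rw [hγ0, (h z.2 hz.2).1])
    exact this hz.1
  -- smoothness for small times
  obtain ⟨ε, hε, hsmall⟩ : ∃ ε > 0, ∀ t, |t| < ε → ∀ x,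
      ContMDiffAt (𝓘(ℝ, ℝ).prod I) I k (fun z : ℝ × N ↦ γ z.2 z.1) (t, x) := by
    have h1 : ∀ᶠ t in 𝓝 (0 : ℝ), ∀ x ∈ (univ : Set N),
        ContMDiffAt (𝓘(ℝ, ℝ).prod I) I k (fun z : ℝ × N ↦ γ z.2 z.1) (t, x) := by
      refine isCompact_univ.eventually_forall_of_forall_eventually fun x _ ↦ ?_
      have := contMDiffAt_iff_contMDiffAt_nhds (by simp) |>.1 (h0 x)
      rw [nhds_prod_eq] at this
      rw [nhds_prod_eq]
      exact this
    obtain ⟨ε, hε, h⟩ := Metric.eventually_nhds_iff.1 h1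
    exact ⟨ε, hε, fun t ht x ↦ h (by simpa [Real.dist_eq] using ht) x trivial⟩
  have hfix : ∀ t, |t| < ε → ContMDiff I I k (fun y ↦ γ y t) := fun t ht x ↦
    (hsmall t ht x).comp x (f := fun y : N ↦ (t, y)) (contMDiffAt_const.prodMk contMDiffAt_id)
  have hiter : ∀ t, |t| < ε → ∀ n : ℕ, ContMDiff I I k (fun y ↦ γ y (n * t)) := by
    intro t ht n
    induction n with
    | zero =>
      simp only [Nat.cast_zero, zero_mul, hγ0]
      exact contMDiff_id
    | succ n ih =>
      have : (fun y ↦ γ y ((n + 1 : ℕ) * t)) = (fun y ↦ γ y t) ∘ fun y ↦ γ y (n * t) := by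
        ext y
        rw [Function.comp, ← hadd]
        congr 1
        push_cast
        ring
      rw [this]
      exact (hfix t ht).comp ih
  have hall : ∀ t, ContMDiff I I k (fun y ↦ γ y t) := by
    intro t
    obtain ⟨n, hn⟩ := exists_nat_gt (|t| / ε)
    have hn0 : (0 : ℝ) < n := lt_of_le_of_lt (by positivity) hn
    have := hiter (t / n) (by
      rw [abs_div, Nat.abs_cast, div_lt_iff₀ hn0]
      rwa [div_lt_iff₀ hε, mul_comm] at hn) n
    rwa [mul_div_cancel₀ _ hn0.ne'] at this
  rintro ⟨t, x⟩
  -- Near `(t, x)` the group law factors the flow through the diffeomorphism at time `t` and a small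
  -- time, where smoothness is known.
  have heq : (fun z : ℝ × N ↦ γ z.2 z.1) =
      (fun z : ℝ × N ↦ γ z.2 z.1) ∘ fun z : ℝ × N ↦ (z.1 - t, γ z.2 t) := by
    ext z
    simp [← hadd]
  change ContMDiffAt (𝓘(ℝ, ℝ).prod I) I k (fun z : ℝ × N ↦ γ z.2 z.1) (t, x)
  rw [heq]
  refine ContMDiffAt.comp (t, x) (by simpa using h0 (γ x t)) ?_
  exact ContMDiffAt.prodMk (contMDiffAt_fst.sub contMDiffAt_const)
    (((hall t) x).comp (t, x) contMDiffAt_snd)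

end Charts

/-! ### Christoffel symbols in coordinates -/

section Christoffel

variable {E : Type*} [NormedAddCommGroup E] [NormedSpace ℝ E]

/-- The Christoffel symbol of the first kind, as a function of the derivative `T` of the metric. -/
def christoffel (T : E →L[ℝ] E →L[ℝ] E →L[ℝ] ℝ) : E →L[ℝ] E →L[ℝ] E →L[ℝ] ℝ :=
  (1 / 2 : ℝ) • (T + T.flip -
    ((ContinuousLinearMap.flipₗᵢ ℝ E E ℝ).toContinuousLinearEquiv :
      (E →L[ℝ] E →L[ℝ] ℝ) →L[ℝ] (E →L[ℝ] E →L[ℝ] ℝ)) ∘L T.flip)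

theorem christoffel_apply (T : E →L[ℝ] E →L[ℝ] E →L[ℝ] ℝ) (u v w : E) :
    christoffel T u v w = (T u v w + T v u w - T w u v) / 2 := by
  simp [christoffel]
  ring

theorem contDiff_christoffel {n : WithTop ℕ∞} :
    ContDiff ℝ n (christoffel : (E →L[ℝ] E →L[ℝ] E →L[ℝ] ℝ) → _) := by
  have h : ContDiff ℝ n (fun T : E →L[ℝ] E →L[ℝ] E →L[ℝ] ℝ ↦ T.flip) :=
    (ContinuousLinearMap.flipₗᵢ ℝ E E (E →L[ℝ] ℝ)).contDiff
  have h2 : ContDiff ℝ n (fun T : E →L[ℝ] E →L[ℝ] E →L[ℝ] ℝ ↦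
      ((ContinuousLinearMap.flipₗᵢ ℝ E E ℝ).toContinuousLinearEquiv :
      (E →L[ℝ] E →L[ℝ] ℝ) →L[ℝ] (E →L[ℝ] E →L[ℝ] ℝ)) ∘L T.flip) := contDiff_const.clm_comp h
  have h3 : ContDiff ℝ n (fun T : E →L[ℝ] E →L[ℝ] E →L[ℝ] ℝ ↦ T + T.flip) := contDiff_id.add h
  exact (h3.sub h2).const_smul _

theorem hasFDerivAt_pullback {G₀ : E → E →L[ℝ] E →L[ℝ] ℝ} {κ : E → E} {z : E}
    (hκ : ContDiffAt ℝ 2 κ z) (hG₀ : DifferentiableAt ℝ G₀ (κ z)) (h v w : E) :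
    DifferentiableAt ℝ (fun y ↦ (G₀ (κ y)).bilinearComp (fderiv ℝ κ y) (fderiv ℝ κ y)) z ∧
    fderiv ℝ (fun y ↦ (G₀ (κ y)).bilinearComp (fderiv ℝ κ y) (fderiv ℝ κ y)) z h v w =
      fderiv ℝ G₀ (κ z) (fderiv ℝ κ z h) (fderiv ℝ κ z v) (fderiv ℝ κ z w) +
      G₀ (κ z) (fderiv ℝ (fderiv ℝ κ) z h v) (fderiv ℝ κ z w) +
      G₀ (κ z) (fderiv ℝ κ z v) (fderiv ℝ (fderiv ℝ κ) z h w) := by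
  have hD : DifferentiableAt ℝ (fderiv ℝ κ) z :=
    (hκ.fderiv_right (m := 1) (by norm_num)).differentiableAt (by norm_num)
  have hk : DifferentiableAt ℝ κ z := hκ.differentiableAt (by norm_num)
  have hGk := hG₀.hasFDerivAt.comp z hk.hasFDerivAt
  have hdiff : DifferentiableAt ℝ
      (fun y ↦ (G₀ (κ y)).bilinearComp (fderiv ℝ κ y) (fderiv ℝ κ y)) z := by
    have h1 : DifferentiableAt ℝ (fun y ↦ (G₀ (κ y)) ∘L (fderiv ℝ κ y)) z :=
      hGk.differentiableAt.clm_comp hD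
    have h2 : DifferentiableAt ℝ (fun y ↦ ((G₀ (κ y)) ∘L (fderiv ℝ κ y)).flip) z :=
      (ContinuousLinearMap.flipₗᵢ ℝ E E ℝ).differentiableAt.comp z h1
    exact (ContinuousLinearMap.flipₗᵢ ℝ E E ℝ).differentiableAt.comp z (h2.clm_comp hD)
  refine ⟨hdiff, ?_⟩
  have e1 := (hdiff.hasFDerivAt.clm_apply (hasFDerivAt_const v z)).clm_apply (hasFDerivAt_const w z)
  have ev := hD.hasFDerivAt.clm_apply (hasFDerivAt_const v z)
  have ew := hD.hasFDerivAt.clm_apply (hasFDerivAt_const w z)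
  have e2 := (hGk.clm_apply ev).clm_apply ew
  have := congrArg (fun f : E →L[ℝ] ℝ ↦ f h) (e1.unique e2)
  simp at this
  rw [this]
  ring

/-- The behaviour of the Christoffel symbols under changes of coordinates. -/
theorem christoffel_transition {G₀ G₁ : E → E →L[ℝ] E →L[ℝ] ℝ} {κ : E → E} {z : E}
    (hκ : ContDiffAt ℝ 2 κ z) (hG₀ : DifferentiableAt ℝ G₀ (κ z))
    (hs : ∀ u v, G₀ (κ z) u v = G₀ (κ z) v u)
    (hG₁ : G₁ =ᶠ[𝓝 z] fun y ↦ (G₀ (κ y)).bilinearComp (fderiv ℝ κ y) (fderiv ℝ κ y))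
    (u v w : E) :
    christoffel (fderiv ℝ G₁ z) u v w =
      christoffel (fderiv ℝ G₀ (κ z)) (fderiv ℝ κ z u) (fderiv ℝ κ z v) (fderiv ℝ κ z w) +
      G₀ (κ z) (fderiv ℝ (fderiv ℝ κ) z u v) (fderiv ℝ κ z w) := by
  have hsym : ∀ a b, fderiv ℝ (fderiv ℝ κ) z a b = fderiv ℝ (fderiv ℝ κ) z b a :=
    hκ.isSymmSndFDerivAt (by simp)
  have h := fun a b c ↦ (hasFDerivAt_pullback hκ hG₀ a b c).2
  rw [christoffel_apply, christoffel_apply, hG₁.fderiv_eq, h, h, h, hsym v u, hsym w u, hsym w v,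
    hs (fderiv ℝ κ z v) (fderiv ℝ (fderiv ℝ κ) z u w), hs (fderiv ℝ κ z u)]
  ring

/-- The vector field `v` along the curve `c` is parallel at time `t` for the metric `G`. -/
def IsParallelIn (G : E → E →L[ℝ] E →L[ℝ] ℝ) (c v : ℝ → E) (t : ℝ) : Prop :=
  ∃ c' v' : E, HasDerivAt c c' t ∧ HasDerivAt v v' t ∧
    ∀ w, G (c t) v' w + christoffel (fderiv ℝ G (c t)) c' (v t) w = 0

/-- Differentiating `fderiv ℝ κ (c s) (v s)` produces a second derivative of `κ`, which is exactly
the inhomogeneous term in `christoffel_transition`. Surjectivity of the differential lets every test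
vector be written as an image. -/
theorem IsParallelIn.transition {G₀ G₁ : E → E →L[ℝ] E →L[ℝ] ℝ} {κ : E → E} {c v : ℝ → E} {t : ℝ}
    (h : IsParallelIn G₁ c v t)
    (hκ : ContDiffAt ℝ 2 κ (c t)) (hsurj : Function.Surjective (fderiv ℝ κ (c t)))
    (hG₀ : DifferentiableAt ℝ G₀ (κ (c t))) (hs : ∀ u v, G₀ (κ (c t)) u v = G₀ (κ (c t)) v u)
    (hG₁ : G₁ =ᶠ[𝓝 (c t)] fun y ↦ (G₀ (κ y)).bilinearComp (fderiv ℝ κ y) (fderiv ℝ κ y)) :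
    IsParallelIn G₀ (fun s ↦ κ (c s)) (fun s ↦ fderiv ℝ κ (c s) (v s)) t := by
  obtain ⟨c', v', hc, hv, hp⟩ := h
  have hD : DifferentiableAt ℝ (fderiv ℝ κ) (c t) :=
    (hκ.fderiv_right (m := 1) (by norm_num)).differentiableAt (by norm_num)
  have hk : DifferentiableAt ℝ κ (c t) := hκ.differentiableAt (by norm_num)
  refine ⟨_, _, hk.hasFDerivAt.comp_hasDerivAt t hc,
    (hD.hasFDerivAt.comp_hasDerivAt t hc).clm_apply hv, fun w ↦ ?_⟩
  obtain ⟨w, rfl⟩ := hsurj w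
  have h1 := hp w
  rw [christoffel_transition hκ hG₀ hs hG₁, hG₁.self_of_nhds] at h1
  simp only [ContinuousLinearMap.bilinearComp_apply] at h1
  simp only [map_add, add_apply, Function.comp]
  linarith

theorem IsParallelIn.congr {G : E → E →L[ℝ] E →L[ℝ] ℝ} {c v c₁ v₁ : ℝ → E} {t : ℝ}
    (h : IsParallelIn G c v t) (hc : c₁ =ᶠ[𝓝 t] c) (hv : v₁ =ᶠ[𝓝 t] v) :
    IsParallelIn G c₁ v₁ t := by
  obtain ⟨c', v', hc', hv', hp⟩ := h
  refine ⟨c', v', hc'.congr_of_eventuallyEq hc, hv'.congr_of_eventuallyEq hv, ?_⟩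
  rwa [hc.self_of_nhds, hv.self_of_nhds]

theorem IsParallelIn.comp {G : E → E →L[ℝ] E →L[ℝ] ℝ} {c v : ℝ → E} {σ : ℝ → ℝ} {t σ' : ℝ}
    (h : IsParallelIn G c v (σ t)) (hσ : HasDerivAt σ σ' t) :
    IsParallelIn G (fun s ↦ c (σ s)) (fun s ↦ v (σ s)) t := by
  obtain ⟨c', v', hc', hv', hp⟩ := h
  refine ⟨_, _, hc'.scomp t hσ, hv'.scomp t hσ, fun w ↦ ?_⟩
  simp only [map_smul, smul_apply, ← smul_add, hp, smul_zero]

theorem IsParallelIn.sub {G : E → E →L[ℝ] E →L[ℝ] ℝ} {c v w : ℝ → E} {t : ℝ}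
    (h : IsParallelIn G c v t) (h' : IsParallelIn G c w t) :
    IsParallelIn G c (fun s ↦ v s - w s) t := by
  obtain ⟨c', v', hc', hv', hp⟩ := h
  obtain ⟨c₁', w', hc₁', hw', hp'⟩ := h'
  obtain rfl := hc'.unique hc₁'
  refine ⟨c', _, hc', hv'.sub hw', fun a ↦ ?_⟩
  have := hp a
  have := hp' a
  simp only [map_sub, sub_apply]
  linarith

/-- Compatibility of the connection with the metric: paired with `v` itself, the Christoffel symbol
reduces to half the derivative of `G` along `c'`. -/
theorem IsParallelIn.hasDerivAt_metric {G : E → E →L[ℝ] E →L[ℝ] ℝ} {c v : ℝ → E} {t : ℝ}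
    (h : IsParallelIn G c v t) (hG : DifferentiableAt ℝ G (c t))
    (hs : ∀ u v, G (c t) u v = G (c t) v u) :
    HasDerivAt (fun s ↦ G (c s) (v s) (v s)) 0 t := by
  obtain ⟨c', v', hc, hv, hp⟩ := h
  have h1 := ((hG.hasFDerivAt.comp_hasDerivAt t hc).clm_apply hv).clm_apply hv
  refine h1.congr_deriv ?_
  have := hp (v t)
  rw [christoffel_apply] at this
  simp only [add_apply, Function.comp]
  rw [hs (v t) v']
  linarith

variable [FiniteDimensional ℝ E]

/-- The connection form in coordinates: `v` is parallel along `c` iff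
`v' = connection G c c' v`. -/
def connection (G : E → E →L[ℝ] E →L[ℝ] ℝ) (z : E) : E →L[ℝ] E →L[ℝ] E :=
  -((ContinuousLinearMap.compL ℝ E (E →L[ℝ] ℝ) E (G z).inverse) ∘L christoffel (fderiv ℝ G z))

theorem exists_equiv_of_pos {g : E →L[ℝ] E →L[ℝ] ℝ} (hg : ∀ u, u ≠ 0 → 0 < g u u) :
    ∃ e : E ≃L[ℝ] (E →L[ℝ] ℝ), (e : E →L[ℝ] (E →L[ℝ] ℝ)) = g := by
  have hinj : Function.Injective g := by
    rw [injective_iff_map_eq_zero]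
    intro u hu
    by_contra h
    have := hg u h
    simp [hu] at this
  have hfr : Module.finrank ℝ E = Module.finrank ℝ (E →L[ℝ] ℝ) := by
    rw [← (LinearMap.toContinuousLinearMap (𝕜 := ℝ) (E := E) (F' := ℝ)).finrank_eq]
    exact (Subspace.dual_finrank_eq (K := ℝ) (V := E)).symm
  refine ⟨(LinearEquiv.ofInjectiveOfFinrankEq (g : E →ₗ[ℝ] (E →L[ℝ] ℝ)) hinj
    hfr).toContinuousLinearEquiv, ?_⟩
  ext u v
  rfl

theorem metric_connection {G : E → E →L[ℝ] E →L[ℝ] ℝ} {z : E} (hg : ∀ u, u ≠ 0 → 0 < G z u u)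
    (u v w : E) : G z (connection G z u v) w = -christoffel (fderiv ℝ G z) u v w := by
  obtain ⟨e, he⟩ := exists_equiv_of_pos hg
  simp only [connection, ← he, ContinuousLinearMap.inverse_equiv]
  simp

theorem contDiffAt_connection {G : E → E →L[ℝ] E →L[ℝ] ℝ} {z : E}
    (hG : ContDiffAt ℝ ∞ G z) (hg : ∀ u, u ≠ 0 → 0 < G z u u) :
    ContDiffAt ℝ ∞ (connection G) z := by
  obtain ⟨e, he⟩ := exists_equiv_of_pos hg
  have : CompleteSpace E := FiniteDimensional.complete ℝ E
  have h1 : ContDiffAt ℝ ∞ (fun z ↦ (G z).inverse) z := by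
    have h0 : ContDiffAt ℝ ∞ (ContinuousLinearMap.inverse : (E →L[ℝ] E →L[ℝ] ℝ) → _) (G z) := by
      rw [← he]
      exact contDiffAt_map_inverse e
    exact h0.comp z hG
  have h2 : ContDiffAt ℝ ∞ (fun z ↦ christoffel (fderiv ℝ G z)) z :=
    contDiff_christoffel.contDiffAt.comp z (hG.fderiv_right (by simp))
  exact (((ContinuousLinearMap.compL ℝ E (E →L[ℝ] ℝ) E).contDiff.contDiffAt.comp z h1).clm_comp
    h2).neg

theorem isParallelIn_of_hasDerivAt {G : E → E →L[ℝ] E →L[ℝ] ℝ} {c v : ℝ → E} {t : ℝ} {c' : E}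
    (hg : ∀ u, u ≠ 0 → 0 < G (c t) u u) (hc : HasDerivAt c c' t)
    (hv : HasDerivAt v (connection G (c t) c' (v t)) t) : IsParallelIn G c v t :=
  ⟨_, _, hc, hv, fun w ↦ by rw [metric_connection hg]; ring⟩

end Christoffel

/-! ### Parallel transport -/

section Transport

variable {E : Type*} [NormedAddCommGroup E] [NormedSpace ℝ E] {H : Type*} [TopologicalSpace H]
  (I : ModelWithCorners ℝ E H) {N : Type*} [TopologicalSpace N] [ChartedSpace H N]

/-- The coordinate expression of a metric in the chart centered at `x`. -/
def chartMetric (B : N → E →L[ℝ] E →L[ℝ] ℝ) (x : N) (z : E) : E →L[ℝ] E →L[ℝ] ℝ :=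
  (B ((extChartAt I x).symm z)).bilinearComp (fromChart I x z) (fromChart I x z)

/-- `B` is a smooth Riemannian metric on the open set `U`. -/
structure IsMetricOn (B : N → E →L[ℝ] E →L[ℝ] ℝ) (U : Set N) : Prop where
  isOpen : IsOpen U
  symm : ∀ x u v, B x u v = B x v u
  pos : ∀ x ∈ U, ∀ u, u ≠ 0 → 0 < B x u u
  smooth : ∀ x, ∀ z ∈ (extChartAt I x).target, (extChartAt I x).symm z ∈ U →
    ContDiffAt ℝ ∞ (chartMetric I B x) z

/-- The vector field `v` along the curve `γ` is parallel at time `t`, as seen in the chart centered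
at `x`. -/
def IsParallelAt (B : N → E →L[ℝ] E →L[ℝ] ℝ) (x : N) (γ : ℝ → N) (v : ℝ → E) (t : ℝ) : Prop :=
  IsParallelIn (chartMetric I B x) (fun s ↦ extChartAt I x (γ s))
    (fun s ↦ toChart I x (γ s) (v s)) t

variable {I} {B : N → E →L[ℝ] E →L[ℝ] ℝ} {U : Set N}

theorem IsParallelAt.congr {x : N} {γ γ₁ : ℝ → N} {v v₁ : ℝ → E} {t : ℝ}
    (h : IsParallelAt I B x γ v t) (hγ : γ₁ =ᶠ[𝓝 t] γ) (hv : v₁ =ᶠ[𝓝 t] v) :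
    IsParallelAt I B x γ₁ v₁ t :=
  IsParallelIn.congr h (hγ.mono fun s hs ↦ by simp only [hs])
    ((hγ.and hv).mono fun s hs ↦ by simp only [hs.1, hs.2])

theorem IsParallelAt.comp {x : N} {γ : ℝ → N} {v : ℝ → E} {σ : ℝ → ℝ} {t σ' : ℝ}
    (h : IsParallelAt I B x γ v (σ t)) (hσ : HasDerivAt σ σ' t) :
    IsParallelAt I B x (fun s ↦ γ (σ s)) (fun s ↦ v (σ s)) t :=
  IsParallelIn.comp h hσ

theorem IsParallelAt.sub {x : N} {γ : ℝ → N} {v w : ℝ → E} {t : ℝ}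
    (h : IsParallelAt I B x γ v t) (h' : IsParallelAt I B x γ w t) :
    IsParallelAt I B x γ (fun s ↦ v s - w s) t := by
  have := IsParallelIn.sub h h'
  simp only [← map_sub] at this
  exact this

theorem IsMetricOn.smooth_self (hB : IsMetricOn I B U) {x : N} (hx : x ∈ U) :
    ContDiffAt ℝ ∞ (chartMetric I B x) (extChartAt I x x) :=
  hB.smooth x _ (mem_extChartAt_target x) (by rwa [extChartAt_to_inv])

variable [I.Boundaryless] [IsManifold I ∞ N]

theorem chartMetric_pos (hB : IsMetricOn I B U) {x : N} {z : E} (hz : z ∈ (extChartAt I x).target)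
    (hU : (extChartAt I x).symm z ∈ U) (u : E) (hu : u ≠ 0) : 0 < chartMetric I B x z u u := by
  refine hB.pos _ hU _ fun h ↦ hu ?_
  have h' : fromChart I x z u = 0 := h
  rw [← toChart_fromChart I hz u, h', map_zero]

theorem chartMetric_toChart {x y : N} (hy : y ∈ (extChartAt I x).source) (u v : E) :
    chartMetric I B x (extChartAt I x y) (toChart I x y u) (toChart I x y v) = B y u v := by
  rw [chartMetric, ContinuousLinearMap.bilinearComp_apply, fromChart_toChart I hy,
    fromChart_toChart I hy, (extChartAt I x).left_inv hy]

/-- On the overlap the metric in one chart is the pull-back of the metric in the other by the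
transition map, so `IsParallelIn.transition` applies. Parallelism may thus be checked in a fixed
chart instead of the moving chart at `γ t`. -/
theorem IsParallelAt.change_chart (hB : IsMetricOn I B U) {x₀ x₁ : N} {γ : ℝ → N} {v : ℝ → E}
    {t : ℝ} (h : IsParallelAt I B x₁ γ v t) (hγ : ContinuousAt γ t) (hU : γ t ∈ U)
    (h₁ : γ t ∈ (extChartAt I x₁).source) (h₀ : γ t ∈ (extChartAt I x₀).source) :
    IsParallelAt I B x₀ γ v t := by
  set κ := extChartAt I x₀ ∘ (extChartAt I x₁).symm with hκdef
  have ht : extChartAt I x₁ (γ t) ∈ (extChartAt I x₁).target := (extChartAt I x₁).map_source h₁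
  have hst : (extChartAt I x₁).symm (extChartAt I x₁ (γ t)) = γ t := (extChartAt I x₁).left_inv h₁
  have hs0 : (extChartAt I x₁).symm (extChartAt I x₁ (γ t)) ∈ (extChartAt I x₀).source := by
    rwa [hst]
  have hκ : ContDiffAt ℝ ∞ κ (extChartAt I x₁ (γ t)) := contDiffAt_transition I ht hs0
  have hκt : κ (extChartAt I x₁ (γ t)) = extChartAt I x₀ (γ t) := congrArg (extChartAt I x₀) hst
  have hfd : ∀ {z : E}, z ∈ (extChartAt I x₁).target →
      (extChartAt I x₁).symm z ∈ (extChartAt I x₀).source → fderiv ℝ κ z =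
        toChart I x₀ ((extChartAt I x₁).symm z) ∘L fromChart I x₁ z := fun hz hz' ↦
    (hasFDerivAt_transition I hz hz').fderiv
  have hev : ∀ᶠ s in 𝓝 t, γ s ∈ (extChartAt I x₁).source ∧ γ s ∈ (extChartAt I x₀).source :=
    (hγ.tendsto.eventually ((isOpen_extChartAt_source x₁).mem_nhds h₁)).and
      (hγ.tendsto.eventually ((isOpen_extChartAt_source x₀).mem_nhds h₀))
  have hmain : IsParallelIn (chartMetric I B x₀) (fun s ↦ κ (extChartAt I x₁ (γ s)))
      (fun s ↦ fderiv ℝ κ (extChartAt I x₁ (γ s)) (toChart I x₁ (γ s) (v s))) t := by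
    refine IsParallelIn.transition h (hκ.of_le (by norm_cast)) ?_ ?_ ?_ ?_
    · intro w
      refine ⟨toChart I x₁ (γ t) (fromChart I x₀ (extChartAt I x₀ (γ t)) w), ?_⟩
      rw [hfd ht hs0, ContinuousLinearMap.comp_apply, fromChart_toChart I h₁, hst]
      have := toChart_fromChart I ((extChartAt I x₀).map_source h₀) w
      rwa [(extChartAt I x₀).left_inv h₀] at this
    · rw [hκt]
      refine (hB.smooth x₀ _ ((extChartAt I x₀).map_source h₀) ?_).differentiableAt (by simp)
      rwa [(extChartAt I x₀).left_inv h₀]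
    · intro a b
      exact hB.symm _ _ _
    · filter_upwards [eventually_mem_transition I ht hs0] with w hw
      ext a b
      rw [hfd hw.1 hw.2]
      simp only [chartMetric, ContinuousLinearMap.bilinearComp_apply, hκdef, Function.comp,
        ContinuousLinearMap.comp_apply]
      rw [fromChart_toChart I hw.2, fromChart_toChart I hw.2, (extChartAt I x₀).left_inv hw.2]
  refine hmain.congr (hev.mono fun s hs ↦ ?_) (hev.mono fun s hs ↦ ?_)
  · exact (congrArg (extChartAt I x₀) ((extChartAt I x₁).left_inv hs.1)).symm
  · have e := (extChartAt I x₁).left_inv hs.1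
    simp only
    rw [hfd ((extChartAt I x₁).map_source hs.1) (by rw [e]; exact hs.2),
      ContinuousLinearMap.comp_apply, fromChart_toChart I hs.1, e]

/-- At its centre a chart has the identity as derivative, and for a differentiable metric the
derivative commutes with evaluation on constant vectors; the two conditions then coincide term by
term. -/
theorem isParallelAlong_iff (hB : IsMetricOn I B U)
    {b : ∀ x : N, TangentSpace I x → TangentSpace I x → ℝ} (hb : ∀ (x : N) (u v : E), b x u v = B x u v)
    {V : ℝ → TangentBundle I N} (hV : ∀ t, (V t).proj ∈ U) :
    IsParallelAlong I b V ↔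
      ∀ t, IsParallelAt I B (V t).proj (fun s ↦ (V s).proj) (fun s ↦ (V s).snd) t := by
  refine forall_congr' fun t ↦ exists_congr fun c' ↦ exists_congr fun v' ↦
    and_congr_right fun _ ↦ and_congr_right fun _ ↦ forall_congr' fun w ↦ ?_
  have hm : ∀ z u v, metricInChart I b (V t).proj z u v = chartMetric I B (V t).proj z u v :=
    fun z u v ↦ hb _ _ _
  have hd : DifferentiableAt ℝ (chartMetric I B (V t).proj)
      (extChartAt I (V t).proj (V t).proj) := by
    exact (hB.smooth_self (hV t)).differentiableAt (by simp)
  have hf : ∀ a u v, fderiv ℝ (fun y ↦ metricInChart I b (V t).proj y u v)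
      (extChartAt I (V t).proj (V t).proj) a = fderiv ℝ (chartMetric I B (V t).proj)
        (extChartAt I (V t).proj (V t).proj) a u v := by
    intro a u v
    simp_rw [hm]
    have h1 := (hd.hasFDerivAt.clm_apply (hasFDerivAt_const u _)).clm_apply (hasFDerivAt_const v _)
    rw [h1.fderiv]
    simp
  have h0 : ∀ e : E, toChart I (V t).proj (V t).proj e = e := fun e ↦ by rw [toChart_self]; rfl
  have h1 : ∀ e : E, christoffelAt I b (V t).proj c' e w = christoffel (fderiv ℝ
      (chartMetric I B (V t).proj) (extChartAt I (V t).proj (V t).proj)) c'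
        (toChart I (V t).proj (V t).proj e) w := by
    intro e
    rw [h0, christoffel_apply, ← hf, ← hf, ← hf]
    rfl
  exact iff_of_eq (congrArg (· = (0 : ℝ)) (congrArg₂ (· + ·) (hm _ _ _) (h1 _)))

theorem IsParallelAt.metric_eq (hB : IsMetricOn I B U) {γ : ℝ → N} {v : ℝ → E}
    (hγ : Continuous γ) (hU : ∀ t, γ t ∈ U) (h : ∀ t, IsParallelAt I B (γ t) γ v t) (s t : ℝ) :
    B (γ s) (v s) (v s) = B (γ t) (v t) (v t) := by
  have hd : ∀ t, HasDerivAt (fun s ↦ B (γ s) (v s) (v s)) 0 t := by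
    intro t
    have h1 := IsParallelIn.hasDerivAt_metric (h t)
      ((hB.smooth_self (hU t)).differentiableAt (by simp)) (fun a b ↦ hB.symm _ _ _)
    refine h1.congr_of_eventuallyEq ?_
    filter_upwards [hγ.continuousAt.tendsto.eventually
      ((isOpen_extChartAt_source (I := I) (γ t)).mem_nhds (mem_extChartAt_source _))] with s hs
    exact (chartMetric_toChart hs _ _).symm
  exact is_const_of_deriv_eq_zero (fun t ↦ (hd t).differentiableAt) (fun t ↦ (hd t).deriv) s t

/-- The difference of the two fields is parallel, so its length is constant, and it vanishes at time
`s`. -/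
theorem IsParallelAt.eq_of_eq (hB : IsMetricOn I B U) {γ : ℝ → N} {v w : ℝ → E}
    (hγ : Continuous γ) (hU : ∀ t, γ t ∈ U) (h : ∀ t, IsParallelAt I B (γ t) γ v t)
    (h' : ∀ t, IsParallelAt I B (γ t) γ w t) {s : ℝ} (hs : v s = w s) (t : ℝ) : v t = w t := by
  have := IsParallelAt.metric_eq hB hγ hU (fun t ↦ (h t).sub (h' t)) t s
  by_contra hne
  have hp := hB.pos _ (hU t) _ (sub_ne_zero.2 hne)
  rw [this, hs, sub_self, map_zero] at hp
  exact lt_irrefl _ hp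

end Transport

/-! ### Linear differential equations -/

theorem exists_linear_ode_solution {R : Type*} [NormedRing R] [NormedAlgebra ℝ R] [CompleteSpace R]
    (h1 : ‖(1 : R)‖ ≤ 1) {A : ℝ → R} {a : ℝ} (ha : a ≤ 1 / 4) (hA : ContinuousOn A (Icc (-2) 2))
    (hAa : ∀ τ ∈ Icc (-2 : ℝ) 2, ‖A τ‖ ≤ a) :
    ∃ F : ℝ → R, F 0 = 1 ∧ (∀ τ ∈ Icc (0 : ℝ) 1, HasDerivAt F (A τ * F τ) τ) ∧
      ∀ τ ∈ Icc (0 : ℝ) 1, ‖F τ - 1‖ ≤ 2 * a := by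
  have ha0 : 0 ≤ a := (norm_nonneg _).trans (hAa 0 (by norm_num))
  have hball : ∀ x ∈ Metric.closedBall (1 : R) 1, ‖x‖ ≤ 2 := by
    intro x hx
    have : ‖x - 1‖ ≤ 1 := by simpa [dist_eq_norm] using hx
    calc ‖x‖ = ‖(x - 1) + 1‖ := by rw [sub_add_cancel]
      _ ≤ 2 := (norm_add_le _ _).trans (by linarith)
  -- In the unit ball around 1 the norm is at most 2, so the speed is at most `1/4 * 2 = 1/2` and
  -- the solution stays in the ball for a time 2. The interval `[-2, 2]` has `[0, 1]` in its
  -- interior, where the derivatives are two-sided.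
  have hPL : IsPicardLindelof (fun τ (x : R) ↦ A τ * x) (tmin := -2) (tmax := 2)
      ⟨0, by norm_num⟩ (1 : R) 1 0 (1 / 2) 1 := by
    refine ⟨fun t ht ↦ ?_, fun x _ ↦ hA.mul continuousOn_const, fun t ht x hx ↦ ?_, ?_⟩
    · refine LipschitzOnWith.of_dist_le_mul fun x _ y _ ↦ ?_
      rw [dist_eq_norm, dist_eq_norm, ← mul_sub]
      refine (norm_mul_le _ _).trans (mul_le_mul_of_nonneg_right ?_ (norm_nonneg _))
      exact (hAa t ht).trans (by norm_num; linarith)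
    · refine (norm_mul_le _ _).trans ?_
      have := hball x (by simpa using hx)
      have := mul_le_mul ((hAa t ht).trans ha) this (norm_nonneg _) (by norm_num)
      refine this.trans ?_
      norm_num
    · norm_num
  obtain ⟨F, hF0, hF⟩ := hPL.exists_eq_forall_mem_Icc_hasDerivWithinAt₀
  have hder : ∀ τ ∈ Icc (0 : ℝ) 1, HasDerivAt F (A τ * F τ) τ := fun τ hτ ↦
    (hF τ ⟨by linarith [hτ.1], by linarith [hτ.2]⟩).hasDerivAt
      (Icc_mem_nhds (by linarith [hτ.1]) (by linarith [hτ.2]))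
  refine ⟨F, hF0, hder, fun τ hτ ↦ ?_⟩
  -- The derivative of `F - 1` is `A (F - 1) + A`, so Gronwall gives the bound `a (e^τ - 1) ≤ 2a`.
  have hg := norm_le_gronwallBound_of_norm_deriv_right_le (f := fun τ ↦ F τ - 1)
    (f' := fun τ ↦ A τ * F τ) (δ := 0) (K := 1) (ε := a) (a := 0) (b := 1)
    (fun t ht ↦ ((hder t ht).continuousAt.sub continuousAt_const).continuousWithinAt)
    (fun t ht ↦ ((hder t ⟨ht.1, ht.2.le⟩).sub_const _).hasDerivWithinAt) (by rw [hF0]; simp)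
    (fun t ht ↦ by
      have hAt := hAa t ⟨by linarith [ht.1], by linarith [ht.2]⟩
      calc ‖A t * F t‖ = ‖A t * (F t - 1) + A t‖ := by rw [mul_sub, mul_one, sub_add_cancel]
        _ ≤ ‖A t‖ * ‖F t - 1‖ + ‖A t‖ := (norm_add_le _ _).trans
            (by gcongr; exact norm_mul_le _ _)
        _ ≤ 1 * ‖F t - 1‖ + a := by gcongr; linarith) τ hτ
  refine hg.trans ?_
  rw [gronwallBound_of_K_ne_0 one_ne_zero]
  have : Real.exp (1 * (τ - 0)) ≤ 3 := by
    refine (Real.exp_le_exp.2 (by linarith [hτ.2] : 1 * (τ - 0) ≤ 1)).trans ?_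
    linarith [Real.exp_one_lt_d9]
  nlinarith

/-! ### Composition and existence of parallel transports -/

section Transport

variable {E : Type*} [NormedAddCommGroup E] [NormedSpace ℝ E] {H : Type*} [TopologicalSpace H]
  (I : ModelWithCorners ℝ E H) {N : Type*} [TopologicalSpace N] [ChartedSpace H N]

/-- `P` is the parallel transport from `x` to `y` along a smooth curve in `U` which is constant
before `1 / 3` and after `2 / 3`. -/
def IsTransport (B : N → E →L[ℝ] E →L[ℝ] ℝ) (U : Set N) (x y : N) (P : E ≃ₗ[ℝ] E) : Prop :=
  ∃ γ : ℝ → N, ContMDiff 𝓘(ℝ, ℝ) I ∞ γ ∧ (∀ t, γ t ∈ U) ∧ (∀ t ≤ 1 / 3, γ t = x) ∧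
    (∀ t, 2 / 3 ≤ t → γ t = y) ∧ ∀ v, ∃ V : ℝ → E, (∀ t, IsParallelAt I B (γ t) γ V t) ∧
      (∀ t ≤ 1 / 3, V t = v) ∧ ∀ t, 2 / 3 ≤ t → V t = P v

variable {I} {B : N → E →L[ℝ] E →L[ℝ] ℝ} {U : Set N}

theorem IsTransport.symm {x y : N} {P : E ≃ₗ[ℝ] E} (h : IsTransport I B U x y P) :
    IsTransport I B U y x P.symm := by
  obtain ⟨γ, hγ, hU, h0, h1, hV⟩ := h
  refine ⟨fun t ↦ γ (1 - t), hγ.comp ((contDiff_const.sub contDiff_id).contMDiff),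
    fun t ↦ hU _, fun t ht ↦ h1 _ (by linarith), fun t ht ↦ h0 _ (by linarith), fun v ↦ ?_⟩
  obtain ⟨V, hp, hV0, hV1⟩ := hV (P.symm v)
  refine ⟨fun t ↦ V (1 - t), fun t ↦ ?_, fun t ht ↦ ?_, fun t ht ↦ hV0 _ (by linarith)⟩
  · exact (hp (1 - t)).comp (σ := fun t ↦ 1 - t) ((hasDerivAt_id t).const_sub 1)
  · simp [hV1 (1 - t) (by linarith)]

/-- Between `4/9` and `5/9` both pieces equal `c`, so near any time the concatenation agrees with
one of the two pieces; smoothness and parallelism then pass to it without any matching of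
derivatives. -/
theorem concat_eventuallyEq {X : Type*} {f g : ℝ → X} {c : X} (hf : ∀ t, 2 / 3 ≤ t → f t = c)
    (hg : ∀ t ≤ 1 / 3, g t = c) (t : ℝ) :
    ((fun s : ℝ ↦ if s < 1 / 2 then f (6 * s - 2) else g (6 * s - 3)) =ᶠ[𝓝 t]
      fun s ↦ f (6 * s - 2)) ∨
    ((fun s : ℝ ↦ if s < 1 / 2 then f (6 * s - 2) else g (6 * s - 3)) =ᶠ[𝓝 t]
      fun s ↦ g (6 * s - 3)) := by
  rcases lt_or_ge t (5 / 9) with ht | ht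
  · refine .inl ?_
    filter_upwards [Iio_mem_nhds ht] with s hs
    simp only [mem_Iio] at hs
    split_ifs with hs'
    · rfl
    · rw [hf _ (by linarith), hg _ (by linarith)]
  · refine .inr ?_
    filter_upwards [Ioi_mem_nhds (show (4 / 9 : ℝ) < t by linarith)] with s hs
    simp only [mem_Ioi] at hs
    split_ifs with hs'
    · rw [hf _ (by linarith), hg _ (by linarith)]
    · rfl

theorem IsTransport.trans {x y z : N} {P Q : E ≃ₗ[ℝ] E} (h : IsTransport I B U x y P)
    (h' : IsTransport I B U y z Q) : IsTransport I B U x z (P.trans Q) := by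
  obtain ⟨γ, hγ, hU, h0, h1, hV⟩ := h
  obtain ⟨γ', hγ', hU', h0', h1', hV'⟩ := h'
  have d6 : ∀ (a t : ℝ), HasDerivAt (fun s : ℝ ↦ 6 * s - a) 6 t := fun a t ↦ by
    simpa using ((hasDerivAt_id t).const_mul 6).sub_const a
  have s6 : ∀ a : ℝ, ContMDiff 𝓘(ℝ, ℝ) 𝓘(ℝ, ℝ) ∞ (fun s : ℝ ↦ 6 * s - a) := fun a ↦
    ((contDiff_const.mul contDiff_id).sub contDiff_const).contMDiff
  -- The two paths move only during `[7/18, 4/9]` and `[5/9, 11/18]`, both inside `[1/3, 2/3]`, so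
  -- the result is again constant near its ends.
  refine ⟨fun s ↦ if s < 1 / 2 then γ (6 * s - 2) else γ' (6 * s - 3), fun t ↦ ?_, fun t ↦ ?_,
    fun t ht ↦ ?_, fun t ht ↦ ?_, fun v ↦ ?_⟩
  · rcases concat_eventuallyEq h1 h0' t with h | h
    · exact ((hγ.comp (s6 2)) t).congr_of_eventuallyEq h
    · exact ((hγ'.comp (s6 3)) t).congr_of_eventuallyEq h
  · simp only
    split_ifs
    exacts [hU _, hU' _]
  · simp only
    rw [if_pos (by linarith), h0 _ (by linarith)]
  · simp only
    rw [if_neg (by linarith), h1' _ (by linarith)]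
  · obtain ⟨V, hp, hV0, hV1⟩ := hV v
    obtain ⟨W, hq, hW0, hW1⟩ := hV' (P v)
    refine ⟨fun s ↦ if s < 1 / 2 then V (6 * s - 2) else W (6 * s - 3), fun t ↦ ?_, fun t ht ↦ ?_,
      fun t ht ↦ ?_⟩
    · have k := concat_eventuallyEq (f := fun s ↦ (γ s, V s)) (g := fun s ↦ (γ' s, W s))
        (c := (y, P v)) (fun t ht ↦ by rw [h1 t ht, hV1 t ht]) (fun t ht ↦ by rw [h0' t ht, hW0 t ht]) t
      rcases k with k | k
      · have k1 : (fun s : ℝ ↦ if s < 1 / 2 then γ (6 * s - 2) else γ' (6 * s - 3)) =ᶠ[𝓝 t]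
          fun s ↦ γ (6 * s - 2) := k.mono fun s hs ↦ by
            have := congrArg Prod.fst hs
            simpa only [apply_ite Prod.fst] using this
        have k2 : (fun s : ℝ ↦ if s < 1 / 2 then V (6 * s - 2) else W (6 * s - 3)) =ᶠ[𝓝 t]
          fun s ↦ V (6 * s - 2) := k.mono fun s hs ↦ by
            have := congrArg Prod.snd hs
            simpa only [apply_ite Prod.snd] using this
        rw [k1.self_of_nhds]
        exact ((hp _).comp (σ := fun s ↦ 6 * s - 2) (d6 2 t)).congr k1 k2
      · have k1 : (fun s : ℝ ↦ if s < 1 / 2 then γ (6 * s - 2) else γ' (6 * s - 3)) =ᶠ[𝓝 t]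
          fun s ↦ γ' (6 * s - 3) := k.mono fun s hs ↦ by
            have := congrArg Prod.fst hs
            simpa only [apply_ite Prod.fst] using this
        have k2 : (fun s : ℝ ↦ if s < 1 / 2 then V (6 * s - 2) else W (6 * s - 3)) =ᶠ[𝓝 t]
          fun s ↦ W (6 * s - 3) := k.mono fun s hs ↦ by
            have := congrArg Prod.snd hs
            simpa only [apply_ite Prod.snd] using this
        rw [k1.self_of_nhds]
        exact ((hq _).comp (σ := fun s ↦ 6 * s - 3) (d6 3 t)).congr k1 k2
    · simp only
      rw [if_pos (by linarith), hV0 _ (by linarith)]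
    · simp only
      rw [if_neg (by linarith), hW1 _ (by linarith)]
      rfl

variable [I.Boundaryless] [IsManifold I ∞ N]

theorem IsTransport.metric_eq (hB : IsMetricOn I B U) {x y : N} {P : E ≃ₗ[ℝ] E}
    (h : IsTransport I B U x y P) (v : E) : B y (P v) (P v) = B x v v := by
  obtain ⟨γ, hγ, hU, h0, h1, hV⟩ := h
  obtain ⟨V, hp, hV0, hV1⟩ := hV v
  have := IsParallelAt.metric_eq hB hγ.continuous hU hp 1 0
  rwa [h0 0 (by norm_num), h1 1 (by norm_num), hV0 0 (by norm_num), hV1 1 (by norm_num)] at this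

variable [FiniteDimensional ℝ E]

/-- Parallel transport along short segments in a chart. -/
theorem exists_transport_segment (hB : IsMetricOn I B U) {x₀ : N} {z₀ : E}
    (hz₀ : z₀ ∈ (extChartAt I x₀).target) (hU₀ : (extChartAt I x₀).symm z₀ ∈ U) :
    ∃ P : E → E →L[ℝ] E, P 0 = 1 ∧ HasFDerivAt P (connection (chartMetric I B x₀) z₀) 0 ∧
      ∀ᶠ h in 𝓝 (0 : E), ∃ Q : E ≃ₗ[ℝ] E,
        IsTransport I B U ((extChartAt I x₀).symm z₀) ((extChartAt I x₀).symm (z₀ + h)) Q ∧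
        ∀ v, toChart I x₀ ((extChartAt I x₀).symm (z₀ + h)) (Q v) =
          P h (toChart I x₀ ((extChartAt I x₀).symm z₀) v) := by
  have hcomplete : CompleteSpace E := FiniteDimensional.complete ℝ E
  set G := chartMetric I B x₀ with hG
  set Γ := connection G with hΓ
  have hΓc : ContinuousAt Γ z₀ :=
    (contDiffAt_connection (hB.smooth x₀ z₀ hz₀ hU₀) (chartMetric_pos hB hz₀ hU₀)).continuousAt
  set C := ‖Γ z₀‖ + 1 with hC
  have hC1 : 1 ≤ C := by simp [hC]
  obtain ⟨r, hr, hball⟩ : ∃ r > 0, ∀ z ∈ Metric.ball z₀ r, z ∈ (extChartAt I x₀).target ∧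
      (extChartAt I x₀).symm z ∈ U ∧ ‖Γ z‖ ≤ C := by
    have e1 : ∀ᶠ z in 𝓝 z₀, z ∈ (extChartAt I x₀).target := extChartAt_target_mem_nhds' hz₀
    have e2 : ∀ᶠ z in 𝓝 z₀, (extChartAt I x₀).symm z ∈ U :=
      (continuousAt_extChartAt_symm'' hz₀).tendsto.eventually (hB.isOpen.mem_nhds hU₀)
    have e3 : ∀ᶠ z in 𝓝 z₀, ‖Γ z‖ ≤ C :=
      (hΓc.norm.tendsto.eventually_lt_const (by simp [hC] : ‖Γ z₀‖ < C)).mono fun _ h ↦ h.le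
    obtain ⟨r, hr, h⟩ := Metric.eventually_nhds_iff_ball.1 (e1.and (e2.and e3))
    exact ⟨r, hr, h⟩
  have hcont : ∀ z ∈ Metric.ball z₀ r, ContinuousAt Γ z := fun z hz ↦
    (contDiffAt_connection (hB.smooth x₀ z (hball z hz).1 (hball z hz).2.1)
      (chartMetric_pos hB (hball z hz).1 (hball z hz).2.1)).continuousAt
  -- The first bound keeps `z₀ + τ h` in the ball for `|τ| ≤ 2`; the second gives `C ‖h‖ ≤ 1/4`, the
  -- smallness required by `exists_linear_ode_solution`.
  set δ := min (r / 3) (1 / (4 * C)) with hδ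
  have hδ0 : 0 < δ := by positivity
  have hmem : ∀ h : E, ‖h‖ < δ → ∀ τ ∈ Icc (-2 : ℝ) 2, z₀ + τ • h ∈ Metric.ball z₀ r := by
    intro h hh τ hτ
    rw [mem_ball_iff_norm, add_sub_cancel_left, norm_smul, Real.norm_eq_abs]
    have h1 : |τ| ≤ 2 := abs_le.2 hτ
    have h2 : ‖h‖ < r / 3 := hh.trans_le (min_le_left _ _)
    nlinarith [norm_nonneg h]
  have hsol : ∀ h : E, ‖h‖ < δ → ∃ F : ℝ → E →L[ℝ] E, F 0 = 1 ∧
      (∀ τ ∈ Icc (0 : ℝ) 1, HasDerivAt F (Γ (z₀ + τ • h) h * F τ) τ) ∧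
      ∀ τ ∈ Icc (0 : ℝ) 1, ‖F τ - 1‖ ≤ 2 * (C * ‖h‖) := by
    intro h hh
    refine exists_linear_ode_solution ContinuousLinearMap.norm_id_le ?_ ?_ ?_
    · have : ‖h‖ < 1 / (4 * C) := hh.trans_le (min_le_right _ _)
      rw [lt_div_iff₀ (by positivity)] at this
      linarith
    · intro τ hτ
      have h1 : ContinuousAt (fun τ : ℝ ↦ Γ (z₀ + τ • h)) τ :=
        ContinuousAt.comp (f := fun τ : ℝ ↦ z₀ + τ • h) (hcont _ (hmem h hh τ hτ)) (by fun_prop)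
      exact (h1.clm_apply continuousAt_const).continuousWithinAt
    · intro τ hτ
      refine (ContinuousLinearMap.le_opNorm _ _).trans ?_
      gcongr
      exact (hball _ (hmem h hh τ hτ)).2.2
  choose! F hF0 hFd hFn using hsol
  refine ⟨fun h ↦ F h 1, ?_, ?_, ?_⟩
  · have := hFn 0 (by simpa using hδ0) 1 (by norm_num)
    simpa [sub_eq_zero] using this
  · rw [hasFDerivAt_iff_isLittleO_nhds_zero, Asymptotics.isLittleO_iff]
    intro ε hε
    have hev : ∀ᶠ z in 𝓝 z₀, ‖Γ z - Γ z₀‖ < ε / 4 := by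
      have := (hΓc.sub (continuousAt_const (y := Γ z₀))).norm
      refine this.tendsto.eventually_lt_const ?_
      simpa using by positivity
    obtain ⟨ρ, hρ, hρΓ⟩ := Metric.eventually_nhds_iff_ball.1 hev
    have hpos : 0 < min (min δ ρ) (ε / (4 * C ^ 2)) := by positivity
    filter_upwards [Metric.ball_mem_nhds (0 : E) hpos] with h hh
    rw [mem_ball_zero_iff] at hh
    have hhδ : ‖h‖ < δ := hh.trans_le ((min_le_left _ _).trans (min_le_left _ _))
    have hhρ : ‖h‖ < ρ := hh.trans_le ((min_le_left _ _).trans (min_le_right _ _))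
    have hhε : ‖h‖ < ε / (4 * C ^ 2) := hh.trans_le (min_le_right _ _)
    rw [lt_div_iff₀ (by positivity)] at hhε
    have hh4 : C * ‖h‖ ≤ 1 / 4 := by
      have : ‖h‖ < 1 / (4 * C) := hhδ.trans_le (min_le_right _ _)
      rw [lt_div_iff₀ (by positivity)] at this
      linarith
    have h0 : F 0 1 = 1 := by
      have := hFn 0 (by simpa using hδ0) 1 (by norm_num)
      simpa [sub_eq_zero] using this
    -- The derivative of `F h τ - τ Γ z₀ h` is bounded by `ε ‖h‖`, because `F h τ` is close to 1 and
    -- `Γ` is continuous at `z₀`. Integrating over `[0, 1]` shows that `P h - 1 - Γ z₀ h` is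
    -- `o(‖h‖)`.
    have hmv := norm_image_sub_le_of_norm_deriv_le_segment_01'
      (f := fun τ ↦ F h τ - τ • Γ z₀ h) (f' := fun τ ↦ Γ (z₀ + τ • h) h * F h τ - Γ z₀ h)
      (C := ε * ‖h‖) (fun τ hτ ↦ by
        have := (hFd h hhδ τ hτ).sub ((hasDerivAt_id τ).smul_const (Γ z₀ h))
        simp only [one_smul] at this
        exact this.hasDerivWithinAt) (fun τ hτ ↦ by
        have hτ' : τ ∈ Icc (0 : ℝ) 1 := ⟨hτ.1, hτ.2.le⟩
        have hn := hFn h hhδ τ hτ'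
        have e : Γ (z₀ + τ • h) h * F h τ - Γ z₀ h =
            (Γ (z₀ + τ • h) - Γ z₀) h * (F h τ - 1) + (Γ (z₀ + τ • h) - Γ z₀) h +
              Γ z₀ h * (F h τ - 1) := by
          rw [sub_apply]
          noncomm_ring
        have b1 : ‖(Γ (z₀ + τ • h) - Γ z₀) h‖ ≤ ε / 4 * ‖h‖ := by
          refine (ContinuousLinearMap.le_opNorm _ _).trans ?_
          gcongr
          refine (hρΓ _ ?_).le
          rw [mem_ball_iff_norm, add_sub_cancel_left, norm_smul, Real.norm_eq_abs,
            abs_of_nonneg hτ.1]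
          nlinarith [norm_nonneg h, hτ.2]
        have b2 : ‖Γ z₀ h‖ ≤ C * ‖h‖ := (ContinuousLinearMap.le_opNorm _ _).trans
          (by gcongr; simp [hC])
        rw [e]
        calc _ ≤ ε / 4 * ‖h‖ * (2 * (C * ‖h‖)) + ε / 4 * ‖h‖ + C * ‖h‖ * (2 * (C * ‖h‖)) := by
              refine (norm_add_le _ _).trans (add_le_add ((norm_add_le _ _).trans
                (add_le_add ((norm_mul_le _ _).trans ?_) b1)) ((norm_mul_le _ _).trans ?_))
              · gcongr
              · gcongr
          _ ≤ ε * ‖h‖ := by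
              have : 0 ≤ ε / 4 * ‖h‖ := by positivity
              nlinarith [norm_nonneg h])
    simp only [hF0 h hhδ, one_smul, zero_smul, sub_zero] at hmv
    simp only [zero_add, h0]
    rwa [sub_right_comm]
  · filter_upwards [Metric.ball_mem_nhds (0 : E) hδ0] with h hh
    rw [mem_ball_zero_iff] at hh
    -- A smooth reparametrization, constant before `1/3` and after `2/3`; parallelism is insensitive
    -- to it.
    set σ : ℝ → ℝ := fun t ↦ Real.smoothTransition (3 * t - 1) with hσ
    have hσs : ContDiff ℝ ∞ σ := Real.smoothTransition.contDiff.comp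
      ((contDiff_const.mul contDiff_id).sub contDiff_const)
    have hσm : ∀ t, σ t ∈ Icc (0 : ℝ) 1 := fun t ↦
      ⟨Real.smoothTransition.nonneg _, Real.smoothTransition.le_one _⟩
    have hσ0 : ∀ t ≤ 1 / 3, σ t = 0 := fun t ht ↦
      Real.smoothTransition.zero_of_nonpos (by linarith)
    have hσ1 : ∀ t, 2 / 3 ≤ t → σ t = 1 := fun t ht ↦
      Real.smoothTransition.one_of_one_le (by linarith)
    have hb : ∀ t, z₀ + σ t • h ∈ Metric.ball z₀ r := fun t ↦
      hmem h hh _ ⟨by linarith [(hσm t).1], by linarith [(hσm t).2]⟩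
    have hb1 : z₀ + h ∈ Metric.ball z₀ r := by simpa [hσ1 1 (by norm_num)] using hb 1
    set γ : ℝ → N := fun t ↦ (extChartAt I x₀).symm (z₀ + σ t • h) with hγ
    have hγs : ContMDiff 𝓘(ℝ, ℝ) I ∞ γ := fun t ↦ by
      have h1 := (contMDiffOn_extChartAt_symm (I := I) (n := ∞) x₀).contMDiffAt
        (extChartAt_target_mem_nhds' (hball _ (hb t)).1)
      have h2 : ContMDiff 𝓘(ℝ, ℝ) 𝓘(ℝ, E) ∞ (fun t ↦ z₀ + σ t • h) :=
        (contDiff_const.add (hσs.smul contDiff_const)).contMDiff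
      exact h1.comp t h2.contMDiffAt
    have hγU : ∀ t, γ t ∈ U := fun t ↦ (hball _ (hb t)).2.1
    have hγsrc : ∀ t, γ t ∈ (extChartAt I x₀).source := fun t ↦
      (extChartAt I x₀).map_target (hball _ (hb t)).1
    set V : E → ℝ → E := fun v t ↦ fromChart I x₀ (z₀ + σ t • h)
      (F h (σ t) (toChart I x₀ ((extChartAt I x₀).symm z₀) v)) with hV
    have hp : ∀ v t, IsParallelAt I B (γ t) γ (V v) t := by
      intro v t
      refine IsParallelAt.change_chart (x₁ := x₀) hB ?_ hγs.continuous.continuousAt (hγU t)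
        (hγsrc t) (mem_extChartAt_source _)
      have e1 : ∀ s, extChartAt I x₀ (γ s) = z₀ + σ s • h := fun s ↦
        (extChartAt I x₀).right_inv (hball _ (hb s)).1
      have e2 : ∀ s, toChart I x₀ (γ s) (V v s) =
          F h (σ s) (toChart I x₀ ((extChartAt I x₀).symm z₀) v) := fun s ↦
        toChart_fromChart I (hball _ (hb s)).1 _
      have hσd := (hσs.differentiable (by simp) t).hasDerivAt
      unfold IsParallelAt
      simp only [e1, e2]
      refine isParallelIn_of_hasDerivAt (c' := deriv σ t • h)
        (chartMetric_pos hB (hball _ (hb t)).1 (hγU t)) ((hσd.smul_const h).const_add z₀) ?_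
      have hd := ((hFd h hh _ (hσm t)).scomp t hσd).clm_apply
        (hasDerivAt_const t (toChart I x₀ ((extChartAt I x₀).symm z₀) v))
      refine hd.congr_deriv ?_
      simp [hΓ, hG]
    have hV0 : ∀ v, ∀ t ≤ 1 / 3, V v t = v := by
      intro v t ht
      simp only [hV, hσ0 t ht, hF0 h hh, zero_smul, add_zero, one_apply_eq_self]
      have := fromChart_toChart I ((extChartAt I x₀).map_target hz₀) v
      rwa [(extChartAt I x₀).right_inv hz₀] at this
    have hV1 : ∀ v, ∀ t, 2 / 3 ≤ t → V v t = fromChart I x₀ (z₀ + h)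
        (F h 1 (toChart I x₀ ((extChartAt I x₀).symm z₀) v)) := by
      intro v t ht
      simp only [hV, hσ1 t ht, one_smul]
    set q : E →ₗ[ℝ] E := ContinuousLinearMap.toLinearMap ((fromChart I x₀ (z₀ + h)) ∘L (F h 1) ∘L
      (toChart I x₀ ((extChartAt I x₀).symm z₀))) with hq
    -- Transport preserves lengths, hence is injective, hence invertible in finite dimension.
    have hqinj : Function.Injective q := by
      rw [← LinearMap.ker_eq_bot, LinearMap.ker_eq_bot']
      intro v hv
      have hm := IsParallelAt.metric_eq hB hγs.continuous hγU (hp v) 0 1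
      rw [hV0 v 0 (by norm_num), hV1 v 1 (by norm_num)] at hm
      change B _ v v = B _ (q v) (q v) at hm
      by_contra hne
      have := hB.pos _ (hγU 0) v hne
      rw [hm, hv, map_zero] at this
      exact lt_irrefl _ this
    refine ⟨LinearEquiv.ofInjectiveEndo q hqinj, ⟨γ, hγs, hγU, fun t ht ↦ ?_, fun t ht ↦ ?_,
      fun v ↦ ⟨V v, hp v, hV0 v, fun t ht ↦ hV1 v t ht⟩⟩, fun v ↦ ?_⟩
    · simp [hγ, hσ0 t ht]
    · simp [hγ, hσ1 t ht]
    · exact toChart_fromChart I (hball _ hb1).1 _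

/-- Any two points of a connected open set are joined by a parallel transport. -/
theorem exists_transport (hB : IsMetricOn I B U) (hUc : IsPreconnected U) {x y : N}
    (hx : x ∈ U) (hy : y ∈ U) : ∃ P, IsTransport I B U x y P := by
  have hloc : ∀ x ∈ U, ∀ᶠ y in 𝓝 x, ∃ P, IsTransport I B U x y P := by
    intro x hx
    obtain ⟨P, -, -, hP⟩ := exists_transport_segment hB (mem_extChartAt_target (I := I) x)
      (by rwa [extChartAt_to_inv])
    have hc : Filter.Tendsto (fun y ↦ extChartAt I x y - extChartAt I x x) (𝓝 x) (𝓝 0) := by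
      have := (continuousAt_extChartAt (I := I) x).sub_const (extChartAt I x x)
      simpa [ContinuousAt] using this
    filter_upwards [hc.eventually hP, extChartAt_source_mem_nhds (I := I) x] with y hy hys
    obtain ⟨Q, hQ, -⟩ := hy
    rw [extChartAt_to_inv, add_sub_cancel, (extChartAt I x).left_inv hys] at hQ
    exact ⟨Q, hQ⟩
  have hx' := (hloc x hx).self_of_nhds
  by_contra hne
  -- Nearby points are joined by transports, which can be composed and reversed, so the points that
  -- can be reached and those that cannot both form open sets.
  refine (isPreconnected_iff_subset_of_disjoint.1 hUc {y | y ∈ U ∧ ∃ P, IsTransport I B U x y P}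
    {y | y ∈ U ∧ ¬ ∃ P, IsTransport I B U x y P} ?_ ?_ ?_ ?_).elim
    (fun h ↦ hne (h hy).2) (fun h ↦ (h hx).2 hx')
  · rw [isOpen_iff_mem_nhds]
    rintro y ⟨hyU, P, hP⟩
    filter_upwards [hloc y hyU, hB.isOpen.mem_nhds hyU] with w ⟨Q, hQ⟩ hw
    exact ⟨hw, _, hP.trans hQ⟩
  · rw [isOpen_iff_mem_nhds]
    rintro y ⟨hyU, hno⟩
    filter_upwards [hloc y hyU, hB.isOpen.mem_nhds hyU] with w ⟨Q, hQ⟩ hw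
    exact ⟨hw, fun ⟨P, hP⟩ ↦ hno ⟨_, hP.trans hQ.symm⟩⟩
  · intro y hyU
    by_cases h : ∃ P, IsTransport I B U x y P
    exacts [.inl ⟨hyU, h⟩, .inr ⟨hyU, h⟩]
  · ext y
    simp only [mem_inter_iff, mem_ofPred_eq, mem_empty_iff_false, iff_false]
    tauto

end Transport

/-! ### Parallel fields of endomorphisms -/

/-- The linear map `h ↦ [Γ h, a]`. -/
def commutatorMap {E R : Type*} [NormedAddCommGroup E] [NormedSpace ℝ E] [NormedRing R]
    [NormedAlgebra ℝ R] (Γ : E →L[ℝ] R) (a : R) : E →L[ℝ] R :=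
  ((ContinuousLinearMap.mul ℝ R).flip a - ContinuousLinearMap.mul ℝ R a) ∘L Γ

theorem commutatorMap_apply {E R : Type*} [NormedAddCommGroup E] [NormedSpace ℝ E] [NormedRing R]
    [NormedAlgebra ℝ R] (Γ : E →L[ℝ] R) (a : R) (h : E) :
    commutatorMap Γ a h = Γ h * a - a * Γ h := by
  simp [commutatorMap]

/-- Near 0 the hypothesis reads `f h = P h * f 0 * (P h)⁻¹`. Inversion has derivative `-1` at 1,
whence the commutator. -/
theorem hasFDerivAt_of_conj {E R : Type*} [NormedAddCommGroup E] [NormedSpace ℝ E] [NormedRing R]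
    [NormedAlgebra ℝ R] [CompleteSpace R] {P f : E → R} {Γ : E →L[ℝ] R} (hP0 : P 0 = 1)
    (hP : HasFDerivAt P Γ 0) (hf : ∀ᶠ h in 𝓝 (0 : E), f h * P h = P h * f 0) :
    HasFDerivAt f (commutatorMap Γ (f 0)) 0 := by
  have hinv : HasFDerivAt (fun h ↦ Ring.inverse (P h)) (-Γ) 0 := by
    have h1 := hasFDerivAt_ringInverse (𝕜 := ℝ) (1 : Rˣ)
    rw [Units.val_one, ← hP0] at h1
    refine (h1.comp (0 : E) hP).congr_fderiv ?_
    ext h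
    simp
  have hmul := (hP.mul' (hasFDerivAt_const (f 0) (0 : E))).mul' hinv
  have hunit : ∀ᶠ h in 𝓝 (0 : E), IsUnit (P h) := by
    have hc : Filter.Tendsto P (𝓝 0) (𝓝 1) := by
      have := hP.continuousAt
      rwa [ContinuousAt, hP0] at this
    exact hc.eventually (Units.isOpen.mem_nhds isUnit_one)
  refine (hmul.congr_of_eventuallyEq ?_).congr_fderiv ?_
  · filter_upwards [hf, hunit] with h hh hu
    simp only [Pi.mul_apply]
    rw [← hh, mul_assoc, Ring.mul_inverse_cancel _ hu, mul_one]
  · ext h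
    rw [commutatorMap_apply]
    simp [hP0]
    abel

section ParallelEndo

variable {E : Type*} [NormedAddCommGroup E] [NormedSpace ℝ E] {H : Type*} [TopologicalSpace H]
  (I : ModelWithCorners ℝ E H) {N : Type*} [TopologicalSpace N] [ChartedSpace H N]

/-- The coordinate expression of a field of endomorphisms in the chart centered at `x`. -/
def endoInChart (J : N → E →L[ℝ] E) (x : N) (z : E) : E →L[ℝ] E :=
  toChart I x ((extChartAt I x).symm z) ∘L J ((extChartAt I x).symm z) ∘L fromChart I x z

variable {I} {B : N → E →L[ℝ] E →L[ℝ] ℝ} {U : Set N}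

variable [I.Boundaryless] [IsManifold I ∞ N] [FiniteDimensional ℝ E]

/-- Along segments from `z` the field is conjugated by the transports `P h`, whose derivative at 0
is the connection form. Nothing is assumed about the regularity of `J`: the equation dA = [Γ, A]
follows from equivariance alone. -/
theorem hasFDerivAt_endoInChart (hB : IsMetricOn I B U) {J : N → E →L[ℝ] E}
    (hJ : ∀ y y' Q, IsTransport I B U y y' Q → ∀ v, J y' (Q v) = Q (J y v)) {x : N} {z : E}
    (hz : z ∈ (extChartAt I x).target) (hU : (extChartAt I x).symm z ∈ U) :
    HasFDerivAt (endoInChart I J x)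
      (commutatorMap (connection (chartMetric I B x) z) (endoInChart I J x z)) z := by
  have hcomplete : CompleteSpace E := FiniteDimensional.complete ℝ E
  obtain ⟨P, hP0, hPd, hP⟩ := exists_transport_segment hB hz hU
  have htgt : ∀ᶠ h in 𝓝 (0 : E), z + h ∈ (extChartAt I x).target := by
    have hc : Filter.Tendsto (fun h ↦ z + h) (𝓝 0) (𝓝 z) := by
      have : ContinuousAt (fun h : E ↦ z + h) 0 := by fun_prop
      simpa [ContinuousAt] using this
    exact hc.eventually (extChartAt_target_mem_nhds' hz)
  have hcomm : ∀ᶠ h in 𝓝 (0 : E), endoInChart I J x (z + h) * P h =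
      P h * endoInChart I J x (z + 0) := by
    filter_upwards [hP, htgt] with h ⟨Q, hQ, hQP⟩ ht
    ext w
    obtain ⟨v, rfl⟩ : ∃ v, toChart I x ((extChartAt I x).symm z) v = w :=
      ⟨_, toChart_fromChart I hz w⟩
    have f1 : ∀ u, fromChart I x z (toChart I x ((extChartAt I x).symm z) u) = u := fun u ↦ by
      have := fromChart_toChart I ((extChartAt I x).map_target hz) u
      rwa [(extChartAt I x).right_inv hz] at this
    have f2 : ∀ u, fromChart I x (z + h) (toChart I x ((extChartAt I x).symm (z + h)) u) = u :=
      fun u ↦ by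
      have := fromChart_toChart I ((extChartAt I x).map_target ht) u
      rwa [(extChartAt I x).right_inv ht] at this
    rw [add_zero]
    change toChart I x ((extChartAt I x).symm (z + h)) (J ((extChartAt I x).symm (z + h))
      (fromChart I x (z + h) (P h (toChart I x ((extChartAt I x).symm z) v)))) =
      P h (toChart I x ((extChartAt I x).symm z) (J ((extChartAt I x).symm z)
        (fromChart I x z (toChart I x ((extChartAt I x).symm z) v))))
    rw [f1, ← hQP, f2, ← hQP, hJ _ _ _ hQ]
  have h2 := hasFDerivAt_of_conj (f := fun h ↦ endoInChart I J x (z + h)) hP0 hPd hcomm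
  have h3 : HasFDerivAt (fun w ↦ w - z) (ContinuousLinearMap.id ℝ E) z :=
    (hasFDerivAt_id z).sub_const z
  have h4 := HasFDerivAt.comp (f := fun w ↦ w - z) z (by rw [sub_self]; exact h2) h3
  refine (h4.congr_fderiv ?_).congr_of_eventuallyEq (Filter.Eventually.of_forall fun w ↦ ?_)
  · rw [add_zero, ContinuousLinearMap.comp_id]
  · simp

theorem isOpen_chart_preimage (hU : IsOpen U) (x : N) :
    IsOpen {z | z ∈ (extChartAt I x).target ∧ (extChartAt I x).symm z ∈ U} := by
  rw [isOpen_iff_mem_nhds]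
  rintro z ⟨hz, hzU⟩
  exact Filter.Eventually.and (extChartAt_target_mem_nhds' hz)
    ((continuousAt_extChartAt_symm'' hz).tendsto.eventually (hU.mem_nhds hzU))

/-- Bootstrapping in dA = [Γ, A] with Γ smooth: if A is `C^n`, then so is its derivative. -/
theorem contDiffAt_endoInChart (hB : IsMetricOn I B U) {J : N → E →L[ℝ] E}
    (hJ : ∀ y y' Q, IsTransport I B U y y' Q → ∀ v, J y' (Q v) = Q (J y v)) {x : N} {z : E}
    (hz : z ∈ (extChartAt I x).target) (hU : (extChartAt I x).symm z ∈ U) :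
    ContDiffAt ℝ ∞ (endoInChart I J x) z := by
  set W := {z | z ∈ (extChartAt I x).target ∧ (extChartAt I x).symm z ∈ U} with hW
  have hWo : IsOpen W := isOpen_chart_preimage hB.isOpen x
  have hΓ : ContDiffOn ℝ ∞ (connection (chartMetric I B x)) W := fun z hz ↦
    (contDiffAt_connection (hB.smooth x z hz.1 hz.2)
      (chartMetric_pos hB hz.1 hz.2)).contDiffWithinAt
  have hd : ∀ z ∈ W, HasFDerivAt (endoInChart I J x)
      (commutatorMap (connection (chartMetric I B x) z) (endoInChart I J x z)) z := fun z hz ↦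
    hasFDerivAt_endoInChart hB hJ hz.1 hz.2
  have hn : ∀ n : ℕ, ContDiffOn ℝ n (endoInChart I J x) W := by
    intro n
    induction n with
    | zero => exact contDiffOn_zero.2 fun z hz ↦ (hd z hz).continuousAt.continuousWithinAt
    | succ n ih =>
      refine (contDiffOn_succ_iff_fderiv_of_isOpen hWo).2
        ⟨fun z hz ↦ (hd z hz).differentiableAt.differentiableWithinAt, fun h ↦ absurd h (WithTop.natCast_ne_top n), ?_⟩
      have hΓn : ContDiffOn ℝ n (connection (chartMetric I B x)) W :=
        hΓ.of_le (by exact_mod_cast le_top)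
      have h1 : ContDiffOn ℝ n (fun z ↦ (ContinuousLinearMap.mul ℝ (E →L[ℝ] E)).flip
          (endoInChart I J x z)) W :=
        (ContinuousLinearMap.mul ℝ (E →L[ℝ] E)).flip.contDiff.comp_contDiffOn ih
      have h2 : ContDiffOn ℝ n (fun z ↦ ContinuousLinearMap.mul ℝ (E →L[ℝ] E)
          (endoInChart I J x z)) W :=
        (ContinuousLinearMap.mul ℝ (E →L[ℝ] E)).contDiff.comp_contDiffOn ih
      exact ((h1.sub h2).clm_comp hΓn).congr fun z hz ↦ (hd z hz).fderiv
  exact (contDiffOn_infty.2 hn).contDiffAt (hWo.mem_nhds ⟨hz, hU⟩)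

variable (I B U) in
open Classical in
/-- The extension of an endomorphism `D` of the tangent space at `x` by parallel transport. -/
def parallelExtension (x : N) (D : E →ₗ[ℝ] E) (y : N) : E →L[ℝ] E :=
  if h : ∃ P, IsTransport I B U x y P then
    (h.choose.toLinearMap ∘ₗ D ∘ₗ h.choose.symm.toLinearMap).toContinuousLinearMap else 0

/-- Two transports from `x` to `y` differ by a holonomy at `x`, with which `D` commutes, so the
chosen path does not matter. -/
theorem parallelExtension_apply {x y : N} {D : E →ₗ[ℝ] E}
    (hD : ∀ P, IsTransport I B U x x P → ∀ v, D (P v) = P (D v)) {P : E ≃ₗ[ℝ] E}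
    (hP : IsTransport I B U x y P) (v : E) :
    parallelExtension I B U x D y (P v) = P (D v) := by
  have h : ∃ P, IsTransport I B U x y P := ⟨P, hP⟩
  have := hD _ (hP.trans h.choose_spec.symm) v
  simp only [LinearEquiv.trans_apply] at this
  rw [parallelExtension, dif_pos h]
  simp [this]

theorem parallelExtension_transport {x y y' : N} {D : E →ₗ[ℝ] E}
    (hD : ∀ P, IsTransport I B U x x P → ∀ v, D (P v) = P (D v)) {P Q : E ≃ₗ[ℝ] E}
    (hP : IsTransport I B U x y P) (hQ : IsTransport I B U y y' Q) (v : E) :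
    parallelExtension I B U x D y' (Q v) = Q (parallelExtension I B U x D y v) := by
  obtain ⟨w, rfl⟩ := P.surjective v
  rw [parallelExtension_apply hD hP]
  exact parallelExtension_apply hD (hP.trans hQ) w

end ParallelEndo

/-! ### The cone metric in coordinates -/

section Cone

variable {d : ℕ} {M : Type*} [TopologicalSpace M] [ChartedSpace (EuclideanSpace ℝ (Fin d)) M]

theorem extChartAt_cone_symm (x : M × ℝ) (z : EuclideanSpace ℝ (Fin d) × ℝ) :
    (extChartAt ((𝓡 d).prod 𝓘(ℝ, ℝ)) x).symm z = ((extChartAt (𝓡 d) x.1).symm z.1, z.2) := rfl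

theorem mem_extChartAt_cone_target (x : M × ℝ) (z : EuclideanSpace ℝ (Fin d) × ℝ) :
    z ∈ (extChartAt ((𝓡 d).prod 𝓘(ℝ, ℝ)) x).target ↔ z.1 ∈ (extChartAt (𝓡 d) x.1).target := by
  rw [extChartAt_prod, PartialEquiv.prod_target, mem_prod, extChartAt_model_space_eq_id]
  simp only [PartialEquiv.refl_target, mem_univ, and_true]

theorem mem_extChartAt_cone_source (x y : M × ℝ) :
    y ∈ (extChartAt ((𝓡 d).prod 𝓘(ℝ, ℝ)) x).source ↔ y.1 ∈ (extChartAt (𝓡 d) x.1).source := by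
  rw [extChartAt_prod, PartialEquiv.prod_source, mem_prod, extChartAt_model_space_eq_id]
  simp only [PartialEquiv.refl_source, mem_univ, and_true]

variable [IsManifold (𝓡 d) ∞ M]

theorem fromChart_cone (x : M × ℝ) {z : EuclideanSpace ℝ (Fin d) × ℝ}
    (hz : z.1 ∈ (extChartAt (𝓡 d) x.1).target) (u : EuclideanSpace ℝ (Fin d) × ℝ) :
    fromChart ((𝓡 d).prod 𝓘(ℝ, ℝ)) x z u = (fromChart (𝓡 d) x.1 z.1 u.1, u.2) := by
  have h1 : HasMFDerivAt 𝓘(ℝ, EuclideanSpace ℝ (Fin d) × ℝ) (𝓡 d)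
      (fun w : EuclideanSpace ℝ (Fin d) × ℝ ↦ (extChartAt (𝓡 d) x.1).symm w.1) z
      ((mfderiv 𝓘(ℝ, EuclideanSpace ℝ (Fin d)) (𝓡 d) (extChartAt (𝓡 d) x.1).symm z.1) ∘L
        (ContinuousLinearMap.fst ℝ (EuclideanSpace ℝ (Fin d)) ℝ)) :=
    (hasMFDerivAt_extChartAt_symm (𝓡 d) hz).comp z
      (hasFDerivAt_fst (𝕜 := ℝ) (p := z)).hasMFDerivAt
  have h2 : HasMFDerivAt 𝓘(ℝ, EuclideanSpace ℝ (Fin d) × ℝ) 𝓘(ℝ, ℝ)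
      (fun w : EuclideanSpace ℝ (Fin d) × ℝ ↦ w.2) z
        (ContinuousLinearMap.snd ℝ (EuclideanSpace ℝ (Fin d)) ℝ) :=
    (hasFDerivAt_snd (𝕜 := ℝ) (p := z)).hasMFDerivAt
  have h3 := (h1.prodMk h2).mfderiv
  exact congrArg (fun f : (EuclideanSpace ℝ (Fin d) × ℝ) →L[ℝ] (EuclideanSpace ℝ (Fin d) × ℝ) ↦ f u)
    h3

theorem toChart_cone (x : M × ℝ) {y : M × ℝ} (hy : y.1 ∈ (extChartAt (𝓡 d) x.1).source)
    (u : EuclideanSpace ℝ (Fin d) × ℝ) :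
    toChart ((𝓡 d).prod 𝓘(ℝ, ℝ)) x y u = (toChart (𝓡 d) x.1 y.1 u.1, u.2) := by
  have hy' := (mem_extChartAt_cone_source x y).2 hy
  have h1 : fromChart ((𝓡 d).prod 𝓘(ℝ, ℝ)) x (extChartAt ((𝓡 d).prod 𝓘(ℝ, ℝ)) x y)
      (toChart (𝓡 d) x.1 y.1 u.1, u.2) = u := by
    rw [fromChart_cone x ((extChartAt (𝓡 d) x.1).map_source hy)]
    exact Prod.ext (fromChart_toChart (𝓡 d) hy u.1) rfl
  have h2 := toChart_fromChart ((𝓡 d).prod 𝓘(ℝ, ℝ))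
    ((extChartAt ((𝓡 d).prod 𝓘(ℝ, ℝ)) x).map_source hy') (toChart (𝓡 d) x.1 y.1 u.1, u.2)
  rwa [(extChartAt ((𝓡 d).prod 𝓘(ℝ, ℝ)) x).left_inv hy', h1] at h2

variable (g : ContMDiffRiemannianMetric (𝓡 d) ∞ (EuclideanSpace ℝ (Fin d))
      (fun p : M ↦ TangentSpace (𝓡 d) p))

/-- The metric `g`, with the tangent spaces identified with the model space. -/
def baseBilin (p : M) : EuclideanSpace ℝ (Fin d) →L[ℝ] EuclideanSpace ℝ (Fin d) →L[ℝ] ℝ := g.inner p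

/-- The cone metric, as a continuous bilinear form. -/
def coneBilin (x : M × ℝ) : (EuclideanSpace ℝ (Fin d) × ℝ) →L[ℝ]
    (EuclideanSpace ℝ (Fin d) × ℝ) →L[ℝ] ℝ :=
  x.2 ^ 2 • (baseBilin g x.1).bilinearComp (ContinuousLinearMap.fst ℝ _ ℝ)
      (ContinuousLinearMap.fst ℝ _ ℝ) +
    (ContinuousLinearMap.mul ℝ ℝ).bilinearComp (ContinuousLinearMap.snd ℝ _ ℝ)
      (ContinuousLinearMap.snd ℝ _ ℝ)

theorem coneBilin_apply (x : M × ℝ) (u v : EuclideanSpace ℝ (Fin d) × ℝ) :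
    coneBilin g x u v = x.2 ^ 2 * baseBilin g x.1 u.1 v.1 + u.2 * v.2 := by
  simp [coneBilin]

theorem coneMetric_eq (x : M × ℝ) (u v : EuclideanSpace ℝ (Fin d) × ℝ) :
    coneMetric g x u v = coneBilin g x u v := (coneBilin_apply g x u v).symm

theorem contDiffAt_of_forall_apply {E F : Type*} [NormedAddCommGroup E] [NormedSpace ℝ E]
    [NormedAddCommGroup F] [NormedSpace ℝ F] {D : Type*} [NormedAddCommGroup D] [NormedSpace ℝ D]
    [FiniteDimensional ℝ D] {f : E → D →L[ℝ] F} {z : E} {n : WithTop ℕ∞}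
    (h : ∀ v, ContDiffAt ℝ n (fun y ↦ f y v) z) : ContDiffAt ℝ n f z := by
  set b := Module.finBasis ℝ D
  have hf : f = fun y ↦ ∑ i, ContinuousLinearMap.smulRightL ℝ D F
      (b.coord i).toContinuousLinearMap (f y (b i)) := by
    ext y v
    conv_lhs => rw [← b.sum_repr v, map_sum]
    simp
  rw [hf]
  exact ContDiffAt.sum fun i _ ↦ (ContinuousLinearMap.contDiff _).contDiffAt.comp z (h (b i))

theorem contMDiffAt_metric_apply {X Y : ∀ p : M, TangentSpace (𝓡 d) p} {p : M}
    (hX : ContMDiffAt (𝓡 d) (𝓡 d).tangent ∞ (fun y ↦ (⟨y, X y⟩ : TangentBundle (𝓡 d) M)) p)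
    (hY : ContMDiffAt (𝓡 d) (𝓡 d).tangent ∞ (fun y ↦ (⟨y, Y y⟩ : TangentBundle (𝓡 d) M)) p) :
    ContMDiffAt (𝓡 d) 𝓘(ℝ, ℝ) ∞ (fun y ↦ baseBilin g y (X y) (Y y)) p := by
  have : IsManifold (𝓡 d) (∞ + 1) M := by simpa using (inferInstance : IsManifold (𝓡 d) ∞ M)
  have h := ContMDiffAt.clm_bundle_apply₂ (F₁ := EuclideanSpace ℝ (Fin d))
    (F₂ := EuclideanSpace ℝ (Fin d)) (F₃ := ℝ) (E₃ := Bundle.Trivial M ℝ) (b := id) (g.contMDiff p)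
    hX hY
  simp only [contMDiffAt_totalSpace] at h
  exact h.2

theorem contDiffAt_chartMetric_base (p : M) {z : EuclideanSpace ℝ (Fin d)}
    (hz : z ∈ (extChartAt (𝓡 d) p).target) :
    ContDiffAt ℝ ∞ (chartMetric (𝓡 d) (baseBilin g) p) z := by
  refine contDiffAt_of_forall_apply fun u ↦ contDiffAt_of_forall_apply fun v ↦ ?_
  have hX : ∀ u : EuclideanSpace ℝ (Fin d), ContMDiffAt (𝓡 d) (𝓡 d).tangent ∞
      (fun y ↦ (⟨y, fromChart (𝓡 d) p (extChartAt (𝓡 d) p y) u⟩ : TangentBundle (𝓡 d) M))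
      ((extChartAt (𝓡 d) p).symm z) := by
    intro u
    have hs := (extChartAt (𝓡 d) p).map_target hz
    refine (contMDiffAt_vectorField_iff (𝓡 d)
      (X := fun y ↦ fromChart (𝓡 d) p (extChartAt (𝓡 d) p y) u) hs).2 ?_
    refine contMDiffAt_const (c := u) |>.congr_of_eventuallyEq ?_
    filter_upwards [(isOpen_extChartAt_source (I := 𝓡 d) p).mem_nhds hs] with y hy
    have := toChart_fromChart (𝓡 d) ((extChartAt (𝓡 d) p).map_source hy) u
    rwa [(extChartAt (𝓡 d) p).left_inv hy] at this
  have h1 : ContMDiffAt (𝓡 d) 𝓘(ℝ, ℝ) ∞ (fun y ↦ baseBilin g y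
      (fromChart (𝓡 d) p (extChartAt (𝓡 d) p y) u) (fromChart (𝓡 d) p (extChartAt (𝓡 d) p y) v))
      ((extChartAt (𝓡 d) p).symm z) :=
    contMDiffAt_metric_apply g (hX u) (hX v)
  have h2 := h1.comp z ((contMDiffOn_extChartAt_symm p).contMDiffAt (extChartAt_target_mem_nhds' hz))
  rw [← contMDiffAt_iff_contDiffAt]
  refine h2.congr_of_eventuallyEq ?_
  filter_upwards [extChartAt_target_mem_nhds' hz] with w hw
  simp only [chartMetric, Function.comp, ContinuousLinearMap.bilinearComp_apply]
  rw [(extChartAt (𝓡 d) p).right_inv hw]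

theorem chartMetric_cone (x : M × ℝ) {z : EuclideanSpace ℝ (Fin d) × ℝ}
    (hz : z.1 ∈ (extChartAt (𝓡 d) x.1).target) (u v : EuclideanSpace ℝ (Fin d) × ℝ) :
    chartMetric ((𝓡 d).prod 𝓘(ℝ, ℝ)) (coneBilin g) x z u v =
      z.2 ^ 2 * chartMetric (𝓡 d) (baseBilin g) x.1 z.1 u.1 v.1 + u.2 * v.2 := by
  rw [chartMetric, ContinuousLinearMap.bilinearComp_apply, coneBilin_apply, fromChart_cone x hz,
    fromChart_cone x hz]
  rfl

theorem isMetricOn_cone :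
    IsMetricOn ((𝓡 d).prod 𝓘(ℝ, ℝ)) (coneBilin g) {x : M × ℝ | 0 < x.2} where
  isOpen := isOpen_lt continuous_const continuous_snd
  symm x u v := by
    rw [coneBilin_apply, coneBilin_apply, mul_comm u.2]
    congr 2
    exact g.symm _ _ _
  pos x hx u hu := by
    rw [coneBilin_apply]
    have hx' : 0 < x.2 ^ 2 := pow_pos hx 2
    have hb : ∀ w : EuclideanSpace ℝ (Fin d), w ≠ 0 → 0 < baseBilin g x.1 w w := g.pos x.1
    by_cases h1 : u.1 = 0
    · have h2 : u.2 ≠ 0 := fun h2 ↦ hu (Prod.ext h1 h2)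
      rw [h1, map_zero, mul_zero, zero_add]
      exact mul_self_pos.2 h2
    · have := mul_pos hx' (hb _ h1)
      nlinarith [mul_self_nonneg u.2]
  smooth x z hz _ := by
    rw [mem_extChartAt_cone_target] at hz
    refine contDiffAt_of_forall_apply fun u ↦ contDiffAt_of_forall_apply fun v ↦ ?_
    have hG : ContDiffAt ℝ ∞ (fun w : EuclideanSpace ℝ (Fin d) × ℝ ↦
        chartMetric (𝓡 d) (baseBilin g) x.1 w.1) z :=
      (contDiffAt_chartMetric_base g x.1 hz).comp z contDiffAt_fst
    have h1 : ContDiffAt ℝ ∞ (fun w : EuclideanSpace ℝ (Fin d) × ℝ ↦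
        w.2 ^ 2 * chartMetric (𝓡 d) (baseBilin g) x.1 w.1 u.1 v.1 + u.2 * v.2) z :=
      ((contDiffAt_snd.pow 2).mul ((hG.clm_apply contDiffAt_const).clm_apply
        contDiffAt_const)).add contDiffAt_const
    refine h1.congr_of_eventuallyEq ?_
    filter_upwards [continuousAt_fst.eventually (extChartAt_target_mem_nhds' hz)] with w hw
    exact chartMetric_cone g x hw u v

theorem eq_of_forall_apply_eq {E : Type*} [NormedAddCommGroup E] [NormedSpace ℝ E]
    {b : E →L[ℝ] E →L[ℝ] ℝ} (hb : ∀ u, u ≠ 0 → 0 < b u u) {u v : E} (h : ∀ w, b u w = b v w) :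
    u = v := by
  by_contra hne
  have := hb _ (sub_ne_zero.2 hne)
  have e : b (u - v) = 0 := by
    ext w
    simp [h]
  rw [e] at this
  exact lt_irrefl _ this

theorem connection_apply_eq {E : Type*} [NormedAddCommGroup E] [NormedSpace ℝ E]
    [FiniteDimensional ℝ E] {G : E → E →L[ℝ] E →L[ℝ] ℝ} {z : E}
    (hG : ∀ u, u ≠ 0 → 0 < G z u u) (hd : DifferentiableAt ℝ G z) {u v c : E}
    (h : ∀ w, (fderiv ℝ (fun y ↦ G y v w) z u + fderiv ℝ (fun y ↦ G y u w) z v -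
      fderiv ℝ (fun y ↦ G y u v) z w) / 2 = -G z c w) : connection G z u v = c := by
  have hfd : ∀ a v w, fderiv ℝ G z a v w = fderiv ℝ (fun y ↦ G y v w) z a := by
    intro a v w
    have h1 := (hd.hasFDerivAt.clm_apply (hasFDerivAt_const v _)).clm_apply (hasFDerivAt_const w _)
    rw [h1.fderiv]
    simp
  refine eq_of_forall_apply_eq hG fun w ↦ ?_
  rw [metric_connection hG, christoffel_apply, hfd, hfd, hfd, h, neg_neg]

/-- The Levi-Civita connection of the cone in the direction of `∂_r`. -/
theorem connection_cone_radial (p : M) (u : EuclideanSpace ℝ (Fin d)) :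
    connection (chartMetric ((𝓡 d).prod 𝓘(ℝ, ℝ)) (coneBilin g) (p, 1))
      (extChartAt ((𝓡 d).prod 𝓘(ℝ, ℝ)) (p, (1 : ℝ)) (p, 1)) (u, 0) (0, 1) = (-u, 0) := by
  set G := chartMetric ((𝓡 d).prod 𝓘(ℝ, ℝ)) (coneBilin g) (p, 1) with hG
  set z := extChartAt ((𝓡 d).prod 𝓘(ℝ, ℝ)) (p, (1 : ℝ)) (p, 1) with hz
  have hU : (p, (1 : ℝ)) ∈ {x : M × ℝ | 0 < x.2} := by simp
  have hpos : ∀ v, v ≠ 0 → 0 < G z v v := chartMetric_pos (isMetricOn_cone g)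
    (mem_extChartAt_target _) (by rw [extChartAt_to_inv]; exact hU)
  have hd : DifferentiableAt ℝ G z :=
    ((isMetricOn_cone g).smooth_self hU).differentiableAt (by simp)
  have hz1 : z.1 ∈ (extChartAt (𝓡 d) p).target := mem_extChartAt_target p
  have hz2 : z.2 = 1 := rfl
  have hev : ∀ᶠ w in 𝓝 z, w.1 ∈ (extChartAt (𝓡 d) p).target :=
    continuousAt_fst.eventually (extChartAt_target_mem_nhds' hz1)
  -- The product of ∂_r with a constant vector is constant in these coordinates, so only the radial
  -- derivative of the metric survives in the Koszul formula. As `connection` is minus the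
  -- Christoffel symbol, the value `-u` means ∇_u ∂_r = u.
  have hR : ∀ (a v : EuclideanSpace ℝ (Fin d) × ℝ), fderiv ℝ (fun y ↦ G y v (0, 1)) z a = 0 := by
    intro a v
    have : (fun y ↦ G y v (0, 1)) =ᶠ[𝓝 z] fun _ ↦ v.2 := hev.mono fun w hw ↦ by
      simp only [hG]
      rw [chartMetric_cone g _ hw]
      simp
    rw [this.fderiv_eq]
    simp
  have hsym : ∀ y v w, G y v w = G y w v := fun y v w ↦ (isMetricOn_cone g).symm _ _ _
  have hR' : ∀ (a v : EuclideanSpace ℝ (Fin d) × ℝ), fderiv ℝ (fun y ↦ G y (0, 1) v) z a = 0 := by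
    intro a v
    simp_rw [fun y ↦ hsym y (0, 1) v]
    exact hR a v
  -- On vectors tangent to the base the cone metric is proportional to r², whose derivative at r = 1
  -- is 2.
  have hrad : ∀ w : EuclideanSpace ℝ (Fin d) × ℝ,
      fderiv ℝ (fun y ↦ G y (u, 0) w) z (0, 1) = 2 * G z (u, 0) w := by
    intro w
    have h0 : DifferentiableAt ℝ (fun y ↦ G y (u, 0) w) z :=
      (hd.clm_apply (differentiableAt_const _)).clm_apply (differentiableAt_const _)
    have hl : HasDerivAt (fun r : ℝ ↦ z + r • ((0, 1) : EuclideanSpace ℝ (Fin d) × ℝ)) (0, 1) 0 := by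
      simpa using ((hasDerivAt_id (0 : ℝ)).smul_const
        ((0, 1) : EuclideanSpace ℝ (Fin d) × ℝ)).const_add z
    have h1 := HasFDerivAt.comp_hasDerivAt (0 : ℝ) (l := fun y ↦ G y (u, 0) w)
      (f := fun r : ℝ ↦ z + r • ((0, 1) : EuclideanSpace ℝ (Fin d) × ℝ))
      (by simpa using h0.hasFDerivAt) hl
    have h2 : HasDerivAt (fun r : ℝ ↦ (1 + r) ^ 2 *
        chartMetric (𝓡 d) (baseBilin g) p z.1 u w.1)
        (2 * chartMetric (𝓡 d) (baseBilin g) p z.1 u w.1) 0 := by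
      have := (((hasDerivAt_id (0 : ℝ)).const_add 1).pow 2).mul_const
        (chartMetric (𝓡 d) (baseBilin g) p z.1 u w.1)
      simpa using this
    have h3 : ((fun y ↦ G y (u, 0) w) ∘
        fun r : ℝ ↦ z + r • ((0, 1) : EuclideanSpace ℝ (Fin d) × ℝ)) =
        fun r : ℝ ↦ (1 + r) ^ 2 * chartMetric (𝓡 d) (baseBilin g) p z.1 u w.1 := by
      funext r
      simp only [Function.comp, hG]
      rw [chartMetric_cone g _ (by simpa using hz1)]
      simp [hz2]
    rw [h3] at h1
    have hval : G z (u, 0) w = z.2 ^ 2 * chartMetric (𝓡 d) (baseBilin g) p z.1 u w.1 + 0 * w.2 :=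
      chartMetric_cone g (p, 1) hz1 (u, 0) w
    rw [h1.unique h2, hval, hz2]
    ring
  have hneg : ((-u, 0) : EuclideanSpace ℝ (Fin d) × ℝ) = -(u, 0) := Prod.ext rfl neg_zero.symm
  rw [hneg]
  refine connection_apply_eq hpos hd fun w ↦ ?_
  rw [hR w (u, 0), hR' (u, 0) w, hrad w, map_neg (G z)]
  change _ = -(-(G z (u, 0) w))
  ring

end Cone

/-! ### Quaternionic structures on the cone -/

section Pairing

variable {E : Type*} [NormedAddCommGroup E] [NormedSpace ℝ E] [FiniteDimensional ℝ E]

theorem fderiv_symm {G : E → E →L[ℝ] E →L[ℝ] ℝ} {z : E} (hd : DifferentiableAt ℝ G z)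
    (hs : ∀ y u v, G y u v = G y v u) (h u v : E) : fderiv ℝ G z h u v = fderiv ℝ G z h v u := by
  have hfd : ∀ v w, fderiv ℝ G z h v w = fderiv ℝ (fun y ↦ G y v w) z h := by
    intro v w
    have h1 := (hd.hasFDerivAt.clm_apply (hasFDerivAt_const v _)).clm_apply (hasFDerivAt_const w _)
    rw [h1.fderiv]
    simp
  rw [hfd, hfd]
  simp_rw [fun y ↦ hs y u v]

/-- Product rule with dA = [Γ, A]: the term `G w (Γ_h A R)` combines with the derivative of `G` into
a Christoffel symbol, and the other half of the commutator remains. With `R` = ∂_r this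
differentiates the forms α_q. -/
theorem fderiv_metric_parallel {G : E → E →L[ℝ] E →L[ℝ] ℝ} {A : E → E →L[ℝ] E} {z : E}
    (hd : DifferentiableAt ℝ G z) (hs : ∀ y u v, G y u v = G y v u)
    (hpos : ∀ u, u ≠ 0 → 0 < G z u u)
    (hA : HasFDerivAt A (commutatorMap (connection G z) (A z)) z) (w R h : E) :
    fderiv ℝ (fun y ↦ G y w (A y R)) z h =
      christoffel (fderiv ℝ G z) h w (A z R) - G z w (A z (connection G z h R)) := by
  have h1 := (hd.hasFDerivAt.clm_apply (hasFDerivAt_const w z)).clm_apply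
    (hA.clm_apply (hasFDerivAt_const R z))
  have h2 : G z w (connection G z h (A z R)) = -christoffel (fderiv ℝ G z) h (A z R) w := by
    rw [hs, metric_connection hpos]
  have h3 := fderiv_symm hd hs
  have hmul : ∀ (a b : E →L[ℝ] E) (v : E), (a * b) v = a (b v) := fun _ _ _ ↦ rfl
  rw [h1.fderiv]
  simp only [add_apply, ContinuousLinearMap.comp_apply, ContinuousLinearMap.flip_apply,
    zero_apply, map_zero, zero_add, commutatorMap_apply, sub_apply,
    hmul, map_sub, h2]
  rw [christoffel_apply, christoffel_apply, h3 h (A z R) w, h3 w h (A z R), h3 (A z R) h w]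
  ring

theorem christoffel_comm {G : E → E →L[ℝ] E →L[ℝ] ℝ} {z : E} (hd : DifferentiableAt ℝ G z)
    (hs : ∀ y u v, G y u v = G y v u) (u v w : E) :
    christoffel (fderiv ℝ G z) u v w = christoffel (fderiv ℝ G z) v u w := by
  rw [christoffel_apply, christoffel_apply, fderiv_symm hd hs w u v]
  ring

end Pairing

/-! ### Parallel quaternionic fields and the 1-forms they define -/

section Fields

variable {d : ℕ} {M : Type*} [TopologicalSpace M] [ChartedSpace (EuclideanSpace ℝ (Fin d)) M]
  [IsManifold (𝓡 d) ∞ M]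

/-- Parallel fields of endomorphisms on the cone, defining on its tangent spaces a structure of
right quaternionic vector space which is compatible with the metric. -/
structure QuaternionicFields (n : ℕ)
    (g : ContMDiffRiemannianMetric (𝓡 d) ∞ (EuclideanSpace ℝ (Fin d))
      (fun p : M ↦ TangentSpace (𝓡 d) p)) where
  /-- The multiplication by a quaternion. -/
  field : ℍ[ℝ] → M × ℝ → (EuclideanSpace ℝ (Fin d) × ℝ) →L[ℝ] (EuclideanSpace ℝ (Fin d) × ℝ)
  exists_frame : ∀ y : M × ℝ, 0 < y.2 →
    ∃ ψ : (EuclideanSpace ℝ (Fin d) × ℝ) ≃ₗ[ℝ] (Fin (n + 1) → ℍ[ℝ]),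
      (∀ v, coneBilin g y v v = ∑ i, ‖ψ v i‖ ^ 2) ∧ ∀ q v i, ψ (field q y v) i = ψ v i * q
  transport : ∀ q y y' Q, IsTransport ((𝓡 d).prod 𝓘(ℝ, ℝ)) (coneBilin g) {x : M × ℝ | 0 < x.2} y y' Q →
    ∀ v, field q y' (Q v) = Q (field q y v)

theorem bilin_eq_sum_inner {E : Type*} [NormedAddCommGroup E] [NormedSpace ℝ E] {n : ℕ}
    {b : E →L[ℝ] E →L[ℝ] ℝ} (hs : ∀ u v, b u v = b v u) {ψ : E ≃ₗ[ℝ] (Fin n → ℍ[ℝ])}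
    (h : ∀ v, b v v = ∑ i, ‖ψ v i‖ ^ 2) (u v : E) : b u v = ∑ i, inner ℝ (ψ u i) (ψ v i) := by
  have h1 := h (u + v)
  have h2 : ∀ i, ‖ψ (u + v) i‖ ^ 2 =
      ‖ψ u i‖ ^ 2 + 2 * inner ℝ (ψ u i) (ψ v i) + ‖ψ v i‖ ^ 2 := fun i ↦ by
    rw [map_add, Pi.add_apply, norm_add_sq_real]
  simp only [map_add b, add_apply, map_add (b u), map_add (b v), h2, Finset.sum_add_distrib,
    ← Finset.mul_sum, h u, h v, hs v u] at h1
  linarith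

theorem inner_mul_right_quaternion (a b q : ℍ[ℝ]) :
    inner ℝ (a * q) b = inner ℝ a (b * star q) := by
  simp only [Quaternion.inner_def, star_mul, star_star, mul_assoc]

theorem inner_self_mul_quaternion (a q : ℍ[ℝ]) : inner ℝ a (a * q) = q.re * ‖a‖ ^ 2 := by
  rw [Quaternion.inner_def, star_mul, ← mul_assoc, sq, ← Quaternion.normSq_eq_norm_mul_self,
    Quaternion.normSq_def']
  simp only [Quaternion.re_mul, Quaternion.imI_mul, Quaternion.imJ_mul, Quaternion.imK_mul,
    Quaternion.re_star, Quaternion.imI_star, Quaternion.imJ_star, Quaternion.imK_star]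
  ring

namespace QuaternionicFields

variable {n : ℕ} {g : ContMDiffRiemannianMetric (𝓡 d) ∞ (EuclideanSpace ℝ (Fin d))
      (fun p : M ↦ TangentSpace (𝓡 d) p)} (K : QuaternionicFields n g)

/-- The quaternions act by multiplication on the right, hence the reversed product. -/
theorem field_field {y : M × ℝ} (hy : 0 < y.2) (a b : ℍ[ℝ]) (v : EuclideanSpace ℝ (Fin d) × ℝ) :
    K.field a y (K.field b y v) = K.field (b * a) y v := by
  obtain ⟨ψ, -, h⟩ := K.exists_frame y hy
  apply ψ.injective
  funext i
  rw [h, h, h, mul_assoc]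

theorem field_one {y : M × ℝ} (hy : 0 < y.2) (v : EuclideanSpace ℝ (Fin d) × ℝ) :
    K.field 1 y v = v := by
  obtain ⟨ψ, -, h⟩ := K.exists_frame y hy
  apply ψ.injective
  funext i
  rw [h, mul_one]

theorem field_add {y : M × ℝ} (hy : 0 < y.2) (a b : ℍ[ℝ]) (v : EuclideanSpace ℝ (Fin d) × ℝ) :
    K.field (a + b) y v = K.field a y v + K.field b y v := by
  obtain ⟨ψ, -, h⟩ := K.exists_frame y hy
  apply ψ.injective
  funext i
  rw [map_add, Pi.add_apply, h, h, h, mul_add]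

theorem field_smul {y : M × ℝ} (hy : 0 < y.2) (c : ℝ) (b : ℍ[ℝ])
    (v : EuclideanSpace ℝ (Fin d) × ℝ) : K.field (c • b) y v = c • K.field b y v := by
  obtain ⟨ψ, -, h⟩ := K.exists_frame y hy
  apply ψ.injective
  funext i
  rw [map_smul, Pi.smul_apply, h, h, mul_smul_comm]

theorem bilin_field_left {y : M × ℝ} (hy : 0 < y.2) (q : ℍ[ℝ])
    (u v : EuclideanSpace ℝ (Fin d) × ℝ) :
    coneBilin g y (K.field q y u) v = coneBilin g y u (K.field (star q) y v) := by
  obtain ⟨ψ, hψ, h⟩ := K.exists_frame y hy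
  have := bilin_eq_sum_inner ((isMetricOn_cone g).symm y) hψ
  rw [this, this]
  simp only [h, inner_mul_right_quaternion]

theorem bilin_field_self {y : M × ℝ} (hy : 0 < y.2) (q : ℍ[ℝ])
    (u : EuclideanSpace ℝ (Fin d) × ℝ) :
    coneBilin g y u (K.field q y u) = q.re * coneBilin g y u u := by
  obtain ⟨ψ, hψ, h⟩ := K.exists_frame y hy
  rw [bilin_eq_sum_inner ((isMetricOn_cone g).symm y) hψ, hψ, Finset.mul_sum]
  simp only [h, inner_self_mul_quaternion]

/-- The vector field `J_q ∂_r`, projected to `M`. -/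
def vectorField (q : ℍ[ℝ]) (p : M) : EuclideanSpace ℝ (Fin d) := (K.field q (p, 1) (0, 1)).1

/-- The inner product of ∂_r with its multiple by `q` is `q.re`, so the radial component vanishes
for imaginary `q`. -/
theorem field_radial {q : ℍ[ℝ]} (hq : q.re = 0) (p : M) :
    K.field q (p, 1) (0, 1) = (K.vectorField q p, 0) := by
  refine Prod.ext rfl ?_
  have := K.bilin_field_self (y := (p, 1)) one_pos q (0, 1)
  rw [hq, zero_mul, coneBilin_apply] at this
  simpa using this

theorem coneBilin_radial (p : M) : coneBilin g (p, 1) (0, 1) (0, 1) = 1 := by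
  rw [coneBilin_apply]
  simp

theorem hasFDerivAt_field (q : ℍ[ℝ]) {x : M × ℝ} {z : EuclideanSpace ℝ (Fin d) × ℝ}
    (hz : z.1 ∈ (extChartAt (𝓡 d) x.1).target) (hz2 : 0 < z.2) :
    HasFDerivAt (endoInChart ((𝓡 d).prod 𝓘(ℝ, ℝ)) (K.field q) x)
      (commutatorMap (connection (chartMetric ((𝓡 d).prod 𝓘(ℝ, ℝ)) (coneBilin g) x) z)
        (endoInChart ((𝓡 d).prod 𝓘(ℝ, ℝ)) (K.field q) x z)) z :=
  hasFDerivAt_endoInChart (isMetricOn_cone g) (K.transport q)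
    ((mem_extChartAt_cone_target x z).2 hz) (by
      rw [extChartAt_cone_symm]
      simpa using hz2)

/-- The fields are only required to be equivariant under transport; their smoothness is that of
`contDiffAt_endoInChart`, here restricted to the slice r = 1. -/
theorem contMDiff_vectorField (q : ℍ[ℝ]) : ContMDiff (𝓡 d) (𝓡 d).tangent ∞
    (fun p ↦ (⟨p, K.vectorField q p⟩ : TangentBundle (𝓡 d) M)) := by
  intro p
  refine (contMDiffAt_vectorField_iff (𝓡 d) (X := fun p ↦ K.vectorField q p)
    (mem_extChartAt_source p)).2 ?_
  have h1 : ContDiffAt ℝ ∞ (endoInChart ((𝓡 d).prod 𝓘(ℝ, ℝ)) (K.field q) (p, 1))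
      (extChartAt (𝓡 d) p p, 1) := contDiffAt_endoInChart (isMetricOn_cone g) (K.transport q)
    ((mem_extChartAt_cone_target (p, 1) _).2 (mem_extChartAt_target p)) (by
      rw [extChartAt_cone_symm]
      simp)
  have h2 : ContDiffAt ℝ ∞ (fun z : EuclideanSpace ℝ (Fin d) ↦
      (endoInChart ((𝓡 d).prod 𝓘(ℝ, ℝ)) (K.field q) (p, 1) (z, 1) (0, 1)).1)
      (extChartAt (𝓡 d) p p) := by
    have h3 : ContDiffAt ℝ ∞ (fun z : EuclideanSpace ℝ (Fin d) ↦
        endoInChart ((𝓡 d).prod 𝓘(ℝ, ℝ)) (K.field q) (p, 1) (z, 1)) (extChartAt (𝓡 d) p p) :=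
      ContDiffAt.comp (f := fun z : EuclideanSpace ℝ (Fin d) ↦ (z, (1 : ℝ))) _ h1
        (contDiffAt_id.prodMk contDiffAt_const)
    exact contDiffAt_fst.comp _ (h3.clm_apply contDiffAt_const)
  have h4 := h2.contMDiffAt.comp p (contMDiffAt_extChartAt (I := 𝓡 d) (n := ∞) (x := p))
  refine h4.congr_of_eventuallyEq ?_
  filter_upwards [extChartAt_source_mem_nhds (I := 𝓡 d) p] with y hy
  have e1 := fromChart_cone (p, (1 : ℝ)) (z := (extChartAt (𝓡 d) p y, 1))
    ((extChartAt (𝓡 d) p).map_source hy) (0, 1)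
  simp only [endoInChart, Function.comp, ContinuousLinearMap.comp_apply, e1, extChartAt_cone_symm]
  rw [(extChartAt (𝓡 d) p).left_inv hy, toChart_cone (p, 1) hy, map_zero]
  rfl

/-- The 1-form `α_q (v) = ḡ (v, J_q ∂_r)`. -/
def form (q : ℍ[ℝ]) : OneForm d M where
  toFun p := g.inner p (K.vectorField q p)
  contMDiff_toFun := by
    have : IsManifold (𝓡 d) (∞ + 1) M := by simpa using (inferInstance : IsManifold (𝓡 d) ∞ M)
    exact ContMDiff.clm_bundle_apply (F₁ := EuclideanSpace ℝ (Fin d)) (b := id) g.contMDiff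
      (K.contMDiff_vectorField q)

theorem form_apply (q : ℍ[ℝ]) (p : M) (v : EuclideanSpace ℝ (Fin d)) :
    K.form q p v = coneBilin g (p, 1) (v, 0) (K.field q (p, 1) (0, 1)) := by
  rw [coneBilin_apply]
  simp only [one_pow, one_mul, zero_mul, add_zero]
  exact g.symm p _ _

end QuaternionicFields

end Fields

/-! ### The contact forms of a quaternionic structure -/

section ContactForms

variable {d : ℕ} {M : Type*} [TopologicalSpace M] [ChartedSpace (EuclideanSpace ℝ (Fin d)) M]
  [IsManifold (𝓡 d) ∞ M]

theorem OneForm.inChart_apply (α : OneForm d M) (x : M) (z w : EuclideanSpace ℝ (Fin d)) :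
    α.inChart x z w = α ((extChartAt (𝓡 d) x).symm z) (fromChart (𝓡 d) x z w) := rfl

/-- The coordinate expression of a 1-form is smooth. -/
theorem OneForm.contDiffAt_inChart (α : OneForm d M) (x : M) {z : EuclideanSpace ℝ (Fin d)}
    (hz : z ∈ (extChartAt (𝓡 d) x).target) : ContDiffAt ℝ ∞ (α.inChart x) z := by
  have : IsManifold (𝓡 d) (∞ + 1) M := by simpa using (inferInstance : IsManifold (𝓡 d) ∞ M)
  refine contDiffAt_of_forall_apply fun u ↦ ?_
  have hs := (extChartAt (𝓡 d) x).map_target hz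
  have hX : ContMDiffAt (𝓡 d) (𝓡 d).tangent ∞
      (fun y ↦ (⟨y, fromChart (𝓡 d) x (extChartAt (𝓡 d) x y) u⟩ : TangentBundle (𝓡 d) M))
      ((extChartAt (𝓡 d) x).symm z) := by
    refine (contMDiffAt_vectorField_iff (𝓡 d)
      (X := fun y ↦ fromChart (𝓡 d) x (extChartAt (𝓡 d) x y) u) hs).2 ?_
    refine contMDiffAt_const (c := u) |>.congr_of_eventuallyEq ?_
    filter_upwards [(isOpen_extChartAt_source (I := 𝓡 d) x).mem_nhds hs] with y hy
    have := toChart_fromChart (𝓡 d) ((extChartAt (𝓡 d) x).map_source hy) u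
    rwa [(extChartAt (𝓡 d) x).left_inv hy] at this
  have h1 := ContMDiffAt.clm_bundle_apply (F₁ := EuclideanSpace ℝ (Fin d))
    (F₂ := ℝ) (E₂ := Bundle.Trivial M ℝ) (b := id) (α.contMDiff ((extChartAt (𝓡 d) x).symm z)) hX
  simp only [contMDiffAt_totalSpace] at h1
  have h2 := h1.2.comp z ((contMDiffOn_extChartAt_symm x).contMDiffAt (extChartAt_target_mem_nhds' hz))
  rw [← contMDiffAt_iff_contDiffAt]
  refine h2.congr_of_eventuallyEq ?_
  filter_upwards [extChartAt_target_mem_nhds' hz] with w hw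
  rw [OneForm.inChart_apply]
  simp only [Function.comp]
  rw [(extChartAt (𝓡 d) x).right_inv hw]
  rfl

namespace QuaternionicFields

variable {n : ℕ} {g : ContMDiffRiemannianMetric (𝓡 d) ∞ (EuclideanSpace ℝ (Fin d))
      (fun p : M ↦ TangentSpace (𝓡 d) p)} (K : QuaternionicFields n g)

theorem form_inChart (q : ℍ[ℝ]) (p : M) {z : EuclideanSpace ℝ (Fin d)}
    (hz : z ∈ (extChartAt (𝓡 d) p).target) (w : EuclideanSpace ℝ (Fin d)) :
    (K.form q).inChart p z w = chartMetric ((𝓡 d).prod 𝓘(ℝ, ℝ)) (coneBilin g) (p, 1) (z, 1) (w, 0)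
      (endoInChart ((𝓡 d).prod 𝓘(ℝ, ℝ)) (K.field q) (p, 1) (z, 1) (0, 1)) := by
  have hz' : ((z, 1) : EuclideanSpace ℝ (Fin d) × ℝ) ∈
      (extChartAt ((𝓡 d).prod 𝓘(ℝ, ℝ)) (p, (1 : ℝ))).target :=
    (mem_extChartAt_cone_target (p, 1) _).2 hz
  rw [OneForm.inChart_apply, form_apply, chartMetric, ContinuousLinearMap.bilinearComp_apply,
    endoInChart, ContinuousLinearMap.comp_apply, ContinuousLinearMap.comp_apply]
  have h1 : ∀ v, fromChart ((𝓡 d).prod 𝓘(ℝ, ℝ)) (p, (1 : ℝ)) (z, 1)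
      (toChart ((𝓡 d).prod 𝓘(ℝ, ℝ)) (p, (1 : ℝ))
        ((extChartAt ((𝓡 d).prod 𝓘(ℝ, ℝ)) (p, (1 : ℝ))).symm (z, 1)) v) = v := fun v ↦ by
    have := fromChart_toChart ((𝓡 d).prod 𝓘(ℝ, ℝ))
      ((extChartAt ((𝓡 d).prod 𝓘(ℝ, ℝ)) (p, (1 : ℝ))).map_target hz') v
    rwa [(extChartAt ((𝓡 d).prod 𝓘(ℝ, ℝ)) (p, (1 : ℝ))).right_inv hz'] at this
  rw [h1, fromChart_cone (p, 1) hz, fromChart_cone (p, 1) hz, extChartAt_cone_symm, map_zero]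

/-- By `fderiv_metric_parallel` and ∇_u ∂_r = u, the derivative of α_q (v) along u is a Christoffel
symbol, symmetric in u and v, plus ḡ(v, J_q u). Antisymmetrizing removes the first and doubles the
second, as J_q is skew. -/
theorem extDerivAt_form {q : ℍ[ℝ]} (hq : q.re = 0) (p : M) (u v : EuclideanSpace ℝ (Fin d)) :
    (K.form q).extDerivAt p u v = 2 * coneBilin g (p, 1) (K.field q (p, 1) (u, 0)) (v, 0) := by
  set G := chartMetric ((𝓡 d).prod 𝓘(ℝ, ℝ)) (coneBilin g) (p, 1) with hG
  set A := endoInChart ((𝓡 d).prod 𝓘(ℝ, ℝ)) (K.field q) (p, 1) with hA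
  set z := extChartAt (𝓡 d) p p with hz
  have hU : (p, (1 : ℝ)) ∈ {x : M × ℝ | 0 < x.2} := by simp
  have hzt : z ∈ (extChartAt (𝓡 d) p).target := mem_extChartAt_target p
  have hd : DifferentiableAt ℝ G (z, 1) :=
    ((isMetricOn_cone g).smooth_self hU).differentiableAt (by simp)
  have hpos : ∀ v, v ≠ 0 → 0 < G (z, 1) v v := chartMetric_pos (isMetricOn_cone g)
    ((mem_extChartAt_cone_target (p, 1) _).2 hzt) (by rw [extChartAt_cone_symm]; simp)
  have hs : ∀ y u v, G y u v = G y v u := fun y u v ↦ (isMetricOn_cone g).symm _ _ _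
  have hAd := K.hasFDerivAt_field q (x := (p, 1)) (z := (z, 1)) hzt one_pos
  have hder : ∀ a b : EuclideanSpace ℝ (Fin d), fderiv ℝ ((K.form q).inChart p) z a b =
      christoffel (fderiv ℝ G (z, 1)) (a, 0) (b, 0) (A (z, 1) (0, 1)) +
        G (z, 1) (b, 0) (A (z, 1) (a, 0)) := by
    intro a b
    have h0 := ((OneForm.contDiffAt_inChart (K.form q) p hzt).differentiableAt
      (by simp)).hasFDerivAt.clm_apply (hasFDerivAt_const b z)
    have h1 : fderiv ℝ ((K.form q).inChart p) z a b =
        fderiv ℝ (fun y ↦ (K.form q).inChart p y b) z a := by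
      rw [h0.fderiv]
      simp
    have h2 : (fun y ↦ (K.form q).inChart p y b) =ᶠ[𝓝 z] fun y ↦ G (y, 1) (b, 0) (A (y, 1) (0, 1)) := by
      filter_upwards [extChartAt_target_mem_nhds' hzt] with y hy
      exact K.form_inChart q p hy b
    have h3 : DifferentiableAt ℝ (fun y ↦ G y (b, 0) (A y (0, 1))) (z, 1) :=
      (hd.clm_apply (differentiableAt_const _)).clm_apply
        (hAd.differentiableAt.clm_apply (differentiableAt_const _))
    have h4 : HasFDerivAt (fun y : EuclideanSpace ℝ (Fin d) ↦ (y, (1 : ℝ)))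
      (ContinuousLinearMap.inl ℝ _ ℝ) z := hasFDerivAt_prodMk_left z 1
    have h5 := h3.hasFDerivAt.comp z h4
    have h6 : connection G (z, 1) (a, 0) (0, 1) = (-a, 0) := connection_cone_radial g p a
    have hneg : ((-a, 0) : EuclideanSpace ℝ (Fin d) × ℝ) = -(a, 0) := Prod.ext rfl neg_zero.symm
    rw [h1, h2.fderiv_eq]
    refine (congrArg (fun f : EuclideanSpace ℝ (Fin d) →L[ℝ] ℝ ↦ f a) h5.fderiv).trans ?_
    rw [ContinuousLinearMap.comp_apply, ContinuousLinearMap.inl_apply,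
      fderiv_metric_parallel hd hs hpos hAd, h6, hneg, map_neg, map_neg, sub_neg_eq_add]
  have hGc : ∀ a b, G (z, 1) a b = coneBilin g (p, 1) a b := by
    intro a b
    rw [hG, chartMetric_cone g (p, 1) hzt, coneBilin_apply]
    simp only [chartMetric, ContinuousLinearMap.bilinearComp_apply]
    rw [hz, fromChart_self, extChartAt_to_inv]
    rfl
  have hAc : ∀ a, A (z, 1) a = K.field q (p, 1) a := by
    intro a
    have e1 : fromChart ((𝓡 d).prod 𝓘(ℝ, ℝ)) (p, (1 : ℝ)) (z, 1) = ContinuousLinearMap.id ℝ _ :=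
      fromChart_self ((𝓡 d).prod 𝓘(ℝ, ℝ)) (p, (1 : ℝ))
    have e2 : (extChartAt ((𝓡 d).prod 𝓘(ℝ, ℝ)) (p, (1 : ℝ))).symm (z, 1) = (p, 1) :=
      extChartAt_to_inv (I := (𝓡 d).prod 𝓘(ℝ, ℝ)) (p, (1 : ℝ))
    rw [hA, endoInChart, e1, e2, toChart_self]
    rfl
  have hskew : coneBilin g (p, 1) (u, 0) (K.field q (p, 1) (v, 0)) =
      -coneBilin g (p, 1) (K.field q (p, 1) (u, 0)) (v, 0) := by
    rw [K.bilin_field_left (y := (p, 1)) one_pos, Quaternion.star_eq_neg.2 hq]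
    have := K.field_smul (y := (p, 1)) one_pos (-1) q (v, 0)
    rw [neg_one_smul, neg_one_smul] at this
    rw [this, map_neg, neg_neg]
  change fderiv ℝ ((K.form q).inChart p) z u v - fderiv ℝ ((K.form q).inChart p) z v u = _
  rw [hder, hder, christoffel_comm hd hs (v, 0) (u, 0), hGc, hGc, hAc (u, 0),
    hAc (v, 0), hskew, (isMetricOn_cone g).symm (p, 1) (v, 0)]
  ring

theorem form_vectorField {a b : ℍ[ℝ]} (ha : a.re = 0) (p : M) :
    K.form b p (K.vectorField a p) = (b * star a).re := by
  have h := K.field_radial ha p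
  rw [form_apply, ← h, K.bilin_field_left (y := (p, 1)) one_pos,
    K.field_field (y := (p, 1)) one_pos, K.bilin_field_self (y := (p, 1)) one_pos, coneBilin_radial,
    mul_one]

/-- If α_q (u) = 0, then `w` = J_q u is orthogonal to ∂_r, hence tangent to M, and it lies in ker
α_q because J_q is an isometry and u is orthogonal to ∂_r. Then dα_q (u, w) = 2|w|², so u = 0 if
this vanishes. -/
theorem isContact_form {q : ℍ[ℝ]} (hq : q.re = 0) (hq1 : ‖q‖ = 1) : (K.form q).IsContact := by
  have h1 : q * star q = 1 := by
    rw [Quaternion.self_mul_star, Quaternion.normSq_eq_norm_mul_self, hq1]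
    simp
  intro p
  have hp : (0 : ℝ) < (p, (1 : ℝ)).2 := one_pos
  refine ⟨fun h ↦ ?_, fun u hu hker ↦ ?_⟩
  · have h2 := K.form_vectorField (b := q) hq p
    rw [h1] at h2
    have h3 : K.form q p (K.vectorField q p) = 0 := by rw [h]; rfl
    rw [h3] at h2
    simp at h2
  · have hu' := K.form_apply q p u
    set w : EuclideanSpace ℝ (Fin d) × ℝ := K.field q (p, 1) (u, 0) with hw
    have hw2 : w.2 = 0 := by
      have h2 : coneBilin g (p, 1) w (0, 1) = -coneBilin g (p, 1) (u, 0) (K.field q (p, 1) (0, 1)) := by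
        rw [hw, K.bilin_field_left hp, Quaternion.star_eq_neg.2 hq]
        have := K.field_smul hp (-1) q (0, 1)
        rw [neg_one_smul, neg_one_smul] at this
        rw [this, map_neg]
      rw [← hu', hu, neg_zero, coneBilin_apply] at h2
      simpa using h2
    have hw1 : (w.1, (0 : ℝ)) = w := Prod.ext rfl hw2.symm
    have hα : K.form q p w.1 = 0 := by
      rw [form_apply, hw1, hw, K.bilin_field_left hp, K.field_field hp, h1, K.field_one hp,
        coneBilin_apply]
      simp
    have h3 := hker w.1 hα
    have h4 := K.extDerivAt_form hq p u w.1
    rw [hw1, ← hw] at h4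
    have h5 : coneBilin g (p, 1) w w = 0 := by
      have : (K.form q).extDerivAt p u w.1 = 0 := h3
      linarith
    have hw0 : w = 0 := by
      by_contra hne
      exact ((isMetricOn_cone g).pos (p, 1) (by simp) w hne).ne' h5
    have h6 : K.field (star q) (p, 1) w = (u, 0) := by
      rw [hw, K.field_field hp, h1, K.field_one hp]
      rfl
    rw [hw0, map_zero] at h6
    exact (congrArg Prod.fst h6).symm

end QuaternionicFields

end ContactForms

/-! ### The quaternionic structure given by the holonomy -/

section Reduction

variable {d : ℕ} {M : Type*} [TopologicalSpace M] [ChartedSpace (EuclideanSpace ℝ (Fin d)) M]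
  [IsManifold (𝓡 d) ∞ M]
  {g : ContMDiffRiemannianMetric (𝓡 d) ∞ (EuclideanSpace ℝ (Fin d))
      (fun p : M ↦ TangentSpace (𝓡 d) p)}

theorem isConeParallel_of_isParallelAt {γ : ℝ → M × ℝ} {V : ℝ → EuclideanSpace ℝ (Fin d) × ℝ}
    (hγ : ContMDiff 𝓘(ℝ, ℝ) ((𝓡 d).prod 𝓘(ℝ, ℝ)) ∞ γ) (hU : ∀ t, γ t ∈ {x : M × ℝ | 0 < x.2})
    (hV : ∀ t, IsParallelAt ((𝓡 d).prod 𝓘(ℝ, ℝ)) (coneBilin g) (γ t) γ V t) :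
    IsConeParallel g (fun t ↦ ⟨γ t, V t⟩) :=
  ⟨hγ, fun t ↦ by simpa using hU t, (isParallelAlong_iff (isMetricOn_cone g) (coneMetric_eq g)
    (V := fun t ↦ ⟨γ t, V t⟩) hU).2 hV⟩

theorem IsConeParallel.isParallelAt {γ : ℝ → M × ℝ} {V : ℝ → EuclideanSpace ℝ (Fin d) × ℝ}
    (h : IsConeParallel g (fun t ↦ ⟨γ t, V t⟩)) (t : ℝ) :
    IsParallelAt ((𝓡 d).prod 𝓘(ℝ, ℝ)) (coneBilin g) (γ t) γ V t :=
  (isParallelAlong_iff (isMetricOn_cone g) (coneMetric_eq g)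
    (V := fun t ↦ ⟨γ t, V t⟩) (fun t ↦ by simpa using h.2.1 t)).1 h.2.2 t

theorem IsTransport.mem_coneHolonomy {x : M × ℝ}
    {P : (EuclideanSpace ℝ (Fin d) × ℝ) ≃ₗ[ℝ] (EuclideanSpace ℝ (Fin d) × ℝ)}
    (h : IsTransport ((𝓡 d).prod 𝓘(ℝ, ℝ)) (coneBilin g) {x : M × ℝ | 0 < x.2} x x P) :
    P ∈ coneHolonomy g x := by
  obtain ⟨γ, hγ, hU, h0, h1, hV⟩ := h
  refine ⟨γ, fun v ↦ ?_⟩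
  obtain ⟨V, hp, hV0, hV1⟩ := hV v
  refine ⟨fun t ↦ ⟨γ t, V t⟩, isConeParallel_of_isParallelAt hγ hU hp, fun t ↦ rfl, ?_, ?_⟩
  · simp only
    rw [h0 0 (by norm_num), hV0 0 (by norm_num)]
  · simp only
    rw [h1 1 (by norm_num), hV1 1 (by norm_num)]
    rfl

/-- The right multiplication by a quaternion, in a quaternionic frame. -/
def frameMul {E : Type*} [AddCommGroup E] [Module ℝ E] {n : ℕ} (ψ : E ≃ₗ[ℝ] (Fin n → ℍ[ℝ]))
    (q : ℍ[ℝ]) : E →ₗ[ℝ] E :=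
  ψ.symm.toLinearMap ∘ₗ ((LinearMap.mulRight ℝ q).compLeft (Fin n)) ∘ₗ ψ.toLinearMap

theorem frame_frameMul {E : Type*} [AddCommGroup E] [Module ℝ E] {n : ℕ}
    (ψ : E ≃ₗ[ℝ] (Fin n → ℍ[ℝ])) (q : ℍ[ℝ]) (v : E) (i : Fin n) :
    ψ (frameMul ψ q v) i = ψ v i * q := by
  simp [frameMul]

variable {n : ℕ} {x : M × ℝ}

/-- The frame of a reduction, with the tangent space identified with the model space. -/
def SpReduction.modelFrame (φ : SpReduction n g x) :
    (EuclideanSpace ℝ (Fin d) × ℝ) ≃ₗ[ℝ] (Fin (n + 1) → ℍ[ℝ]) := φ.frame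

/-- The holonomy acts by matrices on the left and `q` on the right, so this is associativity of the
quaternions. -/
theorem SpReduction.frameMul_comm (φ : SpReduction n g x) (q : ℍ[ℝ])
    (P : (EuclideanSpace ℝ (Fin d) × ℝ) ≃ₗ[ℝ] (EuclideanSpace ℝ (Fin d) × ℝ))
    (hP : IsTransport ((𝓡 d).prod 𝓘(ℝ, ℝ)) (coneBilin g) {x : M × ℝ | 0 < x.2} x x P)
    (v : EuclideanSpace ℝ (Fin d) × ℝ) :
    frameMul φ.modelFrame q (P v) = P (frameMul φ.modelFrame q v) := by
  obtain ⟨A, -, hA⟩ := φ.holonomy_le P hP.mem_coneHolonomy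
  have hA' : ∀ v, φ.modelFrame (P v) = A *ᵥ φ.modelFrame v := hA
  apply φ.modelFrame.injective
  funext i
  rw [frame_frameMul, hA', hA']
  simp only [Matrix.mulVec, dotProduct, frame_frameMul, Finset.sum_mul, mul_assoc]

theorem isPreconnected_cone [ConnectedSpace M] : IsPreconnected {x : M × ℝ | 0 < x.2} := by
  have h : {x : M × ℝ | 0 < x.2} = univ ×ˢ Ioi (0 : ℝ) := by
    ext x
    simp
  rw [h]
  exact isPreconnected_univ.prod isPreconnected_Ioi

/-- The quaternionic structure of the cone given by a reduction of its holonomy. -/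
def SpReduction.quaternionicFields [ConnectedSpace M] (φ : SpReduction n g x) (hx : 0 < x.2) :
    QuaternionicFields n g where
  field q := parallelExtension ((𝓡 d).prod 𝓘(ℝ, ℝ)) (coneBilin g) {x : M × ℝ | 0 < x.2} x
    (frameMul φ.modelFrame q)
  exists_frame y hy := by
    obtain ⟨P, hP⟩ := exists_transport (isMetricOn_cone g) isPreconnected_cone
      (show x ∈ {x : M × ℝ | 0 < x.2} by simpa using hx) (y := y) (by simpa using hy)
    refine ⟨P.symm.trans φ.modelFrame, fun v ↦ ?_, fun q v i ↦ ?_⟩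
    · have h1 := hP.metric_eq (isMetricOn_cone g) (P.symm v)
      rw [P.apply_symm_apply] at h1
      rw [h1, ← coneMetric_eq]
      exact φ.isometry _
    · obtain ⟨w, rfl⟩ := P.surjective v
      rw [parallelExtension_apply (φ.frameMul_comm q) hP]
      simp only [LinearEquiv.trans_apply, LinearEquiv.symm_apply_apply, frame_frameMul]
  transport q y y' Q hQ v := by
    have hy : y ∈ {x : M × ℝ | 0 < x.2} := by
      obtain ⟨γ, -, hU, h0, -⟩ := hQ
      rw [← h0 0 (by norm_num)]
      exact hU 0
    obtain ⟨P, hP⟩ := exists_transport (isMetricOn_cone g) isPreconnected_cone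
      (show x ∈ {x : M × ℝ | 0 < x.2} by simpa using hx) hy
    exact parallelExtension_transport (φ.frameMul_comm q) hP hQ v

/-- Along a transport from `x` to `y`, both `J` and the constructed field carry a parallel field to
a parallel field. The two images agree at `x`, hence at `y`. -/
theorem SpReduction.quaternionicFields_eq [ConnectedSpace M] (φ : SpReduction n g x)
    (hx : 0 < x.2) {J : ∀ x : M × ℝ, TangentSpace ((𝓡 d).prod 𝓘(ℝ, ℝ)) x →ₗ[ℝ]
      TangentSpace ((𝓡 d).prod 𝓘(ℝ, ℝ)) x} (hJ : IsConeParallelEndo g J) {q : ℍ[ℝ]}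
    (hq : ∀ v i, φ.frame (J x v) i = φ.frame v i * q) {y : M × ℝ} (hy : 0 < y.2)
    (v : EuclideanSpace ℝ (Fin d) × ℝ) : J y v = (φ.quaternionicFields hx).field q y v := by
  obtain ⟨P, hP⟩ := exists_transport (isMetricOn_cone g) isPreconnected_cone
    (show x ∈ {x : M × ℝ | 0 < x.2} by simpa using hx) (y := y) (by simpa using hy)
  obtain ⟨v, rfl⟩ := P.surjective v
  have h1 : (φ.quaternionicFields hx).field q y (P v) = P (frameMul φ.modelFrame q v) :=
    parallelExtension_apply (φ.frameMul_comm q) hP v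
  rw [h1]
  have hJx : J x v = frameMul φ.modelFrame q v := by
    apply φ.modelFrame.injective
    funext i
    rw [frame_frameMul]
    exact hq v i
  obtain ⟨γ, hγ, hU, h0, h1, hV⟩ := hP
  obtain ⟨V, hp, hV0, hV1⟩ := hV v
  obtain ⟨W, hq, hW0, hW1⟩ := hV (frameMul φ.modelFrame q v)
  have hJV := hJ _ (isConeParallel_of_isParallelAt hγ hU hp)
  have hJp := IsConeParallel.isParallelAt (γ := γ) (V := fun t ↦ J (γ t) (V t)) hJV
  have h2 : J (γ 0) (V 0) = W 0 := by
    rw [h0 0 (by norm_num), hV0 0 (by norm_num), hW0 0 (by norm_num), hJx]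
  have h3 := IsParallelAt.eq_of_eq (isMetricOn_cone g) hγ.continuous hU hJp hq h2 1
  rw [h1 1 (by norm_num), hV1 1 (by norm_num), hW1 1 (by norm_num)] at h3
  exact h3

end Reduction

/-! ### Lie derivatives of 1-forms along flows -/

/-- Cartan's formula in coordinates, for a 1-form whose value on the vector field is constant. -/
theorem hasDerivAt_pullback {E : Type*} [NormedAddCommGroup E] [NormedSpace ℝ E]
    {α : E → E →L[ℝ] ℝ} {ψ : ℝ × E → E} {X : E → E} {z : E} {c : ℝ}
    (hα : DifferentiableAt ℝ α z) (hψ : ContDiffAt ℝ 2 ψ (0, z)) (h0 : ∀ᶠ y in 𝓝 z, ψ (0, y) = y)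
    (hX : ∀ᶠ y in 𝓝 z, fderiv ℝ ψ (0, y) (1, 0) = X y) (hc : ∀ᶠ y in 𝓝 z, α y (X y) = c) (w : E) :
    HasDerivAt (fun s ↦ α (ψ (s, z)) (fderiv ℝ ψ (s, z) (0, w)))
      (fderiv ℝ α z (X z) w - fderiv ℝ α z w (X z)) 0 := by
  have hψd : DifferentiableAt ℝ ψ (0, z) := hψ.differentiableAt (by norm_num)
  have hD : DifferentiableAt ℝ (fderiv ℝ ψ) (0, z) :=
    (hψ.fderiv_right (m := 1) (by norm_num)).differentiableAt (by norm_num)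
  have hψ0 : ψ (0, z) = z := h0.self_of_nhds
  have hline : HasDerivAt (fun s : ℝ ↦ (s, z)) ((1 : ℝ), (0 : E)) 0 :=
    (hasDerivAt_id (0 : ℝ)).prodMk (hasDerivAt_const (0 : ℝ) z)
  have hslice : HasFDerivAt (fun y : E ↦ ((0 : ℝ), y)) (ContinuousLinearMap.inr ℝ ℝ E) z :=
    hasFDerivAt_prodMk_right 0 z
  have hw : fderiv ℝ ψ (0, z) (0, w) = w := by
    have h1 := (hψd.hasFDerivAt.comp z hslice).congr_of_eventuallyEq
      (f₁ := fun y ↦ y) (h0.mono fun y hy ↦ hy.symm)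
    have := congrArg (fun f : E →L[ℝ] E ↦ f w) (h1.unique (hasFDerivAt_id z))
    simpa using this
  have hXz : fderiv ℝ ψ (0, z) (1, 0) = X z := hX.self_of_nhds
  have hXd : HasFDerivAt X ((fderiv ℝ (fderiv ℝ ψ) (0, z)).flip (1, 0) ∘L
      ContinuousLinearMap.inr ℝ ℝ E) z := by
    have h1 := (hD.hasFDerivAt.clm_apply (hasFDerivAt_const ((1 : ℝ), (0 : E)) (0, z)))
    have h2 := (h1.comp z hslice).congr_of_eventuallyEq (f₁ := X) (hX.mono fun y hy ↦ hy.symm)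
    refine h2.congr_fderiv ?_
    ext v
    simp
  -- The derivative of the constant `α (X)` in the direction `w`: it expresses the term of the Lie
  -- derivative that contains the derivative of `X` through that of `α`, leaving the contraction of
  -- the exterior derivative with `X`.
  have hconst : fderiv ℝ α z w (X z) +
      α z (fderiv ℝ (fderiv ℝ ψ) (0, z) (0, w) (1, 0)) = 0 := by
    have h1 := (hα.hasFDerivAt.clm_apply hXd).congr_of_eventuallyEq (f₁ := fun _ ↦ c)
      (hc.mono fun y hy ↦ hy.symm)
    have := congrArg (fun f : E →L[ℝ] ℝ ↦ f w) (h1.unique (hasFDerivAt_const c z))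
    simp at this
    linarith
  have hsym : fderiv ℝ (fderiv ℝ ψ) (0, z) (0, w) (1, 0) =
      fderiv ℝ (fderiv ℝ ψ) (0, z) (1, 0) (0, w) := (hψ.isSymmSndFDerivAt (by simp)) _ _
  have h1 : HasDerivAt (fun s : ℝ ↦ ψ (s, z)) (X z) 0 := by
    rw [← hXz]
    exact hψd.hasFDerivAt.comp_hasDerivAt (0 : ℝ) hline
  have h2 : HasDerivAt (fun s : ℝ ↦ fderiv ℝ ψ (s, z) (0, w))
      (fderiv ℝ (fderiv ℝ ψ) (0, z) (1, 0) (0, w)) 0 := by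
    have h : HasDerivAt (fun s : ℝ ↦ fderiv ℝ ψ (s, z)) (fderiv ℝ (fderiv ℝ ψ) (0, z) (1, 0)) 0 :=
      hD.hasFDerivAt.comp_hasDerivAt (0 : ℝ) hline
    refine (h.clm_apply (hasDerivAt_const (0 : ℝ) ((0 : ℝ), w))).congr_deriv ?_
    rw [map_zero, add_zero]
  have h3 : HasDerivAt (fun s : ℝ ↦ α (ψ (s, z))) (fderiv ℝ α z (X z)) 0 :=
    HasFDerivAt.comp_hasDerivAt (0 : ℝ) (by rw [hψ0]; exact hα.hasFDerivAt) h1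
  refine (h3.clm_apply h2).congr_deriv ?_
  rw [hw, hψ0, ← hsym]
  linarith

section Flow

variable {d : ℕ} {M : Type*} [TopologicalSpace M] [ChartedSpace (EuclideanSpace ℝ (Fin d)) M]
  [IsManifold (𝓡 d) ∞ M]

theorem OneForm.apply_congr (α : OneForm d M) {p p' : M} {v v' : EuclideanSpace ℝ (Fin d)}
    (hp : p = p') (hv : v = v') : α p v = α p' v' := by
  subst hp hv
  rfl

/-- This is `hasDerivAt_pullback` in the chart at `p`, with `ψ` the flow in coordinates; the flow
keeps `p` in the chart for small times. -/
theorem OneForm.hasDerivAt_pullback_flow (α : OneForm d M) {X : ∀ p : M, TangentSpace (𝓡 d) p}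
    {Φ : ℝ → M → M} (h0 : ∀ y, Φ 0 y = y) (hΦ : ∀ y, IsMIntegralCurve (fun t ↦ Φ t y) X)
    (hΦs : ContMDiff (𝓘(ℝ, ℝ).prod (𝓡 d)) (𝓡 d) ∞ (fun z : ℝ × M ↦ Φ z.1 z.2)) {c : ℝ}
    (hc : ∀ p, α p (X p) = c) (p : M) (w : EuclideanSpace ℝ (Fin d)) :
    HasDerivAt (fun s ↦ α (Φ s p) (mfderiv (𝓡 d) (𝓡 d) (Φ s) p w))
      (α.extDerivAt p (X p) w) 0 := by
  set e := extChartAt (𝓡 d) p with he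
  set z := e p with hz
  have hzt : z ∈ e.target := mem_extChartAt_target p
  have hez : e.symm z = p := extChartAt_to_inv p
  set ψ : ℝ × EuclideanSpace ℝ (Fin d) → EuclideanSpace ℝ (Fin d) :=
    fun y ↦ e (Φ y.1 (e.symm y.2)) with hψdef
  have hψ : ContDiffAt ℝ ∞ ψ (0, z) := by
    rw [← contMDiffAt_iff_contDiffAt]
    have h1 : ContMDiffAt 𝓘(ℝ, ℝ × EuclideanSpace ℝ (Fin d)) (𝓘(ℝ, ℝ).prod (𝓡 d)) ∞
        (fun y : ℝ × EuclideanSpace ℝ (Fin d) ↦ (y.1, e.symm y.2)) (0, z) :=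
      (contDiffAt_fst.contMDiffAt).prodMk (ContMDiffAt.comp (0, z)
        ((contMDiffOn_extChartAt_symm p).contMDiffAt (extChartAt_target_mem_nhds' hzt))
        contDiffAt_snd.contMDiffAt)
    have h2 := (hΦs.contMDiffAt (x := (0, e.symm z))).comp (0, z) h1
    refine ContMDiffAt.comp (0, z) (g := e) ?_ h2
    change ContMDiffAt (𝓡 d) 𝓘(ℝ, EuclideanSpace ℝ (Fin d)) ∞ e (Φ 0 (e.symm z))
    rw [h0, hez]
    exact contMDiffAt_extChartAt
  have hΦd : ∀ s y, MDifferentiableAt (𝓡 d) (𝓡 d) (Φ s) y := fun s y ↦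
    ((hΦs.comp (contMDiff_const.prodMk contMDiff_id)).mdifferentiable (by simp)) y
  have hev : ∀ᶠ s in 𝓝 (0 : ℝ), Φ s p ∈ e.source ∧ DifferentiableAt ℝ ψ (s, z) := by
    have h1 : ContinuousAt (fun s : ℝ ↦ Φ s p) 0 :=
      (hΦs.continuous.comp (continuous_id.prodMk continuous_const)).continuousAt
    have h2 : ContinuousAt (fun s : ℝ ↦ (s, z)) 0 := by fun_prop
    refine Filter.Eventually.and (h1.eventually ?_) (h2.eventually ?_)
    · change ∀ᶠ y in 𝓝 (Φ 0 p), y ∈ e.source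
      rw [h0]
      exact extChartAt_source_mem_nhds p
    · have := (hψ.of_le (m := 1) (by norm_cast)).eventually (by simp)
      exact this.mono fun y hy ↦ hy.differentiableAt (by simp)
  have hmain := hasDerivAt_pullback (α := α.inChart p) (ψ := ψ)
    (X := fun y ↦ toChart (𝓡 d) p (e.symm y) (X (e.symm y))) (c := c) (z := z)
    ((α.contDiffAt_inChart p hzt).differentiableAt (by simp)) (hψ.of_le (by norm_cast))
    (by
      filter_upwards [extChartAt_target_mem_nhds' hzt] with y hy
      simp only [hψdef, h0]
      exact e.right_inv hy)
    (by
      have h1 : ContinuousAt (fun y : EuclideanSpace ℝ (Fin d) ↦ ((0 : ℝ), y)) z := by fun_prop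
      have h2 : ∀ᶠ y in 𝓝 z, DifferentiableAt ℝ ψ (0, y) := by
        refine h1.eventually ?_
        have := (hψ.of_le (m := 1) (by norm_cast)).eventually (by simp)
        exact this.mono fun y hy ↦ hy.differentiableAt (by simp)
      filter_upwards [extChartAt_target_mem_nhds' hzt, h2] with y hy hyd
      have hline : HasDerivAt (fun s : ℝ ↦ (s, y)) ((1 : ℝ), (0 : EuclideanSpace ℝ (Fin d))) 0 :=
        (hasDerivAt_id (0 : ℝ)).prodMk (hasDerivAt_const (0 : ℝ) y)
      have h3 := hyd.hasFDerivAt.comp_hasDerivAt (0 : ℝ) hline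
      have h4 := hΦ (e.symm y) 0
      have hys : Φ 0 (e.symm y) ∈ e.source := by
        rw [h0]
        exact e.map_target hy
      have h5 : HasFDerivAt (fun s : ℝ ↦ ψ (s, y)) ((toChart (𝓡 d) p (Φ 0 (e.symm y)) :
          EuclideanSpace ℝ (Fin d) →L[ℝ] EuclideanSpace ℝ (Fin d)) ∘L
          (1 : ℝ →L[ℝ] ℝ).smulRight (X (Φ 0 (e.symm y)) : EuclideanSpace ℝ (Fin d))) 0 :=
        ((hasMFDerivAt_extChartAt_toChart (𝓡 d) hys).comp (0 : ℝ) h4).hasFDerivAt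
      refine (h3.unique h5.hasDerivAt).trans ?_
      change toChart (𝓡 d) p (Φ 0 (e.symm y)) ((1 : ℝ) • X (Φ 0 (e.symm y))) = _
      rw [h0]
      exact congrArg _ (one_smul ℝ _))
    (by
      filter_upwards [extChartAt_target_mem_nhds' hzt] with y hy
      rw [OneForm.inChart_apply, ← hc (e.symm y)]
      have := fromChart_toChart (𝓡 d) (e.map_target hy) (X (e.symm y))
      rw [e.right_inv hy] at this
      exact congrArg _ this) w
  refine (hmain.congr_of_eventuallyEq ?_).congr_deriv ?_
  · filter_upwards [hev] with s ⟨hs, hsd⟩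
    have h1 : HasFDerivAt (fun y ↦ ψ (s, y)) (fderiv ℝ ψ (s, z) ∘L
        ContinuousLinearMap.inr ℝ ℝ _) z := hsd.hasFDerivAt.comp z (hasFDerivAt_prodMk_right s z)
    have hs' : Φ s (e.symm z) ∈ e.source := by rwa [hez]
    have h2 := ((hasMFDerivAt_extChartAt_toChart (𝓡 d) hs').comp z
      ((hΦd s (e.symm z)).hasMFDerivAt.comp z (hasMFDerivAt_extChartAt_symm (𝓡 d) hzt))).hasFDerivAt
    have h3 : fderiv ℝ ψ (s, z) (0, w) = toChart (𝓡 d) p (Φ s (e.symm z))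
        (mfderiv (𝓡 d) (𝓡 d) (Φ s) (e.symm z) (fromChart (𝓡 d) p z w)) :=
      congrArg (fun f : EuclideanSpace ℝ (Fin d) →L[ℝ] EuclideanSpace ℝ (Fin d) ↦ f w)
        (h1.unique h2)
    have h4 : fromChart (𝓡 d) p z w = w :=
      congrArg (fun f : EuclideanSpace ℝ (Fin d) →L[ℝ] EuclideanSpace ℝ (Fin d) ↦ f w)
        (fromChart_self (𝓡 d) p)
    rw [h3, h4, hez, OneForm.inChart_apply]
    have hψs : ψ (s, z) = e (Φ s p) := by simp only [hψdef, hez]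
    rw [hψs]
    exact (α.apply_congr (e.left_inv hs)
      (fromChart_toChart (𝓡 d) hs (mfderiv (𝓡 d) (𝓡 d) (Φ s) p w))).symm
  · have h7 : toChart (𝓡 d) p (e.symm z) (X (e.symm z)) = X p := by
      rw [hez, toChart_self]
      rfl
    simp only [h7]
    rfl

end Flow

/-! ### Imaginary quaternions -/

theorem Quaternion.mul_self_of_re_eq_zero {q : ℍ[ℝ]} (hq : q.re = 0) (hq1 : ‖q‖ = 1) :
    q * q = -1 := by
  have h := Quaternion.self_mul_star q
  rw [Quaternion.star_eq_neg.2 hq, Quaternion.normSq_eq_norm_mul_self, hq1] at h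
  rw [← neg_eq_iff_eq_neg, ← mul_neg, h]
  simp

theorem Quaternion.re_mul_self {q : ℍ[ℝ]} (hq : q.re = 0) : (q * q).re = -‖q‖ ^ 2 := by
  have h := Quaternion.self_mul_star q
  rw [Quaternion.star_eq_neg.2 hq, Quaternion.normSq_eq_norm_mul_self, mul_neg] at h
  have := congrArg QuaternionAlgebra.re h
  simp at this
  rw [sq]
  simp
  linarith

theorem Quaternion.exists_orthogonal (b : ℍ[ℝ]) :
    ∃ e : ℍ[ℝ], e.re = 0 ∧ ‖e‖ = 1 ∧ (e * b).re = 0 := by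
  suffices h : ∃ e : ℍ[ℝ], e.re = 0 ∧ e ≠ 0 ∧ (e * b).re = 0 by
    obtain ⟨e, h1, h2, h3⟩ := h
    refine ⟨‖e‖⁻¹ • e, ?_, ?_, ?_⟩
    · simp [h1]
    · rw [norm_smul, norm_inv, norm_norm, inv_mul_cancel₀ (norm_ne_zero_iff.2 h2)]
    · rw [smul_mul_assoc, Quaternion.re_smul, h3, smul_zero]
  -- For imaginary `e` the real part of `e * b` is minus the inner product of the imaginary parts.
  -- If `b` has no component along i and j, take `e` = i; otherwise turn these two components by a
  -- right angle.
  by_cases hb : b.imI = 0 ∧ b.imJ = 0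
  · refine ⟨⟨0, 1, 0, 0⟩, rfl, fun h ↦ ?_, ?_⟩
    · simpa using congrArg QuaternionAlgebra.imI h
    · refine (Quaternion.re_mul _ _).trans ?_
      simp [hb.1]
  · refine ⟨⟨0, -b.imJ, b.imI, 0⟩, rfl, fun h ↦ hb ⟨?_, ?_⟩, ?_⟩
    · simpa using congrArg QuaternionAlgebra.imJ h
    · simpa using congrArg QuaternionAlgebra.imI h
    · refine (Quaternion.re_mul _ _).trans ?_
      simp
      ring

/-- Two unit imaginary quaternions lie on a great circle. -/
theorem Quaternion.exists_eq_cos_add_sin {b q : ℍ[ℝ]} (hb : b.re = 0) (hb1 : ‖b‖ = 1)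
    (hq : q.re = 0) (hq1 : ‖q‖ = 1) : ∃ (e : ℍ[ℝ]) (θ : ℝ), e.re = 0 ∧ ‖e‖ = 1 ∧
      (e * b).re = 0 ∧ q = Real.cos θ • b + Real.sin θ • e := by
  -- The inner product of `q` and `b`, so the cosine of their angle; `r` is the component of `q`
  -- orthogonal to `b`.
  set c : ℝ := -(q * b).re with hc
  set r : ℍ[ℝ] := q - c • b with hr
  have hr0 : r.re = 0 := by simp [hr, hq, hb]
  have hbb : (b * b).re = -1 := by rw [Quaternion.re_mul_self hb, hb1]; norm_num
  have hqq : (q * q).re = -1 := by rw [Quaternion.re_mul_self hq, hq1]; norm_num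
  have hbq : (b * q).re = -c := by
    rw [hc, Quaternion.re_mul, Quaternion.re_mul]
    ring
  have hrb : (r * b).re = 0 := by
    rw [hr, sub_mul, smul_mul_assoc, Quaternion.re_sub, Quaternion.re_smul, hbb, hc]
    simp
  have hrr : ‖r‖ ^ 2 = 1 - c ^ 2 := by
    have h1 := Quaternion.re_mul_self hr0
    have h2 : (r * r).re = -1 + c ^ 2 := by
      have h3 : (r * r).re = (r * q).re - c * (r * b).re := by
        conv_lhs => rw [hr, mul_sub, mul_smul_comm, Quaternion.re_sub, Quaternion.re_smul,
          smul_eq_mul, ← hr]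
      rw [h3, hrb, hr, sub_mul, smul_mul_assoc, Quaternion.re_sub, Quaternion.re_smul, hqq, hbq,
        smul_eq_mul]
      ring
    linarith
  have hc1 : c ^ 2 ≤ 1 := by nlinarith [sq_nonneg ‖r‖]
  have hcos : Real.cos (Real.arccos c) = c :=
    Real.cos_arccos (by nlinarith) (by nlinarith)
  have hsin : Real.sin (Real.arccos c) = ‖r‖ := by
    rw [Real.sin_arccos, ← hrr, Real.sqrt_sq (norm_nonneg _)]
  -- If `q` is `b` or `-b`, the great circle is not determined and any unit `e` orthogonal to `b`
  -- serves.
  by_cases h0 : r = 0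
  · obtain ⟨e, h1, h2, h3⟩ := Quaternion.exists_orthogonal b
    refine ⟨e, Real.arccos c, h1, h2, h3, ?_⟩
    rw [hcos, hsin, h0, norm_zero, zero_smul, add_zero]
    exact sub_eq_zero.1 (hr.symm.trans h0)
  · have hn := norm_ne_zero_iff.2 h0
    refine ⟨‖r‖⁻¹ • r, Real.arccos c, by simp [hr0], ?_, ?_, ?_⟩
    · rw [norm_smul, norm_inv, norm_norm, inv_mul_cancel₀ hn]
    · rw [smul_mul_assoc, Quaternion.re_smul, hrb, smul_zero]
    · rw [hcos, hsin, smul_smul, mul_inv_cancel₀ hn, one_smul, hr]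
      abel

/-! ### The contact structures of the 2-sphere of complex structures are isotopic -/

section Isotopy

variable {d : ℕ} {M : Type*} [TopologicalSpace M] [ChartedSpace (EuclideanSpace ℝ (Fin d)) M]
  [IsManifold (𝓡 d) ∞ M] {n : ℕ} {g : ContMDiffRiemannianMetric (𝓡 d) ∞ (EuclideanSpace ℝ (Fin d))
      (fun p : M ↦ TangentSpace (𝓡 d) p)}

namespace QuaternionicFields

variable (K : QuaternionicFields n g)

theorem form_add (a b : ℍ[ℝ]) : K.form (a + b) = K.form a + K.form b := by
  have h : ∀ (p : M) (v : EuclideanSpace ℝ (Fin d)),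
      K.form (a + b) p v = K.form a p v + K.form b p v := fun p v ↦ by
    rw [form_apply, form_apply, form_apply, K.field_add (y := (p, 1)) one_pos, map_add]
  ext p v
  exact h p v

theorem form_smul (c : ℝ) (a : ℍ[ℝ]) : K.form (c • a) = c • K.form a := by
  have h : ∀ (p : M) (v : EuclideanSpace ℝ (Fin d)),
      K.form (c • a) p v = c * K.form a p v := fun p v ↦ by
    rw [form_apply, form_apply, K.field_smul (y := (p, 1)) one_pos, map_smul, smul_eq_mul]
  ext p v
  exact h p v

theorem extDerivAt_form_vectorField {a b : ℍ[ℝ]} (ha : a.re = 0) (hb : b.re = 0) (p : M)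
    (w : EuclideanSpace ℝ (Fin d)) :
    (K.form b).extDerivAt p (K.vectorField a p) w = 2 * K.form (a * b) p w := by
  rw [K.extDerivAt_form hb, ← K.field_radial ha, K.field_field (y := (p, 1)) one_pos, form_apply,
    (isMetricOn_cone g).symm]

variable {Φ : ℝ → M → M} {a : ℍ[ℝ]}

/-- Since α_b (X_a) is constant, Cartan's formula reduces the Lie derivative to the contraction of
dα_b with X_a, which is 2α_{ab}. The group law carries the derivative at time 0 to time `t`. -/
theorem hasDerivAt_form_flow (h0 : ∀ y, Φ 0 y = y) (hadd : ∀ s t y, Φ (s + t) y = Φ s (Φ t y))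
    (hΦ : ∀ y, IsMIntegralCurve (I := 𝓡 d) (fun t ↦ Φ t y) (fun p ↦ K.vectorField a p))
    (hΦs : ContMDiff (𝓘(ℝ, ℝ).prod (𝓡 d)) (𝓡 d) ∞ (fun z : ℝ × M ↦ Φ z.1 z.2))
    (ha : a.re = 0) {b : ℍ[ℝ]} (hb : b.re = 0) (p : M) (w : EuclideanSpace ℝ (Fin d)) (t : ℝ) :
    HasDerivAt (fun s ↦ K.form b (Φ s p) (mfderiv (𝓡 d) (𝓡 d) (Φ s) p w))
      (2 * K.form (a * b) (Φ t p) (mfderiv (𝓡 d) (𝓡 d) (Φ t) p w)) t := by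
  have hΦd : ∀ s y, MDifferentiableAt (𝓡 d) (𝓡 d) (Φ s) y := fun s y ↦
    ((hΦs.comp (contMDiff_const.prodMk contMDiff_id)).mdifferentiable (by simp)) y
  have h1 := ((K.form b).hasDerivAt_pullback_flow h0 hΦ hΦs (fun p ↦ K.form_vectorField ha p)
    (Φ t p) (mfderiv (𝓡 d) (𝓡 d) (Φ t) p w)).congr_deriv
      (K.extDerivAt_form_vectorField ha hb (Φ t p) (mfderiv (𝓡 d) (𝓡 d) (Φ t) p w))
  have h2 := HasDerivAt.comp_sub_const t t (by rw [sub_self]; exact h1)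
  refine h2.congr_of_eventuallyEq (Filter.Eventually.of_forall fun s ↦ ?_)
  have h3 : Φ s = Φ (s - t) ∘ Φ t := by
    funext y
    rw [Function.comp, ← hadd, sub_add_cancel]
  refine (K.form b).apply_congr (congrFun h3 p) ?_
  have h4 : mfderiv (𝓡 d) (𝓡 d) (Φ s) p =
      (mfderiv (𝓡 d) (𝓡 d) (Φ (s - t)) (Φ t p)).comp (mfderiv (𝓡 d) (𝓡 d) (Φ t) p) := by
    rw [← mfderiv_comp p (hΦd _ _) (hΦd _ _), ← h3]
  exact congrArg (fun f : EuclideanSpace ℝ (Fin d) →L[ℝ] EuclideanSpace ℝ (Fin d) ↦ f w) h4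

/-- The pull-backs of α_b and α_{ab} satisfy F_b' = 2F_{ab} and F_{ab}' = -2F_b, as a(ab) = -b. They
rotate with angular speed 2, and the rotation in the statement undoes this. -/
theorem form_flow (h0 : ∀ y, Φ 0 y = y) (hadd : ∀ s t y, Φ (s + t) y = Φ s (Φ t y))
    (hΦ : ∀ y, IsMIntegralCurve (I := 𝓡 d) (fun t ↦ Φ t y) (fun p ↦ K.vectorField a p))
    (hΦs : ContMDiff (𝓘(ℝ, ℝ).prod (𝓡 d)) (𝓡 d) ∞ (fun z : ℝ × M ↦ Φ z.1 z.2))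
    (ha : a.re = 0) (ha1 : ‖a‖ = 1) {b : ℍ[ℝ]} (hb : b.re = 0) (hab : (a * b).re = 0) (p : M)
    (w : EuclideanSpace ℝ (Fin d)) (t : ℝ) :
    K.form (Real.cos (2 * t) • b - Real.sin (2 * t) • (a * b)) (Φ t p)
      (mfderiv (𝓡 d) (𝓡 d) (Φ t) p w) = K.form b p w := by
  set F : ℍ[ℝ] → ℝ → ℝ := fun b t ↦ K.form b (Φ t p) (mfderiv (𝓡 d) (𝓡 d) (Φ t) p w) with hF
  have hd : ∀ {b : ℍ[ℝ]}, b.re = 0 → ∀ t, HasDerivAt (F b) (2 * F (a * b) t) t := fun hb t ↦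
    K.hasDerivAt_form_flow h0 hadd hΦ hΦs ha hb p w t
  have hlin : ∀ t, F (Real.cos (2 * t) • b - Real.sin (2 * t) • (a * b)) t =
      Real.cos (2 * t) * F b t - Real.sin (2 * t) * F (a * b) t := fun t ↦ by
    simp only [hF]
    rw [sub_eq_add_neg, ← neg_smul, form_add, form_smul, form_smul, sub_eq_add_neg, ← neg_mul]
    rfl
  have haab : F (a * (a * b)) = fun t ↦ -F b t := by
    funext t
    have : a * (a * b) = (-1 : ℝ) • b := by
      rw [← mul_assoc, Quaternion.mul_self_of_re_eq_zero ha ha1]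
      simp
    simp only [hF]
    rw [this, form_smul]
    exact neg_one_mul _
  have hcos : ∀ t : ℝ, HasDerivAt (fun t ↦ Real.cos (2 * t)) (-Real.sin (2 * t) * 2) t := fun t ↦ by
    simpa using ((hasDerivAt_id t).const_mul 2).cos
  have hsin : ∀ t : ℝ, HasDerivAt (fun t ↦ Real.sin (2 * t)) (Real.cos (2 * t) * 2) t := fun t ↦ by
    simpa using ((hasDerivAt_id t).const_mul 2).sin
  have hder : ∀ t, HasDerivAt
      (fun t ↦ Real.cos (2 * t) * F b t - Real.sin (2 * t) * F (a * b) t) 0 t := fun t ↦ by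
    refine (((hcos t).mul (hd hb t)).sub ((hsin t).mul (hd hab t))).congr_deriv ?_
    rw [haab]
    ring
  have hconst := is_const_of_deriv_eq_zero (fun t ↦ (hder t).differentiableAt)
    (fun t ↦ (hder t).deriv) t 0
  refine (hlin t).trans (hconst.trans ?_)
  simp only [mul_zero, Real.cos_zero, Real.sin_zero, one_mul, zero_mul, sub_zero, hF]
  refine (K.form b).apply_congr (h0 p) ?_
  have hid : Φ 0 = id := funext h0
  rw [hid, mfderiv_id]
  rfl

/-- On the great circle `cos θ b + sin θ e` through `b` and `q`, the quaternion `a = e * b` is a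
unit imaginary one with `a * b = -e`. By `form_flow`, the flow of its vector field, which is
complete since `M` is compact, carries α_b to α_q at time `θ / 2`. -/
theorem isIsotopic_form [CompactSpace M] [T2Space M] {b q : ℍ[ℝ]} (hb : b.re = 0) (hb1 : ‖b‖ = 1)
    (hq : q.re = 0) (hq1 : ‖q‖ = 1) :
    (ContactForm.ker ⟨K.form b, K.isContact_form hb hb1⟩).IsIsotopic
      (ContactForm.ker ⟨K.form q, K.isContact_form hq hq1⟩) := by
  obtain ⟨e, θ, he, he1, heb, rfl⟩ := Quaternion.exists_eq_cos_add_sin hb hb1 hq hq1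
  obtain ⟨Φ, h0, hadd, hΦ, hΦs⟩ := exists_contMDiff_flow (𝓡 d) (K.contMDiff_vectorField (e * b))
  have hΦt : ∀ t, ContMDiff (𝓡 d) (𝓡 d) ∞ (Φ t) := fun t ↦
    hΦs.comp (contMDiff_const.prodMk contMDiff_id)
  refine ⟨fun s ↦
    { toFun := Φ (s * (θ / 2))
      invFun := Φ (-(s * (θ / 2)))
      left_inv := fun y ↦ by rw [← hadd, neg_add_cancel, h0]
      right_inv := fun y ↦ by rw [← hadd, add_neg_cancel, h0]
      contMDiff_toFun := hΦt _
      contMDiff_invFun := hΦt _ }, ?_, fun p ↦ ?_, _, _, rfl, rfl, fun p v ↦ ?_⟩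
  · refine ContMDiff.contMDiffOn ?_
    have h1 : ContMDiff (𝓘(ℝ, ℝ).prod (𝓡 d)) (𝓘(ℝ, ℝ).prod (𝓡 d)) ∞
        (fun z : ℝ × M ↦ (z.1 * (θ / 2), z.2)) :=
      (ContMDiff.comp (g := fun s : ℝ ↦ s * (θ / 2)) (contDiff_id.mul contDiff_const).contMDiff
        contMDiff_fst).prodMk contMDiff_snd
    exact hΦs.comp h1
  · change Φ (0 * (θ / 2)) p = p
    rw [zero_mul, h0]
  · have habb : e * b * b = -e := by
      rw [mul_assoc, Quaternion.mul_self_of_re_eq_zero hb hb1, mul_neg, mul_one]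
    have h := K.form_flow h0 hadd hΦ hΦs heb (by rw [norm_mul, he1, hb1, one_mul]) hb
      (by rw [habb, Quaternion.re_neg, he, neg_zero]) p v (1 * (θ / 2))
    rw [habb, smul_neg, sub_neg_eq_add, one_mul, mul_div_cancel₀ θ two_ne_zero] at h
    change K.form _ (Φ (1 * (θ / 2)) p) (mfderiv (𝓡 d) (𝓡 d) (Φ (1 * (θ / 2))) p v) = K.form b p v
    rw [one_mul]
    exact h

end QuaternionicFields

end Isotopy

/-! ### The positive spectral projection -/

section PositiveProjection

open scoped Matrix.Norms.L2Operator

variable {ι : Type*} [Fintype ι] [DecidableEq ι]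

/-- The spectral projection of a Hermitian matrix on its positive eigenspaces. -/
def positiveProjection (H : Matrix ι ι ℂ) : Matrix ι ι ℂ :=
  cfc (fun x : ℝ ↦ if 0 < x then (1 : ℝ) else 0) H

theorem continuousOn_heaviside :
    ContinuousOn (fun x : ℝ ↦ if 0 < x then (1 : ℝ) else 0) {0}ᶜ := by
  intro x hx
  refine ContinuousAt.continuousWithinAt ?_
  rcases lt_or_gt_of_ne (show x ≠ 0 by simpa using hx) with h | h
  · refine continuousAt_const (y := (0 : ℝ)) |>.congr ?_
    filter_upwards [Iio_mem_nhds h] with y hy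
    rw [if_neg (not_lt.2 (le_of_lt hy))]
  · refine continuousAt_const (y := (1 : ℝ)) |>.congr ?_
    filter_upwards [Ioi_mem_nhds h] with y hy
    rw [if_pos (mem_Ioi.1 hy)]

theorem spectrum_subset_of_det_ne_zero {H : Matrix ι ι ℂ} (hd : H.det ≠ 0) :
    spectrum ℝ H ⊆ {0}ᶜ := by
  intro x hx h0
  rw [mem_singleton_iff] at h0
  subst h0
  refine (spectrum.zero_notMem_iff ℝ).2 ?_ hx
  exact (Matrix.isUnit_iff_isUnit_det H).2 hd.isUnit

/-- Invertibility keeps 0 out of the spectra, and the step function is continuous away from 0. -/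
theorem continuous_positiveProjection {X : Type*} [TopologicalSpace X] {H : X → Matrix ι ι ℂ}
    (hc : Continuous H) (hs : ∀ x, (H x).IsHermitian) (hd : ∀ x, (H x).det ≠ 0) :
    Continuous fun x ↦ positiveProjection (H x) := by
  refine Continuous.cfc_of_mem_nhdsSet (s := {0}ᶜ) _ ?_ hc (fun x ↦ (hs x).isSelfAdjoint)
    continuousOn_heaviside
  refine isOpen_compl_singleton.mem_nhdsSet.2 (iUnion_subset fun x ↦ ?_)
  exact spectrum_subset_of_det_ne_zero (hd x)

theorem positiveProjection_mul_self {H : Matrix ι ι ℂ} (hd : H.det ≠ 0) :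
    positiveProjection H * positiveProjection H = positiveProjection H := by
  have hc := continuousOn_heaviside.mono (spectrum_subset_of_det_ne_zero hd)
  rw [positiveProjection, ← cfc_mul _ _ H hc hc]
  congr 1
  funext x
  split_ifs <;> norm_num

theorem positiveProjection_smul {H : Matrix ι ι ℂ} (hH : H.IsHermitian) (hd : H.det ≠ 0) {c : ℝ}
    (hc : 0 < c) : positiveProjection (c • H) = positiveProjection H := by
  rw [positiveProjection, ← cfc_comp_const_mul c _ H (continuousOn_heaviside.mono ?_)
    hH.isSelfAdjoint]
  · simp only [mul_pos_iff_of_pos_left hc]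
    rfl
  · rintro _ ⟨x, hx, rfl⟩
    have := spectrum_subset_of_det_ne_zero hd hx
    simpa [hc.ne'] using this

/-- The spectrum lies in {1, -1}, where the step function coincides with (1 + x)/2. -/
theorem positiveProjection_of_mul_self_eq_one {H : Matrix ι ι ℂ} (hH : H.IsHermitian)
    (h1 : H * H = 1) : positiveProjection H = (2⁻¹ : ℝ) • (1 + H) := by
  have hsp : ∀ x ∈ spectrum ℝ H, x = 1 ∨ x = -1 := by
    intro x hx
    have h2 := spectrum.pow_mem_pow H 2 hx
    rw [sq H, h1] at h2
    rcases subsingleton_or_nontrivial (Matrix ι ι ℂ) with h | h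
    · simp [spectrum.of_subsingleton] at hx
    · rw [spectrum.one_eq, mem_singleton_iff] at h2
      simpa using h2
  rw [positiveProjection, cfc_congr (g := fun x ↦ 2⁻¹ * (1 + x)) (fun x hx ↦ by
      rcases hsp x hx with rfl | rfl <;> norm_num),
    cfc_const_mul _ _ H (by fun_prop), cfc_const_add _ _ H (by fun_prop) hH.isSelfAdjoint,
    cfc_id' ℝ H hH.isSelfAdjoint, map_one]

end PositiveProjection

/-! ### The symplectic form on the symplectization -/

section Symplectization

variable {E : Type*} [NormedAddCommGroup E] [NormedSpace ℝ E]

/-- The projection to the kernel of `α` along `T α`. -/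
def kernelProjection (T : (E →L[ℝ] ℝ) →L[ℝ] E) (α : E →L[ℝ] ℝ) : E →ₗ[ℝ] E where
  toFun v := v - (α v / α (T α)) • T α
  map_add' u v := by
    rw [map_add, add_div, add_smul]
    abel
  map_smul' c v := by
    rw [map_smul, smul_eq_mul, mul_div_assoc, mul_smul, RingHom.id_apply, smul_sub]

theorem kernelProjection_apply (T : (E →L[ℝ] ℝ) →L[ℝ] E) (α : E →L[ℝ] ℝ) (v : E) :
    kernelProjection T α v = v - (α v / α (T α)) • T α := rfl

/-- The bilinear form `2 dr ∧ α + dα` on `E × ℝ`, where `A` is the derivative of `α` and the second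
summand is projected to the kernel of `α`. -/
def symplectization (T : (E →L[ℝ] ℝ) →L[ℝ] E) (α : E →L[ℝ] ℝ) (A : E →L[ℝ] E →L[ℝ] ℝ) :
    LinearMap.BilinForm ℝ (E × ℝ) :=
  LinearMap.mk₂ ℝ (fun x y ↦ 2 * (x.2 * α y.1 - y.2 * α x.1) +
      (A (kernelProjection T α x.1) (kernelProjection T α y.1) -
        A (kernelProjection T α y.1) (kernelProjection T α x.1)))
    (fun x x' y ↦ by simp only [Prod.fst_add, Prod.snd_add, map_add, add_apply]; ring)
    (fun c x y ↦ by
      simp only [Prod.smul_fst, Prod.smul_snd, map_smul, smul_apply, smul_eq_mul]; ring)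
    (fun x y y' ↦ by simp only [Prod.fst_add, Prod.snd_add, map_add, add_apply]; ring)
    (fun c x y ↦ by
      simp only [Prod.smul_fst, Prod.smul_snd, map_smul, smul_apply, smul_eq_mul]; ring)

variable {T : (E →L[ℝ] ℝ) →L[ℝ] E} {α : E →L[ℝ] ℝ} {A : E →L[ℝ] E →L[ℝ] ℝ}

theorem symplectization_apply (x y : E × ℝ) : symplectization T α A x y =
    2 * (x.2 * α y.1 - y.2 * α x.1) +
      (A (kernelProjection T α x.1) (kernelProjection T α y.1) -
        A (kernelProjection T α y.1) (kernelProjection T α x.1)) := rfl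

theorem symplectization_swap (x y : E × ℝ) :
    symplectization T α A y x = -symplectization T α A x y := by
  rw [symplectization_apply, symplectization_apply]
  ring

theorem kernelProjection_of_eq_zero {v : E} (h : α v = 0) : kernelProjection T α v = v := by
  rw [kernelProjection_apply, h, zero_div, zero_smul, sub_zero]

theorem apply_kernelProjection (hT : α (T α) ≠ 0) (v : E) : α (kernelProjection T α v) = 0 := by
  rw [kernelProjection_apply, map_sub, map_smul, smul_eq_mul, div_mul_cancel₀ _ hT, sub_self]

/-- For `x` in the radical, pairing with `(0, 1)` gives `α x.1 = 0`, pairing with `(T α, 0)` gives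
`x.2 = 0`, and pairing with `(v, 0)` for `v` in the kernel leaves the nondegeneracy of dα there. -/
theorem symplectization_nondegenerate [FiniteDimensional ℝ E] (hT : α (T α) ≠ 0)
    (h : ∀ u, α u = 0 → (∀ v, α v = 0 → A u v - A v u = 0) → u = 0) :
    (symplectization T α A).Nondegenerate := by
  refine LinearMap.BilinForm.Nondegenerate.ofSeparatingLeft fun x hx ↦ ?_
  have h1 : α x.1 = 0 := by
    have := hx (0, 1)
    rw [symplectization_apply] at this
    simp only [map_zero, mul_zero, one_mul, zero_apply] at this
    linarith
  have h2 : x.2 = 0 := by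
    have := hx (T α, 0)
    have h0 : kernelProjection T α (T α) = 0 := by
      rw [kernelProjection_apply, div_self hT, one_smul, sub_self]
    rw [symplectization_apply] at this
    simp only [h0, map_zero, zero_mul, zero_apply, sub_zero, add_zero] at this
    simpa [hT] using this
  have h3 : x.1 = 0 := by
    refine h x.1 h1 fun v hv ↦ ?_
    have := hx (v, 0)
    rw [symplectization_apply] at this
    simpa [kernelProjection_of_eq_zero h1, kernelProjection_of_eq_zero hv, hv] using this
  exact Prod.ext h3 h2

/-- The projection to the kernel depends only on the line through `α`. This is why dα is projected:
for a form `f • α` the term df ∧ α disappears on the kernel, and the whole form is just multiplied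
by the value of `f`. -/
theorem symplectization_smul (hT : α (T α) ≠ 0) {c : ℝ} (hc : c ≠ 0) {A' : E →L[ℝ] E →L[ℝ] ℝ}
    (h : ∀ u v, α u = 0 → α v = 0 → A' u v - A' v u = c * (A u v - A v u)) :
    symplectization T (c • α) A' = c • symplectization T α A := by
  have hk : kernelProjection T (c • α) = kernelProjection T α := by
    ext v
    rw [kernelProjection_apply, kernelProjection_apply, map_smul, smul_smul]
    congr 2
    simp only [smul_apply, map_smul, smul_eq_mul]
    field_simp
  refine LinearMap.ext₂ fun x y ↦ ?_
  rw [LinearMap.smul_apply, LinearMap.smul_apply, symplectization_apply, symplectization_apply, hk,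
    h _ _ (apply_kernelProjection hT _) (apply_kernelProjection hT _)]
  simp only [smul_apply, smul_eq_mul]
  ring

theorem continuous_symplectization {X : Type*} [TopologicalSpace X] (T : (E →L[ℝ] ℝ) →L[ℝ] E)
    {α : X → E →L[ℝ] ℝ} {A : X → E →L[ℝ] E →L[ℝ] ℝ} (hα : Continuous α) (hA : Continuous A)
    (hT : ∀ x, α x (T (α x)) ≠ 0) (u v : E × ℝ) :
    Continuous fun x ↦ symplectization T (α x) (A x) u v := by
  have hk : ∀ w : E, Continuous fun x ↦ kernelProjection T (α x) w := fun w ↦ by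
    simp only [kernelProjection_apply]
    have h1 : Continuous fun x ↦ T (α x) := T.continuous.comp hα
    exact continuous_const.sub (((hα.clm_apply continuous_const).div (hα.clm_apply h1) hT).smul h1)
  simp only [symplectization_apply]
  have h2 := hk u.1
  have h3 := hk v.1
  fun_prop

variable {ι : Type*} [Fintype ι] [DecidableEq ι]

/-- The matrix of `√-1` times a bilinear form. -/
def hermitianMatrix (e : Module.Basis ι ℝ (E × ℝ)) (B : LinearMap.BilinForm ℝ (E × ℝ)) :
    Matrix ι ι ℂ :=
  Complex.I • (LinearMap.BilinForm.toMatrix e B).map Complex.ofReal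

theorem isHermitian_hermitianMatrix (e : Module.Basis ι ℝ (E × ℝ))
    {B : LinearMap.BilinForm ℝ (E × ℝ)} (hB : ∀ x y, B y x = -B x y) :
    (hermitianMatrix e B).IsHermitian := by
  ext i j
  simp [hermitianMatrix, hB (e i) (e j)]

theorem det_hermitianMatrix_ne_zero (e : Module.Basis ι ℝ (E × ℝ))
    {B : LinearMap.BilinForm ℝ (E × ℝ)} (hB : B.Nondegenerate) :
    (hermitianMatrix e B).det ≠ 0 := by
  have h := (LinearMap.BilinForm.nondegenerate_iff_det_ne_zero e).1 hB
  rw [hermitianMatrix, Matrix.det_smul]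
  refine mul_ne_zero (pow_ne_zero _ Complex.I_ne_zero) ?_
  have := RingHom.map_det Complex.ofRealHom (LinearMap.BilinForm.toMatrix e B)
  rw [RingHom.mapMatrix_apply] at this
  refine (this.symm.trans_ne ?_)
  simpa using h

theorem hermitianMatrix_smul (e : Module.Basis ι ℝ (E × ℝ)) (c : ℝ)
    (B : LinearMap.BilinForm ℝ (E × ℝ)) :
    hermitianMatrix e (c • B) = c • hermitianMatrix e B := by
  ext i j
  simp [hermitianMatrix]
  ring

end Symplectization

/-! ### The 2-sphere of unit imaginary quaternions -/

/-- The 2-sphere of unit imaginary quaternions. -/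
abbrev ImaginarySphere : Type := {q : ℍ[ℝ] // q.re = 0 ∧ ‖q‖ = 1}

theorem Quaternion.re_mul_comm (a b : ℍ[ℝ]) : (a * b).re = (b * a).re := by
  rw [Quaternion.re_mul, Quaternion.re_mul]
  ring

theorem Quaternion.mul_eq_neg_mul {a b : ℍ[ℝ]} (ha : a.re = 0) (hb : b.re = 0)
    (hab : (a * b).re = 0) : b * a = -(a * b) := by
  have h := Quaternion.star_eq_neg.2 hab
  rwa [star_mul, Quaternion.star_eq_neg.2 ha, Quaternion.star_eq_neg.2 hb, neg_mul_neg] at h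

/-- The conjugate of a unit imaginary quaternion. -/
def ImaginarySphere.conj (q : ImaginarySphere) {u : ℍ[ℝ]} (hu : u ≠ 0) : ImaginarySphere :=
  ⟨u * q.1 * u⁻¹, by
    rw [Quaternion.re_mul_comm, ← mul_assoc, inv_mul_cancel₀ hu, one_mul, q.2.1], by
    rw [norm_mul, norm_mul, q.2.2, mul_one, norm_inv, mul_inv_cancel₀ (norm_ne_zero_iff.2 hu)]⟩

theorem ImaginarySphere.conj_of_commute (q : ImaginarySphere) {u : ℍ[ℝ]} (hu : u ≠ 0)
    (h : u * q.1 = q.1 * u) : q.conj hu = q :=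
  Subtype.ext (show u * q.1 * u⁻¹ = q.1 by rw [h, mul_assoc, mul_inv_cancel₀ hu, mul_one])

/-! ### The explicit lift over the 2-sphere and its degree -/

section SphereLift

open scoped unitInterval Matrix.Norms.L2Operator
open Topology.Homotopy

/-- A family of quaternions parametrized by the square, conjugation by which maps the square modulo
its boundary onto the 2-sphere of unit imaginary quaternions. -/
def squareQuaternion (q j : ℍ[ℝ]) (z : I × I) : ℍ[ℝ] :=
  (1 - z.2 + z.2 * Real.cos (2 * Real.pi * z.1) : ℝ) • (1 : ℍ[ℝ]) +
    (z.2 * Real.sin (2 * Real.pi * z.1) : ℝ) • q +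
    (Real.sin (Real.pi * z.1) * (z.2 * (1 - z.2)) : ℝ) • j

theorem continuous_squareQuaternion (q j : ℍ[ℝ]) : Continuous (squareQuaternion q j) := by
  unfold squareQuaternion
  fun_prop

/-- The quaternions 1, `q`, `j` are linearly independent, so all three coefficients `a`, `b`, `c`
would vanish. But `c = 0` forces a vertical side or the bottom, where `a = 1`, or the top, where `a²
+ b² = 1`. -/
theorem squareQuaternion_ne_zero {q j : ℍ[ℝ]} (hq : q.re = 0) (hq1 : ‖q‖ = 1) (hj : j.re = 0)
    (hj1 : ‖j‖ = 1) (hjq : (j * q).re = 0) (z : I × I) : squareQuaternion q j z ≠ 0 := by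
  intro h
  set a : ℝ := 1 - z.2 + z.2 * Real.cos (2 * Real.pi * z.1) with ha
  set b : ℝ := z.2 * Real.sin (2 * Real.pi * z.1) with hb
  set c : ℝ := Real.sin (Real.pi * z.1) * (z.2 * (1 - z.2)) with hc
  have h' : a • (1 : ℍ[ℝ]) + b • q + c • j = 0 := h
  have ha0 : a = 0 := by
    have := congrArg QuaternionAlgebra.re h'
    simpa [hq, hj] using this
  rw [ha0, zero_smul, zero_add] at h'
  have hb0 : b = 0 := by
    have := congrArg (fun x : ℍ[ℝ] ↦ (x * q).re) h'
    simp only [add_mul, smul_mul_assoc, Quaternion.mul_self_of_re_eq_zero hq hq1,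
      Quaternion.re_add, Quaternion.re_smul, hjq] at this
    simpa using this
  rw [hb0, zero_smul, zero_add] at h'
  have hc0 : c = 0 := by
    refine (smul_eq_zero.1 h').resolve_right fun h0 ↦ ?_
    simp [h0] at hj1
  rcases mul_eq_zero.1 hc0 with h1 | h1
  · have h2 : Real.cos (2 * Real.pi * z.1) = 1 := by
      rw [mul_assoc, Real.cos_two_mul', h1]
      have := Real.sin_sq_add_cos_sq (Real.pi * z.1)
      rw [h1] at this
      linarith
    rw [ha, h2] at ha0
    linarith
  · rcases mul_eq_zero.1 h1 with h2 | h2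
    · rw [ha, h2] at ha0
      simp at ha0
    · have h3 : (z.2 : ℝ) = 1 := by linarith
      rw [ha, h3] at ha0
      rw [hb, h3] at hb0
      have := Real.sin_sq_add_cos_sq (2 * Real.pi * z.1)
      nlinarith

theorem squareQuaternion_bottom (q j : ℍ[ℝ]) (s : I) : squareQuaternion q j (s, 0) = 1 := by
  simp [squareQuaternion]

theorem squareQuaternion_left (q j : ℍ[ℝ]) (t : I) : squareQuaternion q j (0, t) = 1 := by
  simp [squareQuaternion]

theorem squareQuaternion_right (q j : ℍ[ℝ]) (t : I) : squareQuaternion q j (1, t) = 1 := by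
  simp [squareQuaternion]

theorem squareQuaternion_top (q j : ℍ[ℝ]) (s : I) : squareQuaternion q j (s, 1) =
    Real.cos (2 * Real.pi * s) • (1 : ℍ[ℝ]) + Real.sin (2 * Real.pi * s) • q := by
  simp [squareQuaternion]

variable {X : Type*} [TopologicalSpace X]

/-- The image of the fundamental class of the 2-sphere of unit imaginary quaternions. -/
def sphereLoop {η : ImaginarySphere → X} (hη : Continuous η) (q : ImaginarySphere) {j : ℍ[ℝ]}
    (hj : j.re = 0) (hj1 : ‖j‖ = 1) (hjq : (j * q.1).re = 0) : GenLoop (Fin 2) X (η q) :=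
  ⟨⟨fun y ↦ η (q.conj (squareQuaternion_ne_zero q.2.1 q.2.2 hj hj1 hjq (y 0, y 1))), by
    refine hη.comp (Continuous.subtype_mk ?_ _)
    have h : Continuous fun y : Fin 2 → I ↦ squareQuaternion q.1 j (y 0, y 1) :=
      (continuous_squareQuaternion q.1 j).comp (by fun_prop)
    exact (h.mul continuous_const).mul
      (h.inv₀ fun y ↦ squareQuaternion_ne_zero q.2.1 q.2.2 hj hj1 hjq (y 0, y 1))⟩, by
    rintro y ⟨i, hi⟩
    refine congrArg η (ImaginarySphere.conj_of_commute _ _ ?_)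
    fin_cases i
    · rcases hi with hi | hi
      · have hi' : y 0 = 0 := hi
        rw [hi', squareQuaternion_left, one_mul, mul_one]
      · have hi' : y 0 = 1 := hi
        rw [hi', squareQuaternion_right, one_mul, mul_one]
    · rcases hi with hi | hi
      · have hi' : y 1 = 0 := hi
        rw [hi', squareQuaternion_bottom, one_mul, mul_one]
      · have hi' : y 1 = 1 := hi
        rw [hi', squareQuaternion_top, add_mul, mul_add, smul_mul_assoc, smul_mul_assoc,
          mul_smul_comm, mul_smul_comm, one_mul, mul_one]⟩

variable {ι : Type*} [Fintype ι] [DecidableEq ι]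

/-- Conjugating `q` by a quaternion `u` conjugates the projection (1 + √-1 R(q))/2 by `R u`, so the
representation itself supplies the intertwiners. -/
theorem isFrameLift_sphereLoop {P : X → Matrix ι ι ℂ} (R : ℍ[ℝ] →ₐ[ℝ] Matrix ι ι ℂ)
    {η : ImaginarySphere → X} (hη : Continuous η)
    (hPη : ∀ q : ImaginarySphere, P (η q) = (2⁻¹ : ℝ) • (1 + Complex.I • R q.1))
    (q : ImaginarySphere) {j : ℍ[ℝ]} (hj : j.re = 0) (hj1 : ‖j‖ = 1) (hjq : (j * q.1).re = 0) :
    IsFrameLift (squareFamily P (sphereLoop hη q hj hj1 hjq)) (P (η q))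
      (fun z ↦ R (squareQuaternion q.1 j z)) where
  cont := by
    have h : Continuous R := R.toLinearMap.continuous_of_finiteDimensional
    exact h.comp (continuous_squareQuaternion q.1 j)
  det_ne_zero z := by
    have h0 := squareQuaternion_ne_zero q.2.1 q.2.2 hj hj1 hjq z
    have h : R (squareQuaternion q.1 j z) * R (squareQuaternion q.1 j z)⁻¹ = 1 := by
      rw [← map_mul, mul_inv_cancel₀ h0, map_one]
    intro hd
    have := congrArg Matrix.det h
    simp [hd] at this
  bottom s := by rw [squareQuaternion_bottom, map_one]
  left t := by rw [squareQuaternion_left, map_one]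
  right t := by rw [squareQuaternion_right, map_one]
  intertwine z := by
    have h0 := squareQuaternion_ne_zero q.2.1 q.2.2 hj hj1 hjq z
    have h1 : squareFamily P (sphereLoop hη q hj hj1 hjq) z = P (η (q.conj h0)) := rfl
    rw [h1, hPη, hPη, smul_mul_assoc, mul_smul_comm, add_mul, mul_add, one_mul, mul_one,
      smul_mul_assoc, mul_smul_comm, ← map_mul, ← map_mul, ImaginarySphere.conj, mul_assoc,
      inv_mul_cancel₀ h0, mul_one]

/-- The matrix `N` conjugates `p` to `1 - p`, so one factor may be replaced by the determinant of `z
• (1 - p) + p`, and the product of the two matrices is `z • 1`. This determines the determinant up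
to sign without computing the rank of `p`. -/
theorem det_add_one_sub_mul_self {p N : Matrix ι ι ℂ} (hp : p * p = p) (hN : N.det ≠ 0)
    (hNp : N * p = (1 - p) * N) (z : ℂ) :
    (z • p + (1 - p)).det * (z • p + (1 - p)).det = z ^ Fintype.card ι := by
  have h1 : N * (z • p + (1 - p)) = (z • (1 - p) + p) * N := by
    rw [mul_add, mul_smul_comm, mul_sub, hNp, mul_one, add_mul, smul_mul_assoc, sub_mul, one_mul]
    abel
  have h2 : (z • p + (1 - p)).det = (z • (1 - p) + p).det := by
    have := congrArg Matrix.det h1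
    rw [Matrix.det_mul, Matrix.det_mul, mul_comm] at this
    exact mul_right_cancel₀ hN this
  have h3 : (z • p + (1 - p)) * (z • (1 - p) + p) = z • (1 : Matrix ι ι ℂ) := by
    simp only [mul_add, add_mul, mul_sub, sub_mul, smul_mul_assoc, mul_smul_comm, smul_sub, mul_one,
      one_mul, hp, smul_add]
    abel
  conv_lhs => enter [2]; rw [h2]
  rw [← Matrix.det_mul, h3, Matrix.det_smul, Matrix.det_one, mul_one]

/-- On the range of `p` the matrix `R q` acts as -√-1, so on the top side the lift acts there as
e^(-2π√-1 s). Since `R j` anticommutes with `R q` it exchanges `p` and `1 - p`, and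
`det_add_one_sub_mul_self` gives the square of the loop; hence the factor 2 in the statement. -/
theorem degree_sphereLoop {P : X → Matrix ι ι ℂ} (hP2 : ∀ y, P y * P y = P y)
    (R : ℍ[ℝ] →ₐ[ℝ] Matrix ι ι ℂ) {η : ImaginarySphere → X} (hη : Continuous η)
    (hPη : ∀ q : ImaginarySphere, P (η q) = (2⁻¹ : ℝ) • (1 + Complex.I • R q.1))
    (q : ImaginarySphere) {j : ℍ[ℝ]} (hj : j.re = 0) (hj1 : ‖j‖ = 1) (hjq : (j * q.1).re = 0) :
    2 * (isFrameLift_sphereLoop R hη hPη q hj hj1 hjq).degree (hP2 _) (squareFamily_top P _) =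
      -(2 * Real.pi * Complex.I) * Fintype.card ι := by
  have hL := isFrameLift_sphereLoop R hη hPη q hj hj1 hjq
  set p := P (η q) with hp
  have hRq : R q.1 * p = (-Complex.I) • p := by
    rw [hp, hPη, mul_smul_comm, mul_add, mul_smul_comm, ← map_mul,
      Quaternion.mul_self_of_re_eq_zero q.2.1 q.2.2, map_neg, map_one, mul_one, smul_comm (-Complex.I)]
    congr 1
    rw [smul_add, smul_smul, neg_mul, Complex.I_mul_I, neg_neg, one_smul, smul_neg, neg_smul,
      add_comm]
  have hN : R j * p = (1 - p) * R j := by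
    have h1 : R j * R q.1 = -(R q.1 * R j) := by
      rw [← map_mul, ← map_mul, Quaternion.mul_eq_neg_mul q.2.1 hj
        (by rw [Quaternion.re_mul_comm, hjq]), map_neg]
    have h2 : (1 : Matrix ι ι ℂ) - p = (2⁻¹ : ℝ) • (1 - Complex.I • R q.1) := by
      rw [hp, hPη, smul_add, smul_sub]
      have : (1 : Matrix ι ι ℂ) = (2⁻¹ : ℝ) • 1 + (2⁻¹ : ℝ) • 1 := by
        rw [← add_smul]
        norm_num
      nth_rewrite 1 [this]
      abel
    rw [h2, hp, hPη, mul_smul_comm, smul_mul_assoc, mul_add, sub_mul, mul_smul_comm, smul_mul_assoc,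
      h1, smul_neg, mul_one, one_mul, sub_eq_add_neg]
  have hNd : (R j).det ≠ 0 := by
    have h : R j * R j = -1 := by
      rw [← map_mul, Quaternion.mul_self_of_re_eq_zero hj hj1, map_neg, map_one]
    intro hd
    have := congrArg Matrix.det h
    rw [Matrix.det_mul, hd, mul_zero, Matrix.det_neg, Matrix.det_one, mul_one] at this
    exact pow_ne_zero _ (by norm_num) this.symm
  have hloop : ∀ s, (hL.loop (hP2 _) (squareFamily_top P _) s : ℂ) =
      (Complex.exp (-(2 * Real.pi * Complex.I) * s) • p + (1 - p)).det := fun s ↦ by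
    change (compression p (R (squareQuaternion q.1 j (s, 1)))).det = _
    rw [compression, squareQuaternion_top, map_add, map_smul, map_smul, map_one, mul_assoc, add_mul,
      smul_mul_assoc, smul_mul_assoc, one_mul, hRq, mul_add, mul_smul_comm, mul_smul_comm,
      mul_smul_comm, hP2]
    congr 2
    rw [← Complex.coe_smul, ← Complex.coe_smul, smul_smul, ← add_smul]
    congr 1
    have : -(2 * Real.pi * Complex.I) * (s : ℂ) = (-(2 * Real.pi * s : ℝ) : ℂ) * Complex.I := by
      push_cast
      ring
    rw [this, Complex.exp_mul_I, Complex.cos_neg, Complex.sin_neg]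
    push_cast
    ring
  let c : C(I, {z : ℂ // z ≠ 0}) :=
    ⟨fun s ↦ ⟨Complex.exp (-(2 * Real.pi * Complex.I) * Fintype.card ι * s), Complex.exp_ne_zero _⟩,
      Continuous.subtype_mk (by fun_prop) _⟩
  have hc0 : (c 0 : ℂ) = 1 := by simp [c]
  have h1 := logIncrement_mul hc0 (hL.loop_zero (hP2 _) (squareFamily_top P _))
    (hL.loop_zero (hP2 _) (squareFamily_top P _)) (fun s ↦ by
      rw [hloop, det_add_one_sub_mul_self (hP2 _) hNd hN, ← Complex.exp_nat_mul]
      change Complex.exp _ = _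
      congr 1
      ring)
  have h2 : logIncrement c hc0 = -(2 * Real.pi * Complex.I) * Fintype.card ι := by
    rw [logIncrement_eq_of_exp hc0 (l := fun s ↦ -(2 * Real.pi * Complex.I) * Fintype.card ι * s)
      (by fun_prop) (by simp) (fun s ↦ rfl)]
    simp
  rw [two_mul, ← h2]
  exact h1.symm

/-- A map from the 2-sphere of unit imaginary quaternions, whose composition with a map to the
idempotents is the family of projections given by a representation of the quaternions, has infinite
order. -/
theorem one_le_rank_of_sphere [Nonempty ι] {P : X → Matrix ι ι ℂ} (hP : Continuous P)
    (hP2 : ∀ y, P y * P y = P y) (R : ℍ[ℝ] →ₐ[ℝ] Matrix ι ι ℂ) {η : ImaginarySphere → X}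
    (hη : Continuous η)
    (hPη : ∀ q : ImaginarySphere, P (η q) = (2⁻¹ : ℝ) • (1 + Complex.I • R q.1))
    (q : ImaginarySphere) : 1 ≤ Module.rank ℤ (Additive (π_ 2 X (η q))) := by
  obtain ⟨j, hj, hj1, hjq⟩ := Quaternion.exists_orthogonal q.1
  refine one_le_rank_of_isFrameLift hP hP2 (sphereLoop hη q hj hj1 hjq)
    (isFrameLift_sphereLoop R hη hPη q hj hj1 hjq) fun h0 ↦ ?_
  have h := degree_sphereLoop hP2 R hη hPη q hj hj1 hjq
  rw [h0, mul_zero] at h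
  have hpi : (Real.pi : ℂ) ≠ 0 := by exact_mod_cast Real.pi_ne_zero
  have hcard : (Fintype.card ι : ℂ) ≠ 0 := by exact_mod_cast Fintype.card_ne_zero
  refine absurd h.symm ?_
  simp [hpi, hcard]

end SphereLift

/-! ### Continuity in the `C^∞` topology -/

section SmoothTopology

variable {d : ℕ} {M : Type*} [TopologicalSpace M] [ChartedSpace (EuclideanSpace ℝ (Fin d)) M]
  [IsManifold (𝓡 d) ∞ M]

/-- Singletons are among the compact sets of uniform convergence. Only orders 0 and 1 are needed, as
the projection at `p` depends on the 1-jet of the form. -/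
theorem OneForm.continuous_iteratedFDeriv_inChart (k : ℕ) (x : M) {y : EuclideanSpace ℝ (Fin d)}
    (hy : y ∈ (extChartAt (𝓡 d) x).target) :
    Continuous fun α : OneForm d M ↦ iteratedFDeriv ℝ k (α.inChart x) y := by
  have h1 : Continuous fun α : OneForm d M ↦ UniformOnFun.ofFun
      {K : Set (EuclideanSpace ℝ (Fin d)) | IsCompact K ∧ K ⊆ (extChartAt (𝓡 d) x).target}
      (iteratedFDeriv ℝ k (α.inChart x)) :=
    continuous_iInf_dom (i := x) (continuous_iInf_dom (i := k) continuous_induced_dom)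
  have h2 := (UniformOnFun.uniformContinuous_eval_of_mem (s := {y})
    (𝔖 := {K : Set (EuclideanSpace ℝ (Fin d)) | IsCompact K ∧ K ⊆ (extChartAt (𝓡 d) x).target})
    (EuclideanSpace ℝ (Fin d) [×k]→L[ℝ] (EuclideanSpace ℝ (Fin d) →L[ℝ] ℝ)) (x := y) (by simp)
    (by simpa using hy)).continuous
  exact h2.comp h1

theorem OneForm.continuous_inChart (x : M) {y : EuclideanSpace ℝ (Fin d)}
    (hy : y ∈ (extChartAt (𝓡 d) x).target) : Continuous fun α : OneForm d M ↦ α.inChart x y := by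
  have h : Continuous fun α : OneForm d M ↦ iteratedFDeriv ℝ 0 (α.inChart x) y 0 :=
    (continuous_eval_const _).comp (OneForm.continuous_iteratedFDeriv_inChart 0 x hy)
  simpa only [iteratedFDeriv_zero_apply] using h

theorem OneForm.continuous_fderiv_inChart (x : M) {y : EuclideanSpace ℝ (Fin d)}
    (hy : y ∈ (extChartAt (𝓡 d) x).target) :
    Continuous fun α : OneForm d M ↦ fderiv ℝ (α.inChart x) y := by
  refine continuous_clm_apply.2 fun u ↦ ?_
  have h : Continuous fun α : OneForm d M ↦ iteratedFDeriv ℝ 1 (α.inChart x) y ![u] :=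
    (continuous_eval_const _).comp (OneForm.continuous_iteratedFDeriv_inChart 1 x hy)
  simp only [iteratedFDeriv_one_apply] at h
  exact h

/-- A finite dimensional linear family of 1-forms is continuous. -/
theorem OneForm.continuous_of_finiteDimensional {V : Type*} [NormedAddCommGroup V] [NormedSpace ℝ V]
    [FiniteDimensional ℝ V] (Λ : V →ₗ[ℝ] OneForm d M) : Continuous Λ := by
  have : ProperSpace V := FiniteDimensional.proper ℝ V
  refine continuous_iInf_rng.2 fun x ↦ continuous_iInf_rng.2 fun k ↦ continuous_induced_rng.2 ?_
  refine continuous_iff_continuousAt.2 fun v₀ ↦ ?_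
  refine UniformOnFun.tendsto_iff_tendstoUniformlyOn.2 fun K hK ↦ ?_
  obtain ⟨hKc, hKt⟩ : IsCompact K ∧ K ⊆ (extChartAt (𝓡 d) x).target := by simpa using hK
  have hC : ∀ (α : OneForm d M), ∀ y ∈ K, ContDiffAt ℝ k (α.inChart x) y := fun α y hy ↦
    (α.contDiffAt_inChart x (hKt hy)).of_le (by exact_mod_cast le_top)
  have hadd : ∀ u v, (Λ (u + v)).inChart x = (Λ u).inChart x + (Λ v).inChart x := fun u v ↦ by
    rw [map_add]
    rfl
  have hsmul : ∀ (c : ℝ) u, (Λ (c • u)).inChart x = c • (Λ u).inChart x := fun c u ↦ by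
    rw [map_smul]
    rfl
  -- By linearity the derivatives on `K` are finite combinations of those of the basis forms, with
  -- the coordinates of `v` as coefficients. They are jointly continuous on `V × K`, and compactness
  -- of `K` turns this into uniform convergence.
  let b := Module.finBasis ℝ V
  have hsum : ∀ v, ∀ y ∈ K, iteratedFDeriv ℝ k ((Λ v).inChart x) y =
      ∑ i, b.equivFun v i • iteratedFDeriv ℝ k ((Λ (b i)).inChart x) y := fun v y hy ↦ by
    let D : V →ₗ[ℝ] _ := IsLinearMap.mk' (fun v ↦ iteratedFDeriv ℝ k ((Λ v).inChart x) y)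
      ⟨fun u v ↦ by rw [hadd, iteratedFDeriv_add_apply (hC _ y hy) (hC _ y hy)],
        fun c u ↦ by rw [hsmul, iteratedFDeriv_const_smul_apply (hC _ y hy)]⟩
    change D v = ∑ i, b.equivFun v i • D (b i)
    conv_lhs => rw [← b.sum_equivFun v, map_sum]
    simp only [map_smul]
  rw [tendstoUniformlyOn_iff_tendstoUniformly_comp_coe]
  have : CompactSpace K := isCompact_iff_compactSpace.1 hKc
  refine Continuous.tendstoUniformly (fun v (y : K) ↦ iteratedFDeriv ℝ k ((Λ v).inChart x) y) ?_ v₀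
  have hc : ∀ i, Continuous fun y : K ↦ iteratedFDeriv ℝ k ((Λ (b i)).inChart x) y := fun i ↦
    continuous_iff_continuousAt.2 fun y ↦
      ((((Λ (b i)).contDiffAt_inChart x (hKt y.2)).iteratedFDeriv_right (i := k) (m := 0)
        (by rw [zero_add]; exact_mod_cast le_top)).continuousAt).comp continuous_subtype_val.continuousAt
  have hb : ∀ i, Continuous fun v ↦ b.equivFun v i := fun i ↦
    (continuous_apply i).comp b.equivFun.toLinearMap.continuous_of_finiteDimensional
  have : ∀ z : V × K, (Function.HasUncurry.uncurry
      fun v (y : K) ↦ iteratedFDeriv ℝ k ((Λ v).inChart x) y) z =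
      ∑ i, b.equivFun z.1 i • iteratedFDeriv ℝ k ((Λ (b i)).inChart x) z.2 := fun z ↦
    hsum z.1 z.2 z.2.2
  refine Continuous.congr ?_ fun z ↦ (this z).symm
  exact continuous_finsetSum _ fun i _ ↦
    ((hb i).comp continuous_fst).smul ((hc i).comp continuous_snd)

end SmoothTopology

/-! ### The positive projection of a contact structure at a point -/

section ContactProjection

open scoped Matrix.Norms.L2Operator

variable {d : ℕ} {M : Type*} [TopologicalSpace M] [ChartedSpace (EuclideanSpace ℝ (Fin d)) M]
  [IsManifold (𝓡 d) ∞ M]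

theorem OneForm.inChart_self (α : OneForm d M) (p : M) (v : EuclideanSpace ℝ (Fin d)) :
    α.inChart p (extChartAt (𝓡 d) p p) v = α p v := by
  rw [OneForm.inChart_apply]
  refine α.apply_congr (extChartAt_to_inv p) ?_
  exact congrArg (fun f : EuclideanSpace ℝ (Fin d) →L[ℝ] EuclideanSpace ℝ (Fin d) ↦ f v)
    (fromChart_self (𝓡 d) p)

/-- On the kernels, the exterior derivative of a 1-form is multiplied by `f` with the 1-form. -/
theorem fderiv_sub_of_eq_smul {E : Type*} [NormedAddCommGroup E] [NormedSpace ℝ E]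
    {α β : E → E →L[ℝ] ℝ} {f : E → ℝ} {z : E} (hα : DifferentiableAt ℝ α z)
    (hβ : DifferentiableAt ℝ β z) (h0 : α z ≠ 0) (h : ∀ y, β y = f y • α y) {u v : E}
    (hu : α z u = 0) (hv : α z v = 0) :
    fderiv ℝ β z u v - fderiv ℝ β z v u = f z * (fderiv ℝ α z u v - fderiv ℝ α z v u) := by
  obtain ⟨w, hw⟩ : ∃ w, α z w ≠ 0 := by
    by_contra! hc
    exact h0 (ContinuousLinearMap.ext hc)
  have hαw : DifferentiableAt ℝ (fun y ↦ α y w) z := hα.clm_apply (differentiableAt_const w)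
  have hβw : DifferentiableAt ℝ (fun y ↦ β y w) z := hβ.clm_apply (differentiableAt_const w)
  -- The factor is not assumed regular: near `z` it is the quotient `β y w / α y w` for a vector `w`
  -- outside the kernel.
  have hf : DifferentiableAt ℝ f z := by
    refine (hβw.fun_mul (hαw.fun_inv hw)).congr_of_eventuallyEq ?_
    filter_upwards [hαw.continuousAt.eventually_ne hw] with y hy
    rw [h y, smul_apply, smul_eq_mul, mul_inv_cancel_right₀ hy]
  have hβ' : β = fun y ↦ f y • α y := funext h
  rw [hβ', (hf.hasFDerivAt.fun_smul hα.hasFDerivAt).fderiv]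
  simp [hu, hv]
  ring

variable {m : ℕ} (T : (EuclideanSpace ℝ (Fin d) →L[ℝ] ℝ) →L[ℝ] EuclideanSpace ℝ (Fin d))
  (e : Module.Basis (Fin m) ℝ (EuclideanSpace ℝ (Fin d) × ℝ)) (p : M)

/-- The symplectic form of the symplectization of a contact form at the point `p`. -/
def OneForm.symplectizationAt (α : OneForm d M) :
    LinearMap.BilinForm ℝ (EuclideanSpace ℝ (Fin d) × ℝ) :=
  symplectization T (α.inChart p (extChartAt (𝓡 d) p p))
    (fderiv ℝ (α.inChart p) (extChartAt (𝓡 d) p p))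

theorem OneForm.IsContact.inChart_ne_zero {α : OneForm d M} (hα : α.IsContact) :
    α.inChart p (extChartAt (𝓡 d) p p) ≠ 0 := fun h ↦ by
  refine (hα p).1 (ContinuousLinearMap.ext fun v ↦ ?_)
  have := α.inChart_self p v
  rw [h] at this
  exact this.symm

theorem OneForm.IsContact.symplectizationAt_nondegenerate
    (hT : ∀ a : EuclideanSpace ℝ (Fin d) →L[ℝ] ℝ, a ≠ 0 → a (T a) ≠ 0) {α : OneForm d M} (hα : α.IsContact) :
    (α.symplectizationAt T p).Nondegenerate := by
  refine symplectization_nondegenerate (hT _ (hα.inChart_ne_zero p)) fun u hu h ↦ ?_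
  refine (hα p).2 u ((α.inChart_self p u).symm.trans hu) fun v hv ↦ ?_
  exact h v ((α.inChart_self p v).trans hv)

/-- The projection to the positive eigenspaces of the symplectic form at `p`. -/
def ContactForm.projection (α : ContactForm d M) : Matrix (Fin m) (Fin m) ℂ :=
  positiveProjection (hermitianMatrix e (α.1.symplectizationAt T p))

theorem ContactForm.projection_mul_self
    (hT : ∀ a : EuclideanSpace ℝ (Fin d) →L[ℝ] ℝ, a ≠ 0 → a (T a) ≠ 0) (α : ContactForm d M) :
    α.projection T e p * α.projection T e p = α.projection T e p :=
  positiveProjection_mul_self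
    (det_hermitianMatrix_ne_zero e (α.2.symplectizationAt_nondegenerate T p hT))

theorem ContactForm.continuous_projection
    (hT : ∀ a : EuclideanSpace ℝ (Fin d) →L[ℝ] ℝ, a ≠ 0 → a (T a) ≠ 0) :
    Continuous fun α : ContactForm d M ↦ α.projection T e p := by
  refine continuous_positiveProjection ?_
    (fun α ↦ isHermitian_hermitianMatrix e fun x y ↦ symplectization_swap x y)
    (fun α ↦ det_hermitianMatrix_ne_zero e (α.2.symplectizationAt_nondegenerate T p hT))
  refine continuous_matrix fun i j ↦ ?_
  have h1 : Continuous fun α : ContactForm d M ↦ α.1.symplectizationAt T p (e i) (e j) :=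
    continuous_symplectization T
      ((OneForm.continuous_inChart p (mem_extChartAt_target p)).comp continuous_subtype_val)
      ((OneForm.continuous_fderiv_inChart p (mem_extChartAt_target p)).comp continuous_subtype_val)
      (fun α ↦ hT _ (α.2.inChart_ne_zero p)) (e i) (e j)
  have h2 : ∀ α : ContactForm d M, hermitianMatrix e (α.1.symplectizationAt T p) i j =
      Complex.I * (α.1.symplectizationAt T p (e i) (e j) : ℂ) := fun α ↦ by
    simp [hermitianMatrix]
  simp only [h2]
  exact continuous_const.mul (Complex.continuous_ofReal.comp h1)

/-- Passing to an equivalent contact form multiplies the symplectic form at `p` by a positive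
number, which does not change the positive eigenspaces. -/
theorem ContactForm.projection_eq
    (hT : ∀ a : EuclideanSpace ℝ (Fin d) →L[ℝ] ℝ, a ≠ 0 → a (T a) ≠ 0) {α β : ContactForm d M} (h : α ≈ β) :
    α.projection T e p = β.projection T e p := by
  obtain ⟨f, hf, h⟩ := h
  set z := extChartAt (𝓡 d) p p with hz
  have hzt : z ∈ (extChartAt (𝓡 d) p).target := mem_extChartAt_target p
  have hchart : ∀ y, β.1.inChart p y = f ((extChartAt (𝓡 d) p).symm y) • α.1.inChart p y :=
    fun y ↦ by
      rw [OneForm.inChart, h]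
      rfl
  have hd : ∀ γ : OneForm d M, DifferentiableAt ℝ (γ.inChart p) z := fun γ ↦
    (γ.contDiffAt_inChart p hzt).differentiableAt (by simp)
  have hs : β.1.symplectizationAt T p = f ((extChartAt (𝓡 d) p).symm z) •
      α.1.symplectizationAt T p := by
    rw [OneForm.symplectizationAt, ← hz, hchart z]
    exact symplectization_smul (hT _ (α.2.inChart_ne_zero p)) (hf _).ne' fun u v hu hv ↦
      fderiv_sub_of_eq_smul (hd _) (hd _) (α.2.inChart_ne_zero p) hchart hu hv
  rw [ContactForm.projection, ContactForm.projection, hs, hermitianMatrix_smul,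
    positiveProjection_smul (H := hermitianMatrix e (α.1.symplectizationAt T p))
      (isHermitian_hermitianMatrix e fun x y ↦ symplectization_swap x y)
      (det_hermitianMatrix_ne_zero e (α.2.symplectizationAt_nondegenerate T p hT)) (hf _)]

/-- The projection to the positive eigenspaces of the symplectic form at `p`, for a contact
structure. -/
def ContactStructure.projection
    (hT : ∀ a : EuclideanSpace ℝ (Fin d) →L[ℝ] ℝ, a ≠ 0 → a (T a) ≠ 0) (ξ : ContactStructure d M) : Matrix (Fin m) (Fin m) ℂ :=
  Quotient.lift (fun α : ContactForm d M ↦ α.projection T e p)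
    (fun _ _ h ↦ ContactForm.projection_eq T e p hT h) ξ

theorem ContactStructure.continuous_projection
    (hT : ∀ a : EuclideanSpace ℝ (Fin d) →L[ℝ] ℝ, a ≠ 0 → a (T a) ≠ 0) :
    Continuous fun ξ : ContactStructure d M ↦ ξ.projection T e p hT :=
  (ContactForm.continuous_projection T e p hT).quotient_lift _

theorem ContactStructure.projection_mul_self
    (hT : ∀ a : EuclideanSpace ℝ (Fin d) →L[ℝ] ℝ, a ≠ 0 → a (T a) ≠ 0) (ξ : ContactStructure d M) :
    ξ.projection T e p hT * ξ.projection T e p hT = ξ.projection T e p hT := by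
  obtain ⟨α, rfl⟩ := Quotient.exists_rep ξ
  exact α.projection_mul_self T e p hT

end ContactProjection

/-! ### The 2-sphere of contact structures has infinite order -/

section Main

/-- A nondegenerate bilinear form identifies the dual space with the space. -/
theorem exists_sharp {E : Type*} [NormedAddCommGroup E] [NormedSpace ℝ E] [FiniteDimensional ℝ E]
    (G : E →L[ℝ] E →L[ℝ] ℝ) (hG : ∀ u, u ≠ 0 → 0 < G u u) :
    ∃ T : (E →L[ℝ] ℝ) →L[ℝ] E, ∀ a, G (T a) = a := by
  have hinj : Function.Injective (G : E →ₗ[ℝ] (E →L[ℝ] ℝ)) := by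
    refine (injective_iff_map_eq_zero _).2 fun u hu ↦ ?_
    by_contra h
    have h0 : G u = 0 := hu
    have := hG u h
    rw [h0] at this
    simp at this
  have hdim : Module.finrank ℝ E = Module.finrank ℝ (E →L[ℝ] ℝ) := by
    rw [← LinearMap.toContinuousLinearMap.finrank_eq]
    exact Subspace.dual_finrank_eq.symm
  let L := LinearEquiv.ofInjectiveOfFinrankEq (G : E →ₗ[ℝ] (E →L[ℝ] ℝ)) hinj hdim
  exact ⟨LinearMap.toContinuousLinearMap L.symm.toLinearMap, fun a ↦ L.apply_symm_apply a⟩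

variable {d : ℕ} {M : Type*} [TopologicalSpace M] [ChartedSpace (EuclideanSpace ℝ (Fin d)) M]
  [IsManifold (𝓡 d) ∞ M] {n : ℕ} {g : ContMDiffRiemannianMetric (𝓡 d) ∞ (EuclideanSpace ℝ (Fin d))
      (fun p : M ↦ TangentSpace (𝓡 d) p)}

namespace QuaternionicFields

variable (K : QuaternionicFields n g)

/-- The frame carries an orthonormal basis of ℍ^(n+1) to the tangent space of the cone. The basis is
not empty, which is needed for the degree to be nonzero. -/
theorem exists_orthonormal_basis (K : QuaternionicFields n g) (p : M) :
    ∃ (m : ℕ) (e : Module.Basis (Fin m) ℝ (EuclideanSpace ℝ (Fin d) × ℝ)), Nonempty (Fin m) ∧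
      ∀ i j, coneBilin g (p, 1) (e i) (e j) = if i = j then 1 else 0 := by
  obtain ⟨ψ, hψ, -⟩ := K.exists_frame (p, 1) one_pos
  let b := stdOrthonormalBasis ℝ (PiLp 2 fun _ : Fin (n + 1) ↦ ℍ[ℝ])
  let e := b.toBasis.map ((WithLp.linearEquiv 2 ℝ (Fin (n + 1) → ℍ[ℝ])).trans ψ.symm)
  refine ⟨_, e, ⟨⟨0, Module.finrank_pos⟩⟩, fun i j ↦ ?_⟩
  rw [bilin_eq_sum_inner ((isMetricOn_cone g).symm (p, 1)) hψ, ← orthonormal_iff_ite.1 b.orthonormal,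
    PiLp.inner_apply]
  simp [e]

variable {m : ℕ} {p : M} {e : Module.Basis (Fin m) ℝ (EuclideanSpace ℝ (Fin d) × ℝ)}

/-- The matrices of the multiplications by the quaternions. -/
def representation (K : QuaternionicFields n g) (p : M)
    (e : Module.Basis (Fin m) ℝ (EuclideanSpace ℝ (Fin d) × ℝ)) :
    ℍ[ℝ] →ₐ[ℝ] Matrix (Fin m) (Fin m) ℂ :=
  AlgHom.ofLinearMap
    { toFun := fun q ↦ ((LinearMap.toMatrix e e (K.field q (p, 1)).toLinearMap)ᵀ).map Complex.ofReal
      map_add' := fun a b ↦ by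
        ext i j
        simp [LinearMap.toMatrix_apply, K.field_add (y := (p, 1)) one_pos]
      map_smul' := fun c a ↦ by
        ext i j
        simp [LinearMap.toMatrix_apply, K.field_smul (y := (p, 1)) one_pos] }
    (by
      have h : (K.field 1 (p, 1)).toLinearMap = LinearMap.id :=
        LinearMap.ext fun v ↦ K.field_one (y := (p, 1)) one_pos v
      change ((LinearMap.toMatrix e e (K.field 1 (p, 1)).toLinearMap)ᵀ).map Complex.ofReal = 1
      rw [h, LinearMap.toMatrix_id, Matrix.transpose_one]
      exact Matrix.map_one _ Complex.ofReal_zero Complex.ofReal_one)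
    (fun a b ↦ by
      -- Multiplication on the right reverses products; the transpose in the definition reverses
      -- them back.
      have h : (K.field (a * b) (p, 1)).toLinearMap =
          (K.field b (p, 1)).toLinearMap ∘ₗ (K.field a (p, 1)).toLinearMap :=
        LinearMap.ext fun v ↦ (K.field_field (y := (p, 1)) one_pos b a v).symm
      change ((LinearMap.toMatrix e e (K.field (a * b) (p, 1)).toLinearMap)ᵀ).map Complex.ofReal =
        ((LinearMap.toMatrix e e (K.field a (p, 1)).toLinearMap)ᵀ).map Complex.ofReal *
        ((LinearMap.toMatrix e e (K.field b (p, 1)).toLinearMap)ᵀ).map Complex.ofReal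
      rw [h, LinearMap.toMatrix_comp e e e, Matrix.transpose_mul]
      exact Matrix.map_mul (f := Complex.ofRealHom))

theorem representation_apply
    (he : ∀ i j, coneBilin g (p, 1) (e i) (e j) = if i = j then 1 else 0) (q : ℍ[ℝ]) (i j : Fin m) :
    K.representation p e q i j = (coneBilin g (p, 1) (K.field q (p, 1) (e i)) (e j) : ℂ) := by
  have h : ∀ v, e.repr v j = coneBilin g (p, 1) v (e j) := fun v ↦ by
    conv_rhs => rw [← e.sum_repr v, map_sum, sum_apply]
    simp [he]
  rw [← h]
  change (LinearMap.toMatrix e e (K.field q (p, 1)).toLinearMap j i : ℂ) = _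
  rw [LinearMap.toMatrix_apply]
  rfl

/-- On vectors tangent to M both sides are dα_q, by `extDerivAt_form`; the pairings with ∂_r on the
right are given by α_q, and they are the summand 2 dr ∧ α_q. -/
theorem symplectizationAt_form
    {T : (EuclideanSpace ℝ (Fin d) →L[ℝ] ℝ) →L[ℝ] EuclideanSpace ℝ (Fin d)}
    (hT : ∀ a, baseBilin g p (T a) = a) {q : ℍ[ℝ]} (hq : q.re = 0) (hq1 : ‖q‖ = 1)
    (x y : EuclideanSpace ℝ (Fin d) × ℝ) :
    (K.form q).symplectizationAt T p x y =
      2 * coneBilin g (p, 1) (K.field q (p, 1) x) y := by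
  have hp : (0 : ℝ) < (p, (1 : ℝ)).2 := one_pos
  set a := (K.form q).inChart p (extChartAt (𝓡 d) p p) with ha
  set G := coneBilin g (p, 1) with hG
  set J := K.field q (p, 1) with hJ
  have hsymm : ∀ u v, G u v = G v u := (isMetricOn_cone g).symm (p, 1)
  have hR : ∀ v : EuclideanSpace ℝ (Fin d), G (0, 1) (v, 0) = 0 := fun v ↦ by
    rw [hG, coneBilin_apply]
    simp
  have hav : ∀ v, a v = G (v, 0) (J (0, 1)) := fun v ↦
    ((K.form q).inChart_self p v).trans (K.form_apply q p v)
  have hJskew : ∀ u v, G (J u) v = -G u (J v) := fun u v ↦ by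
    have h1 : (-q) = (-1 : ℝ) • q := by simp
    rw [hG, hJ, K.bilin_field_left hp, Quaternion.star_eq_neg.2 hq, h1, K.field_smul hp, map_smul]
    simp
  have hJJ : ∀ v, J (J v) = -v := fun v ↦ by
    have h1 : (-1 : ℍ[ℝ]) = (-1 : ℝ) • (1 : ℍ[ℝ]) := by simp
    rw [hJ, K.field_field hp, Quaternion.mul_self_of_re_eq_zero hq hq1, h1, K.field_smul hp,
      K.field_one hp, neg_one_smul]
  -- As `T` is the duality of the metric, the direction of projection is the vector field J_q ∂_r
  -- itself.
  have hTa : (T a, (0 : ℝ)) = J (0, 1) := by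
    rw [hJ, K.field_radial hq]
    refine Prod.ext ?_ rfl
    change T a = K.vectorField q p
    by_contra hne
    have hne' : ((T a - K.vectorField q p, 0) : EuclideanSpace ℝ (Fin d) × ℝ) ≠ 0 := fun h0 ↦
      hne (sub_eq_zero.1 (congrArg Prod.fst h0))
    have hpos := (isMetricOn_cone g).pos (p, 1) (by simp) _ hne'
    refine hpos.ne' ?_
    have h1 : ∀ w, baseBilin g p (T a - K.vectorField q p) w = 0 := fun w ↦ by
      have h2 := hav w
      rw [hJ, K.field_radial hq, hsymm, hG, coneBilin_apply] at h2
      rw [map_sub, sub_apply, hT, h2]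
      simp
    rw [coneBilin_apply, h1]
    simp
  have hpr : ∀ v : EuclideanSpace ℝ (Fin d), ((kernelProjection T a v, 0) :
      EuclideanSpace ℝ (Fin d) × ℝ) = (v, 0) - (a v / a (T a)) • J (0, 1) := fun v ↦ by
    rw [← hTa, kernelProjection_apply]
    simp
  have hd : ∀ u v, fderiv ℝ ((K.form q).inChart p) (extChartAt (𝓡 d) p p) u v -
      fderiv ℝ ((K.form q).inChart p) (extChartAt (𝓡 d) p p) v u = 2 * G (J (u, 0)) (v, 0) :=
    K.extDerivAt_form hq p
  -- The projection changes vectors by multiples of J ∂_r, and J J ∂_r = -∂_r is orthogonal to all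
  -- vectors tangent to M, so here it has no effect.
  have hdpr : ∀ u v : EuclideanSpace ℝ (Fin d),
      G (J (kernelProjection T a u, 0)) (kernelProjection T a v, 0) = G (J (u, 0)) (v, 0) :=
    fun u v ↦ by
      have h1 : ∀ w, G (J (J (0, 1))) (kernelProjection T a w, 0) = 0 := fun w ↦ by
        rw [hJJ, map_neg, neg_apply, hR, neg_zero]
      have h2 : G (J (u, 0)) (J (0, 1)) = 0 := by
        rw [hJskew, hJJ, map_neg, neg_neg, hsymm, hR]
      rw [hpr u, map_sub, map_smul, map_sub, map_smul, sub_apply, smul_apply, h1, smul_zero,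
        sub_zero, hpr v, map_sub, map_smul, h2, smul_zero, sub_zero]
  have hsplit : ∀ w : EuclideanSpace ℝ (Fin d) × ℝ,
      w = (w.1, 0) + w.2 • ((0, 1) : EuclideanSpace ℝ (Fin d) × ℝ) := fun w ↦ by
    ext <;> simp
  have hJR : G (J (0, 1)) (0, 1) = 0 := by
    rw [hsymm, hG, hJ, K.bilin_field_self hp, hq, zero_mul]
  rw [OneForm.symplectizationAt, symplectization_apply, ← ha, hd, hdpr]
  conv_rhs => rw [hsplit x, hsplit y]
  simp only [map_add, map_smul, add_apply, smul_apply, smul_eq_mul, hJR, mul_zero, add_zero]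
  rw [hJskew (x.1, 0) (0, 1), hsymm (J (0, 1)), ← hav, ← hav]
  ring

/-- In an orthonormal basis the Hermitian matrix is twice √-1 R(q). The factor 2 is positive, and
√-1 R(q) is an involution because R(q)² = -1. -/
theorem projection_form (he : ∀ i j, coneBilin g (p, 1) (e i) (e j) = if i = j then 1 else 0)
    {T : (EuclideanSpace ℝ (Fin d) →L[ℝ] ℝ) →L[ℝ] EuclideanSpace ℝ (Fin d)}
    (hT : ∀ a, baseBilin g p (T a) = a) {q : ℍ[ℝ]} (hq : q.re = 0) (hq1 : ‖q‖ = 1) :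
    ContactForm.projection T e p ⟨K.form q, K.isContact_form hq hq1⟩ =
      (2⁻¹ : ℝ) • (1 + Complex.I • K.representation p e q) := by
  have h1 : hermitianMatrix e ((K.form q).symplectizationAt T p) =
      (2 : ℝ) • (Complex.I • K.representation p e q) := by
    ext i j
    simp [hermitianMatrix, K.symplectizationAt_form hT hq hq1, K.representation_apply he]
    ring
  have h2 : (Complex.I • K.representation p e q) * (Complex.I • K.representation p e q) = 1 := by
    rw [smul_mul_smul_comm, Complex.I_mul_I, ← map_mul, Quaternion.mul_self_of_re_eq_zero hq hq1,
      map_neg, map_one, neg_smul_neg, one_smul]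
  have h3 : (Complex.I • K.representation p e q).IsHermitian := by
    have h4 := isHermitian_hermitianMatrix e
      (B := (K.form q).symplectizationAt T p) fun x y ↦ symplectization_swap x y
    have h5 : Complex.I • K.representation p e q =
        (2⁻¹ : ℝ) • hermitianMatrix e ((K.form q).symplectizationAt T p) := by
      rw [h1, smul_smul]
      norm_num
    rw [h5]
    exact h4.smul (IsSelfAdjoint.all _)
  have h6 : (Complex.I • K.representation p e q).det ≠ 0 := fun h0 ↦ by
    have := congrArg Matrix.det h2
    rw [Matrix.det_mul, h0, zero_mul, Matrix.det_one] at this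
    exact zero_ne_one this
  rw [ContactForm.projection, h1, positiveProjection_smul h3 h6 two_pos,
    positiveProjection_of_mul_self_eq_one h3 h2]

/-- The contact form of a unit imaginary quaternion. -/
def contactForm (q : ImaginarySphere) : ContactForm d M :=
  ⟨K.form q.1, K.isContact_form q.2.1 q.2.2⟩

theorem continuous_contactForm : Continuous K.contactForm := by
  let Λ : ℍ[ℝ] →ₗ[ℝ] OneForm d M :=
    { toFun := K.form
      map_add' := K.form_add
      map_smul' := K.form_smul }
  exact ((OneForm.continuous_of_finiteDimensional Λ).comp continuous_subtype_val).subtype_mk _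

theorem one_le_rank [CompactSpace M] [T2Space M] [Nonempty M] (q : ImaginarySphere) :
    1 ≤ Module.rank ℤ (Additive (π_ 2 (K.contactForm q).ker.IsotopyClass
      (K.contactForm q).ker.base)) := by
  obtain ⟨p⟩ := ‹Nonempty M›
  obtain ⟨m, e, hm, he⟩ := K.exists_orthonormal_basis p
  have hpos : ∀ u, u ≠ 0 → 0 < baseBilin g p u u := fun u hu ↦ by
    have h := (isMetricOn_cone g).pos (p, 1) (by simp) (u, 0) (fun h ↦ hu (congrArg Prod.fst h))
    rw [coneBilin_apply] at h
    simpa using h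
  -- The metric at `p` fixes, once for all contact forms, a complement `T a` to the kernel of each
  -- nonzero covector `a`; positivity gives `a (T a) ≠ 0`.
  obtain ⟨T, hT⟩ := exists_sharp (baseBilin g p) hpos
  have hT' : ∀ a : EuclideanSpace ℝ (Fin d) →L[ℝ] ℝ, a ≠ 0 → a (T a) ≠ 0 := fun a ha ↦ by
    have h0 : T a ≠ 0 := fun h ↦ ha (by rw [← hT a, h, map_zero])
    have := hpos (T a) h0
    rw [hT] at this
    exact this.ne'
  let η : ImaginarySphere → (K.contactForm q).ker.IsotopyClass := fun a ↦
    ⟨(K.contactForm a).ker, K.isIsotopic_form q.2.1 q.2.2 a.2.1 a.2.2⟩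
  have hη : Continuous η :=
    (continuous_quotient_mk'.comp K.continuous_contactForm).subtype_mk _
  exact one_le_rank_of_sphere (P := fun ζ ↦ ζ.1.projection T e p hT')
    ((ContactStructure.continuous_projection T e p hT').comp continuous_subtype_val)
    (fun ζ ↦ ζ.1.projection_mul_self T e p hT') (K.representation p e) hη
    (fun a ↦ K.projection_form he hT a.2.1 a.2.2) q

end QuaternionicFields

end Main

theorem theorem1 (n : ℕ) (M : Type*) [TopologicalSpace M]
    [ChartedSpace (EuclideanSpace ℝ (Fin (4 * n + 3))) M] [IsManifold (𝓡 (4 * n + 3)) ∞ M]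
    [T2Space M] [CompactSpace M] [ConnectedSpace M]
    (ξ : ContactStructure (4 * n + 3) M) (hξ : ξ.IsThreeSasakian n) :
    1 ≤ Module.rank ℤ (Additive (π_ 2 ξ.IsotopyClass ξ.base)) := by
  obtain ⟨g, x, φ, J, α, hx, ⟨hJ, q, hq, hq1, hφ⟩, rfl, hα⟩ := hξ
  -- The given `J` is the parallel field of `q`, so `α` equals α_q on the nose and ξ is a point of
  -- the 2-sphere.
  have h : α = (φ.quaternionicFields hx).contactForm ⟨q, hq, hq1⟩ := by
    refine Subtype.ext (ContMDiffSection.ext fun p ↦ ContinuousLinearMap.ext fun v ↦ ?_)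
    refine (hα p v).trans (Eq.trans ?_ ((φ.quaternionicFields hx).form_apply q p v).symm)
    refine (coneMetric_eq g (p, 1) _ _).trans ?_
    exact congrArg _ (φ.quaternionicFields_eq hx hJ hφ (y := (p, 1)) one_pos (0, 1))
  rw [h]
  exact (φ.quaternionicFields hx).one_le_rank ⟨q, hq, hq1⟩

end
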